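/- Let $\pi\colon E\to M$ be a smooth fibration (a surjective submersion; in particular any smooth fibre bundle) with $\dim M=m\ge 1$ and $\dim E=m+n$, and let $\eta$ be a volume form on $M$. Adapted local coordinates on $E$ are written $(x^i,u^\alpha)$, and $d^mx=dx^1\wedge\dots\wedge dx^m$, $d^{m-1}x_i=i_{\partial/\partial x^i}d^mx$. *Notation.* Let $J^1\pi$ be the first jet manifold of $\pi$, with projection $\pi_1\colon J^1\pi\to M$ and coordinates $(x^i,u^\alpha,u^\alpha_i)$. For a fibration $N\to M$ let $\Lambda^k_rN$ be the bundle over $N$ of those $k$-forms on $N$ that vanish when contracted with any $r$ vectors vertical over $M$ (no condition if $r>k$). It carries the tautological $k$-form $\Theta$ (at a point $\omega\in\Lambda^k_rN$, the pull-back of $\omega$ by $\Lambda^k_rN\to N$) and the form $\Omega_{\Lambda^k_rN}=-d\Theta$. Let $\nu\colon\mathcal M\pi=\Lambda^m_2E\to E$, whose elements are written $p\,d^mx+p^i_\alpha\,du^\alpha\wedge d^{m-1}x_i$, and let $J^1(\pi\circ\nu)$ be the first jet manifold of $\pi\circ\nu\colon\mathcal M\pi\to M$, with induced coordinates $(x^i,u^\alpha,p,p^i_\alpha,u^\alpha_j,p_j,p^i_{\alpha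 j})$. The Tulczyjew morphism $A_\pi^\eta\colon J^1(\pi\circ\nu)\to\Lambda^{m+1}_2J^1\pi$, over the projection $J^1(\pi\circ\nu)\to J^1\pi$, is given in any such coordinates by $$A_\pi^\eta(x^i,u^\alpha,p,p^i_\alpha,u^\alpha_j,p_j,p^i_{\alpha j})=(p^i_{\alpha i}\,du^\alpha+p^i_\alpha\,du^\alpha_i)\wedge d^mx .$$ Put $\widetilde\Omega=(A_\pi^\eta)^*\Omega_{\Lambda^{m+1}_2J^1\pi}$, an $(m+2)$-form on $J^1(\pi\circ\nu)$. *Lagrangian submanifolds.* Let $\Omega$ be a closed (premultisymplectic) smooth $(k+1)$-form on a manifold $P$, and $1\le l\le k$. Let $\ker\Omega_p=\{v : i_v\Omega_p=0\}$, let $\overline\Omega_p$ be the form induced by $\Omega_p$ on $\overline V_p=T_pP/\ker\Omega_p$, and for a subspace $W\subseteq\overline V_p$ put $W^{\perp,l}=\{v\in\overline V_p : i_{v\wedge w_1\wedge\dots\wedge w_l}\overline\Omega_p=0\text{ for all }w_1,\dots,w_l\in W\}$. An (embedded) submanifold $S\subseteq P$ is *$l$-Lagrangian* if for every $p\in S$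 the image $W$ of $T_pS$ in $\overline V_p$ satisfies $W=W^{\perp,l}$. **Proposition.** Let $L\colon J^1\pi\to\mathbb R$ be smooth and let $\mathcal L=L\eta$ be the corresponding Lagrangian density, regarded as the $m$-form $L\,\pi_1^*\eta$ on $J^1\pi$, so that $d\mathcal L$ is a section of $\Lambda^{m+1}_2J^1\pi\to J^1\pi$. Then $(J^1(\pi\circ\nu),\widetilde\Omega)$ is a premultisymplectic manifold (that is, $\widetilde\Omega$ is smooth and closed), and the set $$S_{\mathcal L}=(A_\pi^\eta)^{-1}\bigl(d\mathcal L(J^1\pi)\bigr)$$ is an $(m+1)$-Lagrangian submanifold of it. -/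

import Mathlib

open Set Function Manifold
open scoped Manifold ContDiff Topology

set_option linter.unusedSectionVars false

noncomputable section

namespace FieldTheory

section AtlasConstruction

/-- A family of coordinate systems on a bare set `X`, with values in a normed space `V`,
covering `X`, with open overlaps and smooth changes of coordinates. -/
structure SmoothCharts (ι X V : Type*) [NormedAddCommGroup V] [NormedSpace ℝ V] where
  chart : ι → PartialEquiv X V
  index : X → ι
  mem_source : ∀ x, x ∈ (chart (index x)).source
  open_overlap : ∀ i j, IsOpen ((chart i).symm.trans (chart j)).source
  smooth : ∀ i j, ContDiffOn ℝ ∞ ((chart i).symm.trans (chart j))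
    ((chart i).symm.trans (chart j)).source

namespace SmoothCharts

variable {ι X V : Type*} [NormedAddCommGroup V] [NormedSpace ℝ V] (A : SmoothCharts ι X V)

def core : ChartedSpaceCore V X where
  atlas := range A.chart
  chartAt x := A.chart (A.index x)
  mem_chart_source := A.mem_source
  chart_mem_atlas x := ⟨_, rfl⟩
  open_source := by
    rintro _ _ ⟨i, rfl⟩ ⟨j, rfl⟩
    exact A.open_overlap i j
  continuousOn_toFun := by
    rintro _ _ ⟨i, rfl⟩ ⟨j, rfl⟩
    exact (A.smooth i j).continuousOn

/-- The topology for which all the given coordinate systems are homeomorphisms. -/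
@[reducible] def topologicalSpace : TopologicalSpace X := A.core.toTopologicalSpace

/-- The charted space whose atlas is the given family of coordinate systems. -/
@[reducible] def chartedSpace : @ChartedSpace V _ X A.topologicalSpace := A.core.toChartedSpace

def toHomeo (i : ι) : @OpenPartialHomeomorph X V A.topologicalSpace _ :=
  A.core.openPartialHomeomorph (A.chart i) ⟨i, rfl⟩

theorem isManifold :
    @IsManifold ℝ _ V _ _ V _ 𝓘(ℝ, V) ∞ X A.topologicalSpace A.chartedSpace := by
  let _ := A.topologicalSpace
  let _ := A.chartedSpace
  refine isManifold_of_contDiffOn 𝓘(ℝ, V) ∞ X ?_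
  intro e e' he he'
  obtain ⟨_, ⟨i, rfl⟩, rfl⟩ : ∃ a, ∃ h : a ∈ range A.chart,
      e = A.core.openPartialHomeomorph a h := by
    obtain ⟨a, ha⟩ := mem_iUnion.1 he
    obtain ⟨h, hh⟩ := mem_iUnion.1 ha
    exact ⟨a, h, hh⟩
  obtain ⟨_, ⟨j, rfl⟩, rfl⟩ : ∃ a, ∃ h : a ∈ range A.chart,
      e' = A.core.openPartialHomeomorph a h := by
    obtain ⟨a, ha⟩ := mem_iUnion.1 he'
    obtain ⟨h, hh⟩ := mem_iUnion.1 ha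
    exact ⟨a, h, hh⟩
  exact (A.smooth i j).congr_mono (fun x hx => rfl) (fun x hx => hx.1)

theorem toHomeo_mem (i : ι) :
    A.toHomeo i ∈ @atlas V _ X A.topologicalSpace A.chartedSpace := by
  let _ := A.topologicalSpace
  let _ := A.chartedSpace
  simp only [atlas, ChartedSpace.atlas, mem_iUnion, mem_singleton_iff]
  exact ⟨A.chart i, ⟨i, rfl⟩, rfl⟩

end SmoothCharts
end AtlasConstruction

section FiberedManifolds

theorem trans_linear_mem_maximalAtlas {V X : Type*} [NormedAddCommGroup V] [NormedSpace ℝ V]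
    [TopologicalSpace X] [ChartedSpace V X] {φ : OpenPartialHomeomorph X V}
    (hφ : φ ∈ IsManifold.maximalAtlas 𝓘(ℝ, V) ∞ X) (e : V ≃L[ℝ] V) :
    φ.trans e.toHomeomorph.toOpenPartialHomeomorph ∈ IsManifold.maximalAtlas 𝓘(ℝ, V) ∞ X := by
  have he : e.toHomeomorph.toOpenPartialHomeomorph ∈ contDiffGroupoid ∞ 𝓘(ℝ, V) := by
    rw [contDiffGroupoid, mem_groupoid_of_pregroupoid]
    exact ⟨(contDiffOn_univ.2 e.contDiff).mono (subset_univ _),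
      (contDiffOn_univ.2 e.symm.contDiff).mono (subset_univ _)⟩
  refine mem_maximalAtlas_iff.2 fun e' he' => ?_
  obtain ⟨h₁, h₂⟩ := mem_maximalAtlas_iff.1 hφ e' he'
  constructor
  · have h := StructureGroupoid.trans _ (StructureGroupoid.symm _ he) h₁
    rwa [← OpenPartialHomeomorph.trans_assoc,
      ← OpenPartialHomeomorph.trans_symm_eq_symm_trans_symm] at h
  · have h := StructureGroupoid.trans _ h₂ he
    rwa [OpenPartialHomeomorph.trans_assoc] at h

variable (B F : Type*) [NormedAddCommGroup B] [NormedSpace ℝ B] [FiniteDimensional ℝ B]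
  [NormedAddCommGroup F] [NormedSpace ℝ F] [FiniteDimensional ℝ F]
  {M E : Type*} [TopologicalSpace M] [ChartedSpace B M]
  [TopologicalSpace E] [ChartedSpace (B × F) E]

/-- `π : E → M` is a smooth submersion. The base manifold is modelled on `B` and the total space
on `B × F`, so the fibres have dimension `dim F`. -/
class IsFibered (π : E → M) : Prop where
  isSubmersion : IsSubmersion 𝓘(ℝ, B × F) 𝓘(ℝ, B) ∞ π

/-- Adapted (fibered) coordinates `(x, u)` on `E`: smooth charts of `E` and `M` in which `π` is
the projection `(x, u) ↦ x`. -/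
structure FiberedChart (π : E → M) where
  base : OpenPartialHomeomorph M B
  base_mem : base ∈ IsManifold.maximalAtlas 𝓘(ℝ, B) ∞ M
  total : OpenPartialHomeomorph E (B × F)
  total_mem : total ∈ IsManifold.maximalAtlas 𝓘(ℝ, B × F) ∞ E
  mapsTo : ∀ u ∈ total.source, π u ∈ base.source
  comm : ∀ u ∈ total.source, (total u).1 = base (π u)

variable {B F}
variable {π : E → M}

theorem IsFibered.contMDiff (h : IsFibered B F π) : ContMDiff 𝓘(ℝ, B × F) 𝓘(ℝ, B) ∞ π :=
  h.isSubmersion.contMDiff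

theorem IsFibered.of_charts (h : ∀ u : E, ∃ c : FiberedChart B F π, u ∈ c.total.source) :
    IsFibered B F π := by
  refine ⟨Manifold.IsSubmersionOfComplement.isSubmersion (F := F) fun u => ?_⟩
  obtain ⟨c, hc⟩ := h u
  refine Manifold.IsSubmersionAtOfComplement.mk_of_charts (ContinuousLinearEquiv.refl ℝ _) c.total
    c.base hc (c.mapsTo u hc) c.total_mem c.base_mem (fun v hv => c.mapsTo v hv) ?_
  intro y hy
  have hy' : y ∈ c.total.target := by simpa using hy
  have := c.comm _ (c.total.map_target hy')
  rw [c.total.right_inv hy'] at this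
  simpa using this.symm

theorem FiberedChart.exists_mem [h : IsFibered B F π] (u : E) :
    ∃ c : FiberedChart B F π, u ∈ c.total.source := by
  obtain ⟨F', _, _, hF⟩ := h.isSubmersion
  have hu := hF u
  let e₀ := hu.equiv
  have : FiniteDimensional ℝ (B × F') := e₀.toLinearEquiv.finiteDimensional
  have : FiniteDimensional ℝ F' :=
    FiniteDimensional.of_surjective (LinearMap.snd ℝ B F') LinearMap.snd_surjective
  have hd : Module.finrank ℝ F' = Module.finrank ℝ F := by
    have := e₀.toLinearEquiv.finrank_eq
    simp only [Module.finrank_prod] at this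
    omega
  let g : F' ≃L[ℝ] F := ContinuousLinearEquiv.ofFinrankEq hd
  let e : (B × F) ≃L[ℝ] (B × F) := e₀.trans ((ContinuousLinearEquiv.refl ℝ B).prodCongr g)
  have hwr := hu.writtenInCharts
  refine ⟨⟨hu.codChart, hu.codChart_mem_maximalAtlas,
    hu.domChart.trans e.toHomeomorph.toOpenPartialHomeomorph, ?_, ?_, ?_⟩, ?_⟩
  · exact trans_linear_mem_maximalAtlas hu.domChart_mem_maximalAtlas e
  · intro v hv
    exact hu.source_subset_preimage_source (by simpa using hv)
  · intro v hv
    have hv' : v ∈ hu.domChart.source := by simpa using hv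
    have := hwr (x := hu.domChart v) (by simpa using hu.domChart.map_source hv')
    simpa [hu.domChart.left_inv hv', e] using this.symm
  · simpa using hu.mem_domChart_source

/-- A chosen system of adapted coordinates around a point of the total space. -/
def FiberedChart.around [IsFibered B F π] (u : E) : FiberedChart B F π :=
  (FiberedChart.exists_mem u).choose

theorem FiberedChart.mem_around [IsFibered B F π] (u : E) :
    u ∈ (FiberedChart.around (B := B) (F := F) (π := π) u).total.source :=
  (FiberedChart.exists_mem u).choose_spec

end FiberedManifolds

section Differentials

variable {V W X Y : Type*} [NormedAddCommGroup V] [NormedSpace ℝ V] [NormedAddCommGroup W]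
  [NormedSpace ℝ W] [TopologicalSpace X] [ChartedSpace V X] [TopologicalSpace Y] [ChartedSpace W Y]

variable (V W) in
/-- The differential `T_x X → T_{f x} Y` of a map between manifolds modelled on `V` and `W`. The
tangent space `TangentSpace 𝓘(ℝ, V) x` is by definition a copy of `V`, and we drop the copy. -/
def dmap (f : X → Y) (x : X) : V →L[ℝ] W := mfderiv 𝓘(ℝ, V) 𝓘(ℝ, W) f x

theorem dmap_comp {U Z : Type*} [NormedAddCommGroup U] [NormedSpace ℝ U] [TopologicalSpace Z]
    [ChartedSpace U Z] {g : Y → Z} {f : X → Y} {x : X}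
    (hg : MDifferentiableAt 𝓘(ℝ, W) 𝓘(ℝ, U) g (f x))
    (hf : MDifferentiableAt 𝓘(ℝ, V) 𝓘(ℝ, W) f x) :
    dmap V U (g ∘ f) x = (dmap W U g (f x)).comp (dmap V W f x) :=
  mfderiv_comp x hg hf

variable [IsManifold 𝓘(ℝ, V) ∞ X]
variable {φ φ' : OpenPartialHomeomorph X V}

theorem mdiff_chart (hφ : φ ∈ IsManifold.maximalAtlas 𝓘(ℝ, V) ∞ X) {x : X} (hx : x ∈ φ.source) :
    MDifferentiableAt 𝓘(ℝ, V) 𝓘(ℝ, V) φ x :=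
  (contMDiffAt_of_mem_maximalAtlas hφ hx).mdifferentiableAt (by simp)

theorem mdiff_chart_symm (hφ : φ ∈ IsManifold.maximalAtlas 𝓘(ℝ, V) ∞ X) {y : V}
    (hy : y ∈ φ.target) : MDifferentiableAt 𝓘(ℝ, V) 𝓘(ℝ, V) φ.symm y :=
  (contMDiffAt_symm_of_mem_maximalAtlas hφ hy).mdifferentiableAt (by simp)

theorem dmap_chart_trans (hφ : φ ∈ IsManifold.maximalAtlas 𝓘(ℝ, V) ∞ X)
    (hφ' : φ' ∈ IsManifold.maximalAtlas 𝓘(ℝ, V) ∞ X) {y : V} (hy : y ∈ φ.target)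
    (hy' : φ.symm y ∈ φ'.source) :
    (dmap V V φ' (φ.symm y)).comp (dmap V V φ.symm y) = fderiv ℝ (φ' ∘ φ.symm) y := by
  rw [← dmap_comp (mdiff_chart hφ' hy') (mdiff_chart_symm hφ hy)]
  exact mfderiv_eq_fderiv

theorem dmap_chart_symm_comp (hφ : φ ∈ IsManifold.maximalAtlas 𝓘(ℝ, V) ∞ X) {x : X}
    (hx : x ∈ φ.source) :
    (dmap V V φ.symm (φ x)).comp (dmap V V φ x) = ContinuousLinearMap.id ℝ V := by
  have h : OpenPartialHomeomorph.MDifferentiable 𝓘(ℝ, V) 𝓘(ℝ, V) φ :=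
    ⟨fun x hx => (mdiff_chart hφ hx).mdifferentiableWithinAt,
      fun x hx => (mdiff_chart_symm hφ hx).mdifferentiableWithinAt⟩
  exact h.symm_comp_deriv hx

theorem dmap_chart_comp_symm (hφ : φ ∈ IsManifold.maximalAtlas 𝓘(ℝ, V) ∞ X) {y : V}
    (hy : y ∈ φ.target) :
    (dmap V V φ (φ.symm y)).comp (dmap V V φ.symm y) = ContinuousLinearMap.id ℝ V := by
  have h : OpenPartialHomeomorph.MDifferentiable 𝓘(ℝ, V) 𝓘(ℝ, V) φ :=
    ⟨fun x hx => (mdiff_chart hφ hx).mdifferentiableWithinAt,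
      fun x hx => (mdiff_chart_symm hφ hx).mdifferentiableWithinAt⟩
  exact h.comp_symm_deriv hy

theorem contDiffOn_chart_trans (hφ : φ ∈ IsManifold.maximalAtlas 𝓘(ℝ, V) ∞ X)
    (hφ' : φ' ∈ IsManifold.maximalAtlas 𝓘(ℝ, V) ∞ X) :
    ContDiffOn ℝ ∞ (φ' ∘ φ.symm) (φ.symm.trans φ').source := by
  rw [← contMDiffOn_iff_contDiffOn]
  refine (contMDiffOn_of_mem_maximalAtlas hφ').comp
    ((contMDiffOn_symm_of_mem_maximalAtlas hφ).mono fun y hy => hy.1) fun y hy => hy.2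

theorem contDiffOn_fderiv_chart_trans (hφ : φ ∈ IsManifold.maximalAtlas 𝓘(ℝ, V) ∞ X)
    (hφ' : φ' ∈ IsManifold.maximalAtlas 𝓘(ℝ, V) ∞ X) :
    ContDiffOn ℝ ∞ (fderiv ℝ (φ' ∘ φ.symm)) (φ.symm.trans φ').source :=
  (contDiffOn_chart_trans hφ hφ').fderiv_of_isOpen (φ.symm.trans φ').open_source (by simp)

end Differentials

section FiberedManifolds

variable {B F : Type*} [NormedAddCommGroup B] [NormedSpace ℝ B] [FiniteDimensional ℝ B]
  [NormedAddCommGroup F] [NormedSpace ℝ F] [FiniteDimensional ℝ F]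
  {M E : Type*} [TopologicalSpace M] [ChartedSpace B M] [IsManifold 𝓘(ℝ, B) ∞ M]
  [TopologicalSpace E] [ChartedSpace (B × F) E] [IsManifold 𝓘(ℝ, B × F) ∞ E] {π : E → M}

namespace FiberedChart

theorem fst_comp_dmap [h : IsFibered B F π] (c : FiberedChart B F π) {u : E}
    (hu : u ∈ c.total.source) :
    (ContinuousLinearMap.fst ℝ B F).comp (dmap (B × F) (B × F) c.total u) =
      (dmap B B c.base (π u)).comp (dmap (B × F) B π u) := by
  rw [← dmap_comp (mdiff_chart c.base_mem (c.mapsTo u hu))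
    (h.contMDiff.mdifferentiable (by simp) u)]
  have h1 : dmap (B × F) B (Prod.fst : B × F → B) (c.total u) = ContinuousLinearMap.fst ℝ B F := by
    rw [dmap, mfderiv_eq_fderiv]; exact fderiv_fst
  rw [← h1, ← dmap_comp (differentiableAt_fst.mdifferentiableAt) (mdiff_chart c.total_mem hu)]
  refine Filter.EventuallyEq.mfderiv_eq ?_
  filter_upwards [c.total.open_source.mem_nhds hu] with v hv using c.comm v hv

theorem dmap_proj_comp_symm [h : IsFibered B F π] (c : FiberedChart B F π) {y : B × F}
    (hy : y ∈ c.total.target) :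
    (dmap (B × F) B π (c.total.symm y)).comp (dmap (B × F) (B × F) c.total.symm y) =
      (dmap B B c.base.symm y.1).comp (ContinuousLinearMap.fst ℝ B F) := by
  have hu := c.total.map_target hy
  have hb := c.mapsTo _ hu
  have hy1 : c.base (π (c.total.symm y)) = y.1 := by
    rw [← c.comm _ hu, c.total.right_inv hy]
  have h1 := congrArg (fun T => ((dmap B B c.base.symm y.1).comp T).comp
    (dmap (B × F) (B × F) c.total.symm y)) (c.fst_comp_dmap hu)
  simp only [ContinuousLinearMap.comp_assoc, dmap_chart_comp_symm c.total_mem hy,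
    ContinuousLinearMap.comp_id] at h1
  rw [h1, ← hy1, ← ContinuousLinearMap.comp_assoc (dmap B B c.base.symm _),
    dmap_chart_symm_comp c.base_mem hb, ContinuousLinearMap.id_comp]

theorem base_proj (c : FiberedChart B F π) {y : B × F} (hy : y ∈ c.total.target) :
    c.base (π (c.total.symm y)) = y.1 := by
  rw [← c.comm _ (c.total.map_target hy), c.total.right_inv hy]

end FiberedChart

end FiberedManifolds

section Jets

variable (B F : Type*) [NormedAddCommGroup B] [NormedSpace ℝ B] [FiniteDimensional ℝ B]
  [NormedAddCommGroup F] [NormedSpace ℝ F] [FiniteDimensional ℝ F]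
  {M E : Type*} [TopologicalSpace M] [ChartedSpace B M] [IsManifold 𝓘(ℝ, B) ∞ M]
  [TopologicalSpace E] [ChartedSpace (B × F) E] [IsManifold 𝓘(ℝ, B × F) ∞ E]

/-- The first jet manifold `J¹π`: a jet at `x ∈ M` is a point `u` of the fibre over `x` together
with a linear map `z : T_x M → T_u E` such that `T_u π ∘ z = id`. (Tangent spaces of `M` and `E` are
copies of `B` and `B × F`.) -/
@[ext]
structure J1 (π : E → M) where
  pt : E
  lin : B →L[ℝ] B × F
  isSection : (dmap (B × F) B π pt).comp lin = ContinuousLinearMap.id ℝ B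

variable {B F} {π : E → M}

namespace J1

/-- The projection `π₁ : J¹π → M`. -/
def toBase (z : J1 B F π) : M := π z.pt

/-- The jet with coordinates `(y, A)`, where `y = (x, u)`. -/
def ofCoord [IsFibered B F π] (c : FiberedChart B F π) (y : B × F) (hy : y ∈ c.total.target)
    (A : B →L[ℝ] F) : J1 B F π where
  pt := c.total.symm y
  lin := (dmap (B × F) (B × F) c.total.symm y).comp
    (((ContinuousLinearMap.id ℝ B).prod A).comp (dmap B B c.base (π (c.total.symm y))))
  isSection := by
    have h : (ContinuousLinearMap.fst ℝ B F).comp ((ContinuousLinearMap.id ℝ B).prod A) =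
      ContinuousLinearMap.id ℝ B := ContinuousLinearMap.fst_comp_prod _ _
    rw [← ContinuousLinearMap.comp_assoc, c.dmap_proj_comp_symm hy,
      ContinuousLinearMap.comp_assoc, ← ContinuousLinearMap.comp_assoc _ _ (dmap B B c.base _), h,
      ContinuousLinearMap.id_comp, ← c.base_proj hy,
      dmap_chart_symm_comp c.base_mem (c.mapsTo _ (c.total.map_target hy))]

theorem nonempty_of_point [IsFibered B F π] (u : E) : Nonempty (J1 B F π) :=
  ⟨ofCoord (FiberedChart.around u) _ ((FiberedChart.around u).total.map_source (FiberedChart.mem_around u)) 0⟩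

/-- The derivative coordinates `u^α_i` of a jet, as a linear map `B → F`. -/
def slope (c : FiberedChart B F π) (z : J1 B F π) : B →L[ℝ] F :=
  (ContinuousLinearMap.snd ℝ B F).comp ((dmap (B × F) (B × F) c.total z.pt).comp
    (z.lin.comp (dmap B B c.base.symm (c.base (π z.pt)))))

theorem prod_slope [IsFibered B F π] (c : FiberedChart B F π) (z : J1 B F π)
    (hz : z.pt ∈ c.total.source) :
    (ContinuousLinearMap.id ℝ B).prod (z.slope c) = (dmap (B × F) (B × F) c.total z.pt).comp
      (z.lin.comp (dmap B B c.base.symm (c.base (π z.pt)))) := by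
  have h : (ContinuousLinearMap.fst ℝ B F).comp ((dmap (B × F) (B × F) c.total z.pt).comp
      (z.lin.comp (dmap B B c.base.symm (c.base (π z.pt))))) =
      ContinuousLinearMap.id ℝ B := by
    have hs : (dmap (B × F) B π z.pt).comp z.lin = ContinuousLinearMap.id ℝ B :=
      z.isSection
    have hb := c.mapsTo _ hz
    rw [← ContinuousLinearMap.comp_assoc, c.fst_comp_dmap hz, ContinuousLinearMap.comp_assoc,
      ← ContinuousLinearMap.comp_assoc (dmap (B × F) B π z.pt), hs, ContinuousLinearMap.id_comp]
    have := dmap_chart_comp_symm c.base_mem (c.base.map_source hb)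
    rwa [c.base.left_inv hb] at this
  ext1 v
  exact Prod.ext (congrArg (fun T => T v) h).symm rfl

open Classical in
/-- The coordinates `(x, u, u_x)` on `J¹π` induced by adapted coordinates `(x, u)` on `E`. -/
def chart [IsFibered B F π] (c : FiberedChart B F π) :
    PartialEquiv (J1 B F π) (B × (F × (B →L[ℝ] F))) where
  toFun z := ((c.total z.pt).1, ((c.total z.pt).2, z.slope c))
  invFun w := if h : (w.1, w.2.1) ∈ c.total.target then ofCoord c (w.1, w.2.1) h w.2.2
    else (nonempty_of_point (c.total.symm (w.1, w.2.1))).some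
  source := {z | z.pt ∈ c.total.source}
  target := {w | (w.1, w.2.1) ∈ c.total.target}
  map_source' z hz := c.total.map_source hz
  map_target' w hw := by
    rw [mem_ofPred_eq] at hw
    rw [dif_pos hw]
    exact c.total.map_target hw
  left_inv' z hz := by
    have hz' : z.pt ∈ c.total.source := hz
    have ht := c.total.map_source hz'
    rw [dif_pos (show ((c.total z.pt).1, (c.total z.pt).2) ∈ c.total.target from ht)]
    refine J1.ext (c.total.left_inv hz') ?_
    change (dmap (B × F) (B × F) c.total.symm (c.total z.pt)).comp
      (((ContinuousLinearMap.id ℝ B).prod (z.slope c)).comp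
        (dmap B B c.base (π (c.total.symm (c.total z.pt))))) = _
    rw [prod_slope c z hz', c.total.left_inv hz', ← ContinuousLinearMap.comp_assoc,
      ← ContinuousLinearMap.comp_assoc, dmap_chart_symm_comp c.total_mem hz',
      ContinuousLinearMap.id_comp, ContinuousLinearMap.comp_assoc,
      dmap_chart_symm_comp c.base_mem (c.mapsTo _ hz'), ContinuousLinearMap.comp_id]
  right_inv' w hw := by
    have hw' : (w.1, w.2.1) ∈ c.total.target := hw
    rw [dif_pos hw']
    have h1 : c.total (ofCoord c (w.1, w.2.1) hw' w.2.2).pt = (w.1, w.2.1) := c.total.right_inv hw'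
    have h2 : (ofCoord c (w.1, w.2.1) hw' w.2.2).slope c = w.2.2 := by
      have hb := c.mapsTo _ (c.total.map_target hw')
      have e1 := dmap_chart_comp_symm c.total_mem hw'
      have e2 := dmap_chart_comp_symm c.base_mem (c.base.map_source hb)
      rw [c.base.left_inv hb] at e2
      change (ContinuousLinearMap.snd ℝ B F).comp
        ((dmap (B × F) (B × F) c.total (c.total.symm (w.1, w.2.1))).comp
        (((dmap (B × F) (B × F) c.total.symm (w.1, w.2.1)).comp
        (((ContinuousLinearMap.id ℝ B).prod w.2.2).comp
          (dmap B B c.base (π (c.total.symm (w.1, w.2.1)))))).comp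
          (dmap B B c.base.symm (c.base (π (c.total.symm (w.1, w.2.1))))))) = _
      rw [ContinuousLinearMap.comp_assoc, ContinuousLinearMap.comp_assoc, e2,
        ContinuousLinearMap.comp_id, ← ContinuousLinearMap.comp_assoc (dmap _ _ c.total _), e1,
        ContinuousLinearMap.id_comp]
      exact ContinuousLinearMap.snd_comp_prod _ _
    rw [h1, h2]

theorem chart_trans_apply [IsFibered B F π] (c c' : FiberedChart B F π)
    {w : B × (F × (B →L[ℝ] F))} (hw : w ∈ ((chart c).symm.trans (chart c')).source) :
    ((chart c).symm.trans (chart c')) w =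
      (((c'.total ∘ c.total.symm) (w.1, w.2.1)).1, (((c'.total ∘ c.total.symm) (w.1, w.2.1)).2,
        (ContinuousLinearMap.snd ℝ B F).comp
          ((fderiv ℝ (c'.total ∘ c.total.symm) (w.1, w.2.1)).comp
            (((ContinuousLinearMap.inl ℝ B F) + (ContinuousLinearMap.inr ℝ B F).comp w.2.2).comp
              (fderiv ℝ (c.base ∘ c'.base.symm)
                ((c'.total ∘ c.total.symm) (w.1, w.2.1)).1))))) := by
  have h1 : (w.1, w.2.1) ∈ c.total.target := hw.1
  have hs : (chart c).symm w = ofCoord c (w.1, w.2.1) h1 w.2.2 := dif_pos h1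
  have h2 : c.total.symm (w.1, w.2.1) ∈ c'.total.source := by
    have : (chart c).symm w ∈ (chart c').source := hw.2
    rw [hs] at this
    exact this
  have hb := c.mapsTo _ (c.total.map_target h1)
  have hb' := c'.mapsTo _ h2
  change chart c' ((chart c).symm w) = _
  rw [hs]
  refine Prod.ext rfl (Prod.ext rfl ?_)
  have e1 := dmap_chart_trans c.total_mem c'.total_mem h1 h2
  have e2 := dmap_chart_trans c'.base_mem c.base_mem (c'.base.map_source hb')
    (by rwa [c'.base.left_inv hb'])
  rw [c'.base.left_inv hb'] at e2
  have e3 : ((c'.total ∘ c.total.symm) (w.1, w.2.1)).1 =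
    c'.base (π (c.total.symm (w.1, w.2.1))) := c'.comm _ h2
  have e4 : (ContinuousLinearMap.inl ℝ B F) + (ContinuousLinearMap.inr ℝ B F).comp w.2.2 =
      (ContinuousLinearMap.id ℝ B).prod w.2.2 := by
    ext v <;> simp
  rw [e3, ← e2, ← e1, e4]
  rfl

theorem chart_trans_source [IsFibered B F π] (c c' : FiberedChart B F π) :
    ((chart c).symm.trans (chart c')).source =
      (fun w : B × (F × (B →L[ℝ] F)) => (w.1, w.2.1)) ⁻¹' (c.total.symm.trans c'.total).source := by
  ext w
  constructor
  · intro hw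
    have h1 : (w.1, w.2.1) ∈ c.total.target := hw.1
    have hs : (chart c).symm w = ofCoord c (w.1, w.2.1) h1 w.2.2 := dif_pos h1
    have : (chart c).symm w ∈ (chart c').source := hw.2
    rw [hs] at this
    exact ⟨h1, this⟩
  · intro hw
    have h1 : (w.1, w.2.1) ∈ c.total.target := hw.1
    have hs : (chart c).symm w = ofCoord c (w.1, w.2.1) h1 w.2.2 := dif_pos h1
    refine ⟨h1, ?_⟩
    change (chart c).symm w ∈ (chart c').source
    rw [hs]
    exact hw.2

variable (B F π) in
/-- The induced coordinate systems on `J¹π`. -/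
def charts [IsFibered B F π] :
    SmoothCharts (FiberedChart B F π) (J1 B F π) (B × (F × (B →L[ℝ] F))) where
  chart := chart
  index z := FiberedChart.around z.pt
  mem_source z := FiberedChart.mem_around z.pt
  open_overlap c c' := by
    rw [chart_trans_source]
    exact (c.total.symm.trans c'.total).open_source.preimage (by fun_prop)
  smooth c c' := by
    have hp : ContDiff ℝ ∞ (fun w : B × (F × (B →L[ℝ] F)) => (w.1, w.2.1)) := by fun_prop
    have hτ := (contDiffOn_chart_trans c.total_mem c'.total_mem).comp hp.contDiffOn
      (s := ((chart c).symm.trans (chart c')).source) (by rw [chart_trans_source]; exact fun _ h => h)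
    have hdτ := (contDiffOn_fderiv_chart_trans c.total_mem c'.total_mem).comp hp.contDiffOn
      (s := ((chart c).symm.trans (chart c')).source) (by rw [chart_trans_source]; exact fun _ h => h)
    have hdσ := (contDiffOn_fderiv_chart_trans c'.base_mem c.base_mem).comp hτ.fst (by
      rw [chart_trans_source]
      intro w hw
      have h2 : π (c.total.symm (w.1, w.2.1)) ∈ c'.base.source := c'.mapsTo _ hw.2
      have e3 : ((c'.total ∘ c.total.symm) (w.1, w.2.1)).1 =
        c'.base (π (c.total.symm (w.1, w.2.1))) := c'.comm _ hw.2
      change ((c'.total ∘ c.total.symm) (w.1, w.2.1)).1 ∈ _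
      rw [e3]
      refine ⟨c'.base.map_source h2, ?_⟩
      change c'.base.symm _ ∈ c.base.source
      rw [c'.base.left_inv h2]
      exact c.mapsTo _ (c.total.map_target hw.1))
    have hA : ContDiffOn ℝ ∞ (fun w : B × (F × (B →L[ℝ] F)) =>
        (ContinuousLinearMap.inl ℝ B F) + (ContinuousLinearMap.inr ℝ B F).comp w.2.2)
        ((chart c).symm.trans (chart c')).source := by
      refine ContDiff.contDiffOn ?_
      exact contDiff_const.add (contDiff_const.clm_comp contDiff_snd.snd)
    refine ContDiffOn.congr ?_ fun w hw => chart_trans_apply c c' hw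
    exact hτ.fst.prodMk (hτ.snd.prodMk (contDiffOn_const.clm_comp
      (hdτ.clm_comp (hA.clm_comp hdσ))))

instance [IsFibered B F π] : TopologicalSpace (J1 B F π) := (charts B F π).topologicalSpace

instance [IsFibered B F π] : ChartedSpace (B × (F × (B →L[ℝ] F))) (J1 B F π) :=
  (charts B F π).chartedSpace

instance [IsFibered B F π] : IsManifold 𝓘(ℝ, B × (F × (B →L[ℝ] F))) ∞ (J1 B F π) :=
  (charts B F π).isManifold

/-- The coordinates on `J¹π` induced by adapted coordinates `c` on `E`, as adapted coordinates for
`π₁ : J¹π → M`: `(x, (u, u_x))`. -/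
def fiberedChart [IsFibered B F π] (c : FiberedChart B F π) :
    FiberedChart B (F × (B →L[ℝ] F)) (toBase : J1 B F π → M) where
  base := c.base
  base_mem := c.base_mem
  total := (charts B F π).toHomeo c
  total_mem := IsManifold.subset_maximalAtlas ((charts B F π).toHomeo_mem c)
  mapsTo z hz := c.mapsTo z.pt hz
  comm z hz := c.comm z.pt hz

instance [IsFibered B F π] : IsFibered B (F × (B →L[ℝ] F)) (toBase : J1 B F π → M) :=
  IsFibered.of_charts fun z => ⟨fiberedChart (FiberedChart.around z.pt), FiberedChart.mem_around z.pt⟩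

end J1

end Jets

section HorizontalForms

variable (B F : Type*) [NormedAddCommGroup B] [NormedSpace ℝ B] [FiniteDimensional ℝ B]
  [NormedAddCommGroup F] [NormedSpace ℝ F] [FiniteDimensional ℝ F]

instance finiteDimensional_forms {V : Type*} [NormedAddCommGroup V] [NormedSpace ℝ V]
    [FiniteDimensional ℝ V] (k : ℕ) : FiniteDimensional ℝ (V [⋀^Fin k]→L[ℝ] ℝ) := by
  let f : (V [⋀^Fin k]→L[ℝ] ℝ) →ₗ[ℝ] MultilinearMap ℝ (fun _ : Fin k => V) ℝ :=
    { toFun := fun α => α.toMultilinearMap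
      map_add' := fun _ _ => rfl
      map_smul' := fun _ _ => rfl }
  refine FiniteDimensional.of_injective f fun a b h => ?_
  ext v
  exact congrArg (fun g : MultilinearMap ℝ (fun _ : Fin k => V) ℝ => g v) h

/-- A `k`-form `α` is `r`-horizontal with respect to a linear map `p` if contracting it with any `r`
vectors of `ker p` gives zero; the condition is void when `r > k`. -/
def IsHorizontal {V W : Type*} [NormedAddCommGroup V] [NormedSpace ℝ V] [NormedAddCommGroup W]
    [NormedSpace ℝ W] (p : V →L[ℝ] W) {k : ℕ} (r : ℕ) (α : V [⋀^Fin k]→L[ℝ] ℝ) : Prop :=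
  r ≤ k → ∀ v : Fin k → V, (∀ i : Fin k, (i : ℕ) < r → p (v i) = 0) → α v = 0

/-- The space of `r`-horizontal `k`-forms on `B × F` with respect to the projection to `B`. -/
def horizontalSubmodule (k r : ℕ) : Submodule ℝ ((B × F) [⋀^Fin k]→L[ℝ] ℝ) where
  carrier := {α | IsHorizontal (ContinuousLinearMap.fst ℝ B F) r α}
  zero_mem' _ _ _ := rfl
  add_mem' ha hb h v hv := by
    simp [ha h v hv, hb h v hv]
  smul_mem' c _ ha h v hv := by
    simp [ha h v hv]

/-- The space of `r`-horizontal `k`-forms on `B × F`, as a normed space. -/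
def HForms (k r : ℕ) : Type _ := horizontalSubmodule B F k r

instance (k r : ℕ) : NormedAddCommGroup (HForms B F k r) :=
  inferInstanceAs (NormedAddCommGroup (horizontalSubmodule B F k r))

instance (k r : ℕ) : NormedSpace ℝ (HForms B F k r) :=
  inferInstanceAs (NormedSpace ℝ (horizontalSubmodule B F k r))

instance (k r : ℕ) : FiniteDimensional ℝ (HForms B F k r) :=
  inferInstanceAs (FiniteDimensional ℝ (horizontalSubmodule B F k r))

variable {B F} in
/-- The form underlying an element of the space of horizontal forms. -/
def HForms.form {k r : ℕ} (a : HForms B F k r) : (B × F) [⋀^Fin k]→L[ℝ] ℝ := a.1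

variable {B F} in
theorem HForms.ext {k r : ℕ} {a b : HForms B F k r} (h : a.form = b.form) : a = b :=
  Subtype.ext h

theorem HForms.contDiff_form (k r : ℕ) :
    ContDiff ℝ ∞ (HForms.form : HForms B F k r → (B × F) [⋀^Fin k]→L[ℝ] ℝ) := by
  have h : ContDiff ℝ ∞ (horizontalSubmodule B F k r).subtypeL := ContinuousLinearMap.contDiff _
  exact h

theorem HForms.exists_retraction (k r : ℕ) :
    ∃ P : ((B × F) [⋀^Fin k]→L[ℝ] ℝ) → HForms B F k r, ContDiff ℝ ∞ P ∧ ∀ a, P a.form = a := by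
  obtain ⟨P, hP⟩ := Submodule.ClosedComplemented.of_finiteDimensional (horizontalSubmodule B F k r)
  have h : ContDiff ℝ ∞ P := ContinuousLinearMap.contDiff _
  exact ⟨P, h, hP⟩

theorem contDiffOn_forms_iff {V U : Type*} [NormedAddCommGroup V] [NormedSpace ℝ V]
    [FiniteDimensional ℝ V] [NormedAddCommGroup U] [NormedSpace ℝ U] {k : ℕ} {s : Set U}
    {f : U → V [⋀^Fin k]→L[ℝ] ℝ} (h : ∀ v, ContDiffOn ℝ ∞ (fun x => f x v) s) :
    ContDiffOn ℝ ∞ f s := by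
  let b := Module.finBasis ℝ V
  let T : (V [⋀^Fin k]→L[ℝ] ℝ) →ₗ[ℝ] ((Fin k → Fin (Module.finrank ℝ V)) → ℝ) :=
    { toFun := fun a v => a (fun i => b (v i))
      map_add' := fun _ _ => rfl
      map_smul' := fun _ _ => rfl }
  have hT : LinearMap.ker T = ⊥ := by
    refine LinearMap.ker_eq_bot.2 fun x y hxy => ?_
    have h1 : x.toMultilinearMap = y.toMultilinearMap :=
      Module.Basis.ext_multilinear (fun _ => b) fun v => congrFun hxy v
    ext v
    exact congrArg (fun g : MultilinearMap ℝ (fun _ : Fin k => V) ℝ => g v) h1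
  obtain ⟨P, hP⟩ := T.exists_leftInverse_of_injective hT
  have h2 : ContDiffOn ℝ ∞ (fun x => T (f x)) s := contDiffOn_pi.2 fun v => h _
  refine ((LinearMap.toContinuousLinearMap P).contDiff.comp_contDiffOn h2).congr fun x _ => ?_
  exact (LinearMap.congr_fun hP (f x)).symm

theorem contDiffOn_pullback {V U : Type*} [NormedAddCommGroup V] [NormedSpace ℝ V]
    [FiniteDimensional ℝ V] [NormedAddCommGroup U] [NormedSpace ℝ U] {k : ℕ} {s : Set U}
    {f : U → V [⋀^Fin k]→L[ℝ] ℝ} {g : U → V →L[ℝ] V} (hf : ContDiffOn ℝ ∞ f s)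
    (hg : ContDiffOn ℝ ∞ g s) :
    ContDiffOn ℝ ∞ (fun x => (f x).compContinuousLinearMap (g x)) s := by
  refine contDiffOn_forms_iff fun v => ?_
  have h1 : ContDiffOn ℝ ∞ (fun x => ContinuousMultilinearMap.compContinuousLinearMapContinuousMultilinear
      ℝ (fun _ : Fin k => V) (fun _ : Fin k => V) ℝ (fun _ => g x)) s :=
    (ContinuousMultilinearMap.contDiff _).comp_contDiffOn (contDiffOn_pi.2 fun _ => hg)
  have h2 : ContDiffOn ℝ ∞ (fun x => (f x).toContinuousMultilinearMap) s :=
    (ContinuousAlternatingMap.toContinuousMultilinearMapLI (𝕜 := ℝ) (E := V) (F := ℝ)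
      (ι := Fin k)).toContinuousLinearMap.contDiff.comp_contDiffOn hf
  exact (ContinuousMultilinearMap.apply ℝ (fun _ : Fin k => V) ℝ v).contDiff.comp_contDiffOn
    (h1.clm_apply h2)

variable {M E : Type*} [TopologicalSpace M] [ChartedSpace B M] [IsManifold 𝓘(ℝ, B) ∞ M]
  [TopologicalSpace E] [ChartedSpace (B × F) E] [IsManifold 𝓘(ℝ, B × F) ∞ E]

/-- The bundle `Λᵏ_r E` of `k`-forms on `E` that are `r`-horizontal with respect to `π : E → M`:
its points are pairs `(u, α)` with `u ∈ E` and `α` an `r`-horizontal alternating form on `T_u E`. -/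
@[ext]
structure Lam (π : E → M) (k r : ℕ) where
  pt : E
  form : (B × F) [⋀^Fin k]→L[ℝ] ℝ
  horizontal : IsHorizontal (dmap (B × F) B π pt) r form

variable {B F} {π : E → M} {k r : ℕ}

namespace Lam

/-- The projection `Λᵏ_r E → M`. -/
def toBase (l : Lam B F π k r) : M := π l.pt

/-- The coefficients of a horizontal form in adapted coordinates. -/
def coeff [IsFibered B F π] (c : FiberedChart B F π) (l : Lam B F π k r)
    (hl : l.pt ∈ c.total.source) : HForms B F k r :=
  ⟨l.form.compContinuousLinearMap (dmap (B × F) (B × F) c.total.symm (c.total l.pt)), by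
    intro h v hv
    refine l.horizontal h _ fun i hi => ?_
    have h1 := c.dmap_proj_comp_symm (c.total.map_source hl)
    rw [c.total.left_inv hl] at h1
    have h2 := congrArg (fun T => T (v i)) h1
    have h3 : (v i).1 = 0 := hv i hi
    simpa [h3] using h2⟩

/-- The horizontal form with given coordinates. -/
def ofCoord [IsFibered B F π] (c : FiberedChart B F π) (y : B × F) (hy : y ∈ c.total.target)
    (α : HForms B F k r) : Lam B F π k r where
  pt := c.total.symm y
  form := α.form.compContinuousLinearMap (dmap (B × F) (B × F) c.total (c.total.symm y))
  horizontal := by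
    intro h v hv
    refine α.2 h _ fun i hi => ?_
    have h1 := congrArg (fun T => T (v i)) (c.fst_comp_dmap (c.total.map_target hy))
    have h2 := hv i hi
    simpa [h2] using h1

open Classical in
/-- The coordinates `(x, u, α)` on `Λᵏ_r E` induced by adapted coordinates `(x, u)` on `E`; the last
entry is the form read in the coordinates, that is, its family of coefficients. -/
def chart [IsFibered B F π] (c : FiberedChart B F π) :
    PartialEquiv (Lam B F π k r) (B × (F × HForms B F k r)) where
  toFun l := ((c.total l.pt).1, ((c.total l.pt).2,
    if h : l.pt ∈ c.total.source then coeff c l h else 0))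
  invFun w := if h : (w.1, w.2.1) ∈ c.total.target then ofCoord c (w.1, w.2.1) h w.2.2
    else ⟨c.total.symm (w.1, w.2.1), 0, fun _ _ _ => rfl⟩
  source := {l | l.pt ∈ c.total.source}
  target := {w | (w.1, w.2.1) ∈ c.total.target}
  map_source' z hz := c.total.map_source hz
  map_target' w hw := by
    rw [mem_ofPred_eq] at hw
    rw [dif_pos hw]
    exact c.total.map_target hw
  left_inv' z hz := by
    have hz' : z.pt ∈ c.total.source := hz
    have ht := c.total.map_source hz'
    rw [dif_pos (show ((c.total z.pt).1, (c.total z.pt).2) ∈ c.total.target from ht), dif_pos hz']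
    refine Lam.ext (c.total.left_inv hz') ?_
    have h1 := dmap_chart_symm_comp c.total_mem hz'
    ext v
    change z.form (fun i => (dmap (B × F) (B × F) c.total.symm (c.total z.pt))
      (dmap (B × F) (B × F) c.total (c.total.symm (c.total z.pt)) (v i))) = z.form v
    rw [c.total.left_inv hz']
    congr 1
    ext1 i
    exact congrArg (fun T => T (v i)) h1
  right_inv' w hw := by
    have hw' : (w.1, w.2.1) ∈ c.total.target := hw
    rw [dif_pos hw']
    have h1 : c.total (ofCoord c (w.1, w.2.1) hw' w.2.2).pt = (w.1, w.2.1) := c.total.right_inv hw'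
    have h0 : (ofCoord c (w.1, w.2.1) hw' w.2.2).pt ∈ c.total.source := c.total.map_target hw'
    have h2 : coeff c (ofCoord c (w.1, w.2.1) hw' w.2.2) h0 = w.2.2 := by
      have e1 := dmap_chart_comp_symm c.total_mem hw'
      refine HForms.ext ?_
      ext v
      change w.2.2.form (fun i => (dmap (B × F) (B × F) c.total (c.total.symm (w.1, w.2.1)))
        (dmap (B × F) (B × F) c.total.symm (c.total (c.total.symm (w.1, w.2.1))) (v i))) = w.2.2.form v
      rw [c.total.right_inv hw']
      congr 1
      ext1 i
      exact congrArg (fun T => T (v i)) e1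
    rw [dif_pos h0, h1, h2]

theorem chart_symm_apply [IsFibered B F π] (c : FiberedChart B F π)
    {w : B × (F × HForms B F k r)} (hw : (w.1, w.2.1) ∈ c.total.target) :
    (chart c).symm w = ofCoord c (w.1, w.2.1) hw w.2.2 := dif_pos hw

theorem chart_trans_source [IsFibered B F π] (c c' : FiberedChart B F π) :
    ((chart (k := k) (r := r) c).symm.trans (chart c')).source =
      (fun w : B × (F × HForms B F k r) => (w.1, w.2.1)) ⁻¹'
        (c.total.symm.trans c'.total).source := by
  ext w
  constructor
  · intro hw
    have h1 : (w.1, w.2.1) ∈ c.total.target := hw.1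
    have : (chart c).symm w ∈ (chart (k := k) (r := r) c').source := hw.2
    rw [chart_symm_apply c h1] at this
    exact ⟨h1, this⟩
  · intro hw
    have h1 : (w.1, w.2.1) ∈ c.total.target := hw.1
    refine ⟨h1, ?_⟩
    change (chart c).symm w ∈ (chart (k := k) (r := r) c').source
    rw [chart_symm_apply c h1]
    exact hw.2

theorem chart_trans_apply [IsFibered B F π] (c c' : FiberedChart B F π)
    {w : B × (F × HForms B F k r)} (hw : w ∈ ((chart (k := k) (r := r) c).symm.trans (chart c')).source) :
    (((chart c).symm.trans (chart c')) w).1 = ((c'.total ∘ c.total.symm) (w.1, w.2.1)).1 ∧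
    (((chart c).symm.trans (chart c')) w).2.1 = ((c'.total ∘ c.total.symm) (w.1, w.2.1)).2 ∧
    (((chart c).symm.trans (chart c')) w).2.2.form =
      w.2.2.form.compContinuousLinearMap
        (fderiv ℝ (c.total ∘ c'.total.symm) ((c'.total ∘ c.total.symm) (w.1, w.2.1))) := by
  have hw' := hw
  rw [chart_trans_source] at hw'
  have h1 : (w.1, w.2.1) ∈ c.total.target := hw'.1
  have h2 : c.total.symm (w.1, w.2.1) ∈ c'.total.source := hw'.2
  change (chart c' ((chart c).symm w)).1 = _ ∧ (chart c' ((chart c).symm w)).2.1 = _ ∧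
    (chart c' ((chart c).symm w)).2.2.form = _
  rw [chart_symm_apply c h1]
  refine ⟨rfl, rfl, ?_⟩
  have h0 : (ofCoord c (w.1, w.2.1) h1 w.2.2).pt ∈ c'.total.source := h2
  have h3 : (chart c' (ofCoord c (w.1, w.2.1) h1 w.2.2)).2.2 =
    coeff c' (ofCoord c (w.1, w.2.1) h1 w.2.2) h0 := dif_pos h0
  rw [h3]
  have e1 := dmap_chart_trans c'.total_mem c.total_mem (c'.total.map_source h2)
    (by rw [c'.total.left_inv h2]; exact c.total.map_target h1)
  rw [c'.total.left_inv h2] at e1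
  change _ = w.2.2.form.compContinuousLinearMap
    (fderiv ℝ (c.total ∘ c'.total.symm) (c'.total (c.total.symm (w.1, w.2.1))))
  rw [← e1]
  rfl

variable (B F π k r) in
/-- The induced coordinate systems on `Λᵏ_r E`. -/
def charts [IsFibered B F π] :
    SmoothCharts (FiberedChart B F π) (Lam B F π k r) (B × (F × HForms B F k r)) where
  chart := chart
  index z := FiberedChart.around z.pt
  mem_source z := FiberedChart.mem_around z.pt
  open_overlap c c' := by
    rw [chart_trans_source]
    exact (c.total.symm.trans c'.total).open_source.preimage (by fun_prop)
  smooth c c' := by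
    set S := ((chart (k := k) (r := r) c).symm.trans (chart c')).source with hS
    have hp : ContDiff ℝ ∞ (fun w : B × (F × HForms B F k r) => (w.1, w.2.1)) := by fun_prop
    have hτ := (contDiffOn_chart_trans c.total_mem c'.total_mem).comp hp.contDiffOn
      (s := S) (by rw [hS, chart_trans_source]; exact fun _ h => h)
    have hdτ := (contDiffOn_fderiv_chart_trans c'.total_mem c.total_mem).comp hτ (by
      rw [hS, chart_trans_source]
      intro w hw
      refine ⟨c'.total.map_source hw.2, ?_⟩
      change c'.total.symm (c'.total (c.total.symm (w.1, w.2.1))) ∈ c.total.source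
      have h2 : c.total.symm (w.1, w.2.1) ∈ c'.total.source := hw.2
      rw [c'.total.left_inv h2]
      exact c.total.map_target hw.1)
    obtain ⟨P, hPc, hP⟩ := HForms.exists_retraction B F k r
    have hα : ContDiffOn ℝ ∞ (fun w : B × (F × HForms B F k r) => w.2.2.form) S :=
      ((HForms.contDiff_form B F k r).comp contDiff_snd.snd).contDiffOn
    have hmain := hPc.comp_contDiffOn (contDiffOn_pullback hα hdτ)
    refine ContDiffOn.congr (hτ.fst.prodMk (hτ.snd.prodMk hmain)) fun w hw => ?_
    obtain ⟨a, b, d⟩ := chart_trans_apply c c' hw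
    refine Prod.ext a (Prod.ext b ?_)
    have := congrArg P d
    have hP' := hP (((chart c).symm.trans (chart c')) w).2.2
    exact hP'.symm.trans this

instance [IsFibered B F π] : TopologicalSpace (Lam B F π k r) := (charts B F π k r).topologicalSpace

instance [IsFibered B F π] : ChartedSpace (B × (F × HForms B F k r)) (Lam B F π k r) :=
  (charts B F π k r).chartedSpace

instance [IsFibered B F π] : IsManifold 𝓘(ℝ, B × (F × HForms B F k r)) ∞ (Lam B F π k r) :=
  (charts B F π k r).isManifold

/-- The coordinates on `Λᵏ_r E` induced by adapted coordinates `c` on `E`, as adapted coordinates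
for the projection to `M`: `(x, (u, ω))`. -/
def fiberedChart [IsFibered B F π] (c : FiberedChart B F π) :
    FiberedChart B (F × HForms B F k r) (toBase : Lam B F π k r → M) where
  base := c.base
  base_mem := c.base_mem
  total := (charts B F π k r).toHomeo c
  total_mem := IsManifold.subset_maximalAtlas ((charts B F π k r).toHomeo_mem c)
  mapsTo z hz := c.mapsTo z.pt hz
  comm z hz := c.comm z.pt hz

instance [IsFibered B F π] : IsFibered B (F × HForms B F k r) (toBase : Lam B F π k r → M) :=
  IsFibered.of_charts fun z => ⟨fiberedChart (FiberedChart.around z.pt), FiberedChart.mem_around z.pt⟩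

end Lam

end HorizontalForms

section ProjectionOfJets

variable {B F : Type*} [NormedAddCommGroup B] [NormedSpace ℝ B] [FiniteDimensional ℝ B]
  [NormedAddCommGroup F] [NormedSpace ℝ F] [FiniteDimensional ℝ F]
  {M E : Type*} [TopologicalSpace M] [ChartedSpace B M] [IsManifold 𝓘(ℝ, B) ∞ M]
  [TopologicalSpace E] [ChartedSpace (B × F) E] [IsManifold 𝓘(ℝ, B × F) ∞ E]
  {π : E → M} {k r : ℕ}

/-- The bundle projection `ν : Λᵏ_r E → E` is smooth. -/
theorem Lam.contMDiff_pt [IsFibered B F π] :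
    ContMDiff 𝓘(ℝ, B × (F × HForms B F k r)) 𝓘(ℝ, B × F) ∞ (Lam.pt : Lam B F π k r → E) := by
  intro l
  let c : FiberedChart B F π := FiberedChart.around l.pt
  let C := Lam.fiberedChart (k := k) (r := r) c
  have hl : l ∈ C.total.source := FiberedChart.mem_around l.pt
  have hlp : l.pt ∈ c.total.source := FiberedChart.mem_around l.pt
  have h1 : ContMDiffAt 𝓘(ℝ, B × (F × HForms B F k r)) 𝓘(ℝ, B × (F × HForms B F k r)) ∞
      C.total l := contMDiffAt_of_mem_maximalAtlas C.total_mem hl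
  have h2 : ContMDiffAt 𝓘(ℝ, B × (F × HForms B F k r)) 𝓘(ℝ, B × F) ∞
      (fun w : B × (F × HForms B F k r) => (w.1, w.2.1)) (C.total l) := by
    refine ContDiffAt.contMDiffAt (ContDiff.contDiffAt ?_)
    fun_prop
  have h3 : ContMDiffAt 𝓘(ℝ, B × F) 𝓘(ℝ, B × F) ∞ c.total.symm (c.total l.pt) :=
    contMDiffAt_symm_of_mem_maximalAtlas c.total_mem (c.total.map_source hlp)
  have h4 := h3.comp l (h2.comp l h1)
  refine h4.congr_of_eventuallyEq ?_
  filter_upwards [C.total.open_source.mem_nhds hl] with q hq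
  exact (c.total.left_inv (show q.pt ∈ c.total.source from hq)).symm

/-- The projection `J¹(π ∘ ν) → J¹π` induced by `ν : Λᵏ_r E → E`, that is
`j¹_x s ↦ j¹_x (ν ∘ s)`. -/
def jetProj [IsFibered B F π]
    (z : J1 B (F × HForms B F k r) (Lam.toBase : Lam B F π k r → M)) : J1 B F π where
  pt := z.pt.pt
  lin := (dmap (B × (F × HForms B F k r)) (B × F) Lam.pt z.pt).comp z.lin
  isSection := by
    have h : IsFibered B F π := inferInstance
    have h1 := dmap_comp (x := z.pt) (h.contMDiff.mdifferentiable (by simp) z.pt.pt)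
      (Lam.contMDiff_pt.mdifferentiable (by simp) z.pt)
    rw [← ContinuousLinearMap.comp_assoc, ← h1]
    exact z.isSection

end ProjectionOfJets

section Forms

variable {V W X Y : Type*} [NormedAddCommGroup V] [NormedSpace ℝ V] [NormedAddCommGroup W]
  [NormedSpace ℝ W] [TopologicalSpace X] [ChartedSpace V X] [TopologicalSpace Y] [ChartedSpace W Y]
  {k : ℕ}

/-- The pull-back of a differential `k`-form. -/
def pullback (f : X → Y) (a : Y → W [⋀^Fin k]→L[ℝ] ℝ) (x : X) : V [⋀^Fin k]→L[ℝ] ℝ :=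
  (a (f x)).compContinuousLinearMap (dmap V W f x)

/-- The expression of a differential form in the preferred chart around `p`. -/
def localForm (a : X → V [⋀^Fin k]→L[ℝ] ℝ) (p : X) : V → V [⋀^Fin k]→L[ℝ] ℝ :=
  pullback (X := V) (chartAt V p).symm a

/-- A differential form is smooth when all its local expressions are. -/
def IsSmoothForm (a : X → V [⋀^Fin k]→L[ℝ] ℝ) : Prop :=
  ∀ p : X, ContDiffOn ℝ ∞ (localForm a p) (chartAt V p).target

/-- The exterior derivative of a differential form on a manifold, computed in a chart. -/
def dform (a : X → V [⋀^Fin k]→L[ℝ] ℝ) (p : X) : V [⋀^Fin (k + 1)]→L[ℝ] ℝ :=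
  (extDeriv (localForm a p) (chartAt V p p)).compContinuousLinearMap (dmap V V (chartAt V p) p)

/-- A premultisymplectic form: a smooth closed form. -/
structure IsPremultisymplectic (Ω : X → V [⋀^Fin k]→L[ℝ] ℝ) : Prop where
  smooth : IsSmoothForm Ω
  closed : ∀ p, dform Ω p = 0

/-- A volume form: a smooth nowhere vanishing form of top degree (the degree `k` is meant to be
the dimension). -/
structure IsVolumeForm (η : X → V [⋀^Fin k]→L[ℝ] ℝ) : Prop where
  top : Module.finrank ℝ V = k
  smooth : IsSmoothForm η
  ne_zero : ∀ p, η p ≠ 0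

end Forms

section LagrangianSubspaces

variable {U : Type*} [AddCommGroup U] [Module ℝ U] {k : ℕ}

/-- The kernel of `v ↦ i_v Ω`. -/
def radical (Ω : U [⋀^Fin (k + 1)]→ₗ[ℝ] ℝ) : Submodule ℝ U := LinearMap.ker Ω.curryLeft

theorem apply_eq_zero_of_mem_radical {Ω : U [⋀^Fin (k + 1)]→ₗ[ℝ] ℝ} {x : Fin (k + 1) → U}
    (i : Fin (k + 1)) (h : x i ∈ radical Ω) : Ω x = 0 := by
  have h0 : Ω.curryLeft (x i) = 0 := h
  have h1 : Ω (x ∘ Equiv.swap 0 i) = 0 := by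
    have h2 : x ∘ Equiv.swap 0 i = Fin.cons (x i) (Fin.tail (x ∘ Equiv.swap 0 i)) := by
      conv_lhs => rw [← Fin.cons_self_tail (x ∘ Equiv.swap 0 i)]
      simp
    rw [h2]
    exact congrArg (fun g : U [⋀^Fin k]→ₗ[ℝ] ℝ => g (Fin.tail (x ∘ Equiv.swap 0 i))) h0
  rw [Ω.map_perm] at h1
  rcases Int.units_eq_one_or (Equiv.Perm.sign (Equiv.swap 0 i)) with h | h <;>
    simpa [h] using h1

theorem apply_congr_radical {Ω : U [⋀^Fin (k + 1)]→ₗ[ℝ] ℝ} {x y : Fin (k + 1) → U}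
    (h : ∀ i, x i - y i ∈ radical Ω) : Ω x = Ω y := by
  classical
  have key : ∀ s : Finset (Fin (k + 1)), Ω (s.piecewise x y) = Ω y := by
    intro s
    induction s using Finset.induction_on with
    | empty => simp
    | insert i s hi ih =>
      have h1 : x i = y i + (x i - y i) := by abel
      have h2 : Function.update (s.piecewise x y) i (y i) = s.piecewise x y := by
        have h3 := Function.update_eq_self i (s.piecewise x y)
        rwa [Finset.piecewise_eq_of_notMem _ _ _ hi] at h3
      have h4 : Ω (Function.update (s.piecewise x y) i (x i - y i)) = 0 :=
        apply_eq_zero_of_mem_radical i (by rw [Function.update_self]; exact h i)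
      rw [Finset.piecewise_insert, h1, Ω.map_update_add, h2, ih, h4, add_zero]
  have := key Finset.univ
  rwa [Finset.piecewise_univ] at this

/-- The form induced by `Ω` on the quotient by its kernel. -/
def reducedForm (Ω : U [⋀^Fin (k + 1)]→ₗ[ℝ] ℝ) : (U ⧸ radical Ω) [⋀^Fin (k + 1)]→ₗ[ℝ] ℝ :=
  Ω.compLinearMap (LinearMap.exists_rightInverse_of_surjective (radical Ω).mkQ
    (radical Ω).range_mkQ).choose

theorem reducedForm_mkQ (Ω : U [⋀^Fin (k + 1)]→ₗ[ℝ] ℝ) :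
    (reducedForm Ω).compLinearMap (radical Ω).mkQ = Ω := by
  ext v
  have hs : (radical Ω).mkQ ∘ₗ (LinearMap.exists_rightInverse_of_surjective (radical Ω).mkQ
    (radical Ω).range_mkQ).choose = LinearMap.id :=
    (LinearMap.exists_rightInverse_of_surjective (radical Ω).mkQ
      (radical Ω).range_mkQ).choose_spec
  refine apply_congr_radical (Ω := Ω) fun i => ?_
  refine (Submodule.Quotient.mk_eq_zero (radical Ω)).1 ?_
  refine (map_sub (radical Ω).mkQ _ _).trans ?_
  have := LinearMap.congr_fun hs ((radical Ω).mkQ (v i))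
  simp only [LinearMap.comp_apply, LinearMap.id_apply] at this
  exact sub_eq_zero.2 this

/-- The `l`-th orthogonal `{v | i_{v ∧ w₁ ∧ … ∧ w_l} Ω = 0 for all w₁, …, w_l ∈ W}`. -/
def orth (Ω : U [⋀^Fin (k + 1)]→ₗ[ℝ] ℝ) (l : ℕ) (W : Submodule ℝ U) : Submodule ℝ U where
  carrier := {v | ∀ x : Fin k → U, (∀ i : Fin k, (i : ℕ) < l → x i ∈ W) →
    Ω.curryLeft v x = 0}
  zero_mem' x _ := by simp
  add_mem' ha hb x hx := by simp [ha x hx, hb x hx]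
  smul_mem' c a ha x hx := by simp [ha x hx]

/-- `W` is an `l`-Lagrangian subspace. -/
def IsLagrangianSubspace (Ω : U [⋀^Fin (k + 1)]→ₗ[ℝ] ℝ) (l : ℕ) (W : Submodule ℝ U) : Prop :=
  W = orth Ω l W

end LagrangianSubspaces

section LagrangianSubmanifolds

variable {V P : Type*} [NormedAddCommGroup V] [NormedSpace ℝ V] [TopologicalSpace P]
  [ChartedSpace V P] {k : ℕ}

/-- An embedded submanifold: a subset which around each of its points is, in a suitable chart, a
linear subspace of a fixed dimension. -/
def IsEmbeddedSubmanifold (V : Type*) [NormedAddCommGroup V] [NormedSpace ℝ V] {P : Type*}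
    [TopologicalSpace P] [ChartedSpace V P] (S : Set P) : Prop :=
  ∃ d : ℕ, ∀ p ∈ S, ∃ φ ∈ IsManifold.maximalAtlas 𝓘(ℝ, V) ∞ P, p ∈ φ.source ∧
    ∃ W : Submodule ℝ V, Module.finrank ℝ W = d ∧ ∀ q ∈ φ.source, q ∈ S ↔ φ q ∈ W

/-- The tangent space of a submanifold, spanned by the velocities of the curves contained in it. -/
def tangentSubspace (V : Type*) [NormedAddCommGroup V] [NormedSpace ℝ V] {P : Type*}
    [TopologicalSpace P] [ChartedSpace V P] (S : Set P) (p : P) : Submodule ℝ V :=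
  Submodule.span ℝ {v | ∃ γ : ℝ → P, γ 0 = p ∧ ContMDiffAt 𝓘(ℝ, ℝ) 𝓘(ℝ, V) ∞ γ 0 ∧
    (∀ᶠ t in 𝓝 0, γ t ∈ S) ∧ v = dmap ℝ V γ 0 1}

/-- `S` is an `l`-Lagrangian submanifold with respect to the premultisymplectic form `Ω`: at each
point the image of the tangent space `T_p S` in the quotient of `T_p P` by the kernel of `Ω_p` is an
`l`-Lagrangian subspace for the induced form. -/
structure IsLagrangianSubmanifold (Ω : P → V [⋀^Fin (k + 1)]→L[ℝ] ℝ) (l : ℕ) (S : Set P) :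
    Prop where
  submanifold : IsEmbeddedSubmanifold V S
  lagrangian : ∀ p ∈ S, IsLagrangianSubspace (reducedForm (Ω p).toAlternatingMap) l
    ((tangentSubspace V S p).map (radical (Ω p).toAlternatingMap).mkQ)

end LagrangianSubmanifolds

section CanonicalForms

variable {B F : Type*} [NormedAddCommGroup B] [NormedSpace ℝ B] [FiniteDimensional ℝ B]
  [NormedAddCommGroup F] [NormedSpace ℝ F] [FiniteDimensional ℝ F]
  {M E : Type*} [TopologicalSpace M] [ChartedSpace B M] [IsManifold 𝓘(ℝ, B) ∞ M]
  [TopologicalSpace E] [ChartedSpace (B × F) E] [IsManifold 𝓘(ℝ, B × F) ∞ E]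

/-- The tautological `k`-form `Θ` on `Λᵏ_r E`: at a point `ω` it is the pull-back of the form `ω`
by `Λᵏ_r E → E`. -/
def Lam.theta (π : E → M) [IsFibered B F π] (k r : ℕ) (l : Lam B F π k r) :
    (B × (F × HForms B F k r)) [⋀^Fin k]→L[ℝ] ℝ :=
  l.form.compContinuousLinearMap (dmap (B × (F × HForms B F k r)) (B × F) Lam.pt l)

/-- The canonical multisymplectic form `Ω = -dΘ` on `Λᵏ_r E`. -/
def Lam.omega (π : E → M) [IsFibered B F π] (k r : ℕ) (l : Lam B F π k r) :
    (B × (F × HForms B F k r)) [⋀^Fin (k + 1)]→L[ℝ] ℝ :=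
  -(dform (V := B × (F × HForms B F k r)) (Lam.theta π k r) l)

/-- A Lagrangian density `ℒ = L η` as an `m`-form on `J¹π`. -/
def lagrangianForm {m : ℕ} (π : E → M) [IsFibered B F π] (L : J1 B F π → ℝ)
    (η : M → B [⋀^Fin m]→L[ℝ] ℝ) (z : J1 B F π) :
    (B × (F × (B →L[ℝ] F))) [⋀^Fin m]→L[ℝ] ℝ :=
  L z • pullback (J1.toBase : J1 B F π → M) η z

end CanonicalForms

section Tulczyjew

/-- The coordinate space `ℝ^m`. -/
abbrev Euc (m : ℕ) : Type := EuclideanSpace ℝ (Fin m)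

variable {m : ℕ} {F : Type*} [NormedAddCommGroup F] [NormedSpace ℝ F] [FiniteDimensional ℝ F]

/-- The form `d^m x = dx¹ ∧ … ∧ dx^m` on the coordinate space `ℝ^m`. -/
def stdVolume (m : ℕ) : Euc m [⋀^Fin m]→L[ℝ] ℝ :=
  { (EuclideanSpace.basisFun (Fin m) ℝ).toBasis.det with
    cont := by
      change Continuous fun v : Fin m → Euc m =>
        ((EuclideanSpace.basisFun (Fin m) ℝ).toBasis.toMatrix v).det
      refine Continuous.matrix_det (continuous_matrix fun i j => ?_)
      simp only [Module.Basis.toMatrix_apply, OrthonormalBasis.coe_toBasis_repr_apply,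
        EuclideanSpace.basisFun_repr]
      fun_prop }

/-- The wedge product `a ∧ d^m x` on `ℝ^m × G`, with `a` a `1`-form. -/
def wedgeStdVolume {G : Type*} [NormedAddCommGroup G] [NormedSpace ℝ G]
    (a : Euc m × G →L[ℝ] ℝ) :
    (Euc m × G) [⋀^Fin (m + 1)]→L[ℝ] ℝ :=
  ContinuousAlternatingMap.alternatizeUncurryFin
    (a.smulRight ((stdVolume m).compContinuousLinearMap
      (ContinuousLinearMap.fst ℝ (Euc m) G)))

theorem wedgeStdVolume_apply {G : Type*} [NormedAddCommGroup G] [NormedSpace ℝ G]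
    (a : Euc m × G →L[ℝ] ℝ) (v : Fin (m + 1) → Euc m × G) :
    wedgeStdVolume a v = ∑ i : Fin (m + 1), (-1) ^ (i : ℕ) *
      (a (v i) * (EuclideanSpace.basisFun (Fin m) ℝ).toBasis.det (fun j => (i.removeNth v j).1)) := by
  rw [wedgeStdVolume, ContinuousAlternatingMap.alternatizeUncurryFin_apply]
  refine Finset.sum_congr rfl fun i _ => ?_
  simp only [zsmul_eq_mul, Int.cast_pow, Int.cast_neg, Int.cast_one]
  rfl

theorem wedgeStdVolume_isHorizontal {G : Type*} [NormedAddCommGroup G] [NormedSpace ℝ G]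
    (a : Euc m × G →L[ℝ] ℝ) :
    IsHorizontal (ContinuousLinearMap.fst ℝ (Euc m) G) 2 (wedgeStdVolume a) := by
  intro h v hv
  rw [wedgeStdVolume_apply]
  refine Finset.sum_eq_zero fun i _ => ?_
  obtain ⟨j, hj⟩ : ∃ j : Fin m, (i.removeNth v j).1 = 0 := by
    have hm : 0 < m := by omega
    have h0 : (v 0).1 = 0 := hv 0 (by simp)
    have h1 : (v ⟨1, by omega⟩).1 = 0 := hv ⟨1, by omega⟩ (by simp)
    refine ⟨⟨0, hm⟩, ?_⟩
    by_cases hi : i = 0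
    · subst hi
      exact h1
    · have : i.succAbove ⟨0, hm⟩ = 0 := by
        rw [Fin.succAbove_of_castSucc_lt]
        · rfl
        · exact Fin.pos_of_ne_zero hi
      simp only [Fin.removeNth, this, h0]
  rw [AlternatingMap.map_coord_zero _ j hj, mul_zero, mul_zero]

/-- The momenta of a `2`-horizontal `m`-form `p d^m x + p^i_α du^α ∧ d^{m-1} x_i` on `ℝ^m × F`, with
`d^{m-1} x_i = i_{∂/∂x^i} d^m x`: for every `i` the covector `p^i_α du^α`, obtained by evaluating
the form on `∂/∂x¹, …, ∂/∂x^m` with the `i`-th vector replaced by a vector of `F`. -/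
def momentum (a : (Euc m × F) [⋀^Fin m]→L[ℝ] ℝ) (i : Fin m) : F →L[ℝ] ℝ :=
  (a.toContinuousMultilinearMap.toContinuousLinearMap
    (fun j => (EuclideanSpace.single j (1 : ℝ), (0 : F))) i).comp
    (ContinuousLinearMap.inr ℝ (Euc m) F)

/-- The coordinate expression `p^i_{αi} du^α + p^i_α du^α_i` on `J¹π`, at the point of `J¹(π ∘ ν)`
with coordinates `w = (x, ((u, ω), (u_x, ω_x)))`, where `ω = p d^m x + p^i_α du^α ∧ d^{m-1} x_i` and
`ω_x` collects the derivative coordinates `p_j` and `p^i_{αj}`. -/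
def tulczyjewCovector (w : Euc m ×
      ((F × HForms (Euc m) F m 2) ×
        (Euc m →L[ℝ] F × HForms (Euc m) F m 2))) :
    Euc m × (F × (Euc m →L[ℝ] F)) →L[ℝ] ℝ :=
  ∑ i : Fin m,
    ((momentum (w.2.2 (EuclideanSpace.single i 1)).2.form i).comp
        ((ContinuousLinearMap.fst ℝ F _).comp (ContinuousLinearMap.snd ℝ _ _)) +
      (momentum w.2.1.2.form i).comp
        ((ContinuousLinearMap.apply ℝ F (EuclideanSpace.single i (1 : ℝ))).comp
          ((ContinuousLinearMap.snd ℝ F _).comp (ContinuousLinearMap.snd ℝ _ _))))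

variable {M E : Type*} [TopologicalSpace M] [ChartedSpace (Euc m) M]
  [IsManifold 𝓘(ℝ, Euc m) ∞ M]
  [TopologicalSpace E] [ChartedSpace (Euc m × F) E]
  [IsManifold 𝓘(ℝ, Euc m × F) ∞ E]

/-- The jet manifold `J¹(π ∘ ν)` of the bundle `π ∘ ν : Λᵐ_2 E → M`, where `ν : Λᵐ_2 E → E`. -/
abbrev JetMom (m : ℕ) (F : Type*) [NormedAddCommGroup F] [NormedSpace ℝ F] [FiniteDimensional ℝ F]
    {M E : Type*} [TopologicalSpace M] [ChartedSpace (Euc m) M]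
    [IsManifold 𝓘(ℝ, Euc m) ∞ M]
    [TopologicalSpace E] [ChartedSpace (Euc m × F) E]
    [IsManifold 𝓘(ℝ, Euc m × F) ∞ E] (π : E → M)
    [IsFibered (Euc m) F π] :=
  J1 (Euc m) (F × HForms (Euc m) F m 2)
    (Lam.toBase : Lam (Euc m) F π m 2 → M)

/-- The coordinates `(x, ((u, ω), (u_x, ω_x)))` on `J¹(π ∘ ν)` induced by adapted coordinates `c`. -/
def jetMomCoord {π : E → M} [IsFibered (Euc m) F π] (c : FiberedChart (Euc m) F π)
    (z : JetMom m F π) : Euc m × ((F × HForms (Euc m) F m 2) ×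
      (Euc m →L[ℝ] F × HForms (Euc m) F m 2)) :=
  (J1.fiberedChart (Lam.fiberedChart (k := m) (r := 2) c)).total z

/-- The form `(p^i_{αi} du^α + p^i_α du^α_i) ∧ d^m x` in coordinates. -/
def tulczyjewCoord (w : Euc m × ((F × HForms (Euc m) F m 2) ×
      (Euc m →L[ℝ] F × HForms (Euc m) F m 2))) :
    (Euc m × (F × (Euc m →L[ℝ] F))) [⋀^Fin (m + 1)]→L[ℝ] ℝ :=
  wedgeStdVolume (G := F × (Euc m →L[ℝ] F)) (tulczyjewCovector w)

theorem tulczyjewCoord_isHorizontal (w : Euc m × ((F × HForms (Euc m) F m 2) ×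
      (Euc m →L[ℝ] F × HForms (Euc m) F m 2))) :
    IsHorizontal (ContinuousLinearMap.fst ℝ (Euc m) (F × (Euc m →L[ℝ] F))) 2 (tulczyjewCoord w) :=
  wedgeStdVolume_isHorizontal _

/-- The value of the Tulczyjew morphism at `z`, computed in adapted coordinates `c`: the form
`(p^i_{αi} du^α + p^i_α du^α_i) ∧ d^m x` on `J¹π`. -/
def tulczyjewIn {π : E → M} [IsFibered (Euc m) F π]
    (c : FiberedChart (Euc m) F π) (z : JetMom m F π)
    (hz : z.pt.pt ∈ c.total.source) :
    Lam (Euc m) (F × (Euc m →L[ℝ] F))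
      (J1.toBase : J1 (Euc m) F π → M) (m + 1) 2 where
  pt := jetProj z
  form := (tulczyjewCoord (jetMomCoord c z)).compContinuousLinearMap
    (dmap (Euc m × (F × (Euc m →L[ℝ] F))) (Euc m × (F × (Euc m →L[ℝ] F)))
      (J1.fiberedChart c).total (jetProj z))
  horizontal := by
    intro h v hv
    refine tulczyjewCoord_isHorizontal (jetMomCoord c z) h _ fun i hi => ?_
    have h1 := congrArg (fun T => T (v i))
      ((J1.fiberedChart c).fst_comp_dmap (u := jetProj z) hz)
    have h2 := hv i hi
    simpa [h2] using h1

/-- The Tulczyjew morphism `A : J¹(π ∘ ν) → Λ^{m+1}_2 J¹π`, locally given by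
`(x, u, p, p^i_α, u_j, p_j, p^i_{αj}) ↦ (p^i_{αi} du^α + p^i_α du^α_i) ∧ d^m x`.
This expression defines the same form in all adapted coordinates (so the choice of the coordinates
around the point plays no role): if `z = j¹_x s` for a local section `s` of `π ∘ ν`, if `Y` is the
velocity of a variation `σ_t` of the section `σ = ν ∘ s` of `π`, and `V` is the velocity of the
curve `j¹_x σ_t`, then `i_V A(z)` is the pull-back to `J¹π` of the exterior derivative at `x` of the
`(m-1)`-form `σ^* (i_Y s)` on `M`. -/
def tulczyjew (π : E → M) [IsFibered (Euc m) F π] (z : JetMom m F π) :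
    Lam (Euc m) (F × (Euc m →L[ℝ] F))
      (J1.toBase : J1 (Euc m) F π → M) (m + 1) 2 :=
  tulczyjewIn (FiberedChart.around z.pt.pt) z (FiberedChart.mem_around z.pt.pt)

/-- The form `Ω̃` on `J¹(π ∘ ν)`: the pull-back by the Tulczyjew morphism of the canonical
multisymplectic form of `Λ^{m+1}_2 J¹π`. -/
def omegaTilde (π : E → M) [IsFibered (Euc m) F π] (z : JetMom m F π) :
    (Euc m × ((F × HForms (Euc m) F m 2) ×
      (Euc m →L[ℝ] F × HForms (Euc m) F m 2)))
      [⋀^Fin (m + 1 + 1)]→L[ℝ] ℝ :=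
  pullback (tulczyjew π)
    (Lam.omega (J1.toBase : J1 (Euc m) F π → M) (m + 1) 2) z

/-- The set `S_ℒ = A⁻¹(dℒ(J¹π))`; an element of `Λ^{m+1}_2 J¹π` lies in the image of the section
`dℒ` if it is the value of `dℒ` at its base point. -/
def lagrangianSet (π : E → M) [IsFibered (Euc m) F π]
    (L : J1 (Euc m) F π → ℝ)
    (η : M → Euc m [⋀^Fin m]→L[ℝ] ℝ) : Set (JetMom m F π) :=
  tulczyjew π ⁻¹' {l | l.form = dform (lagrangianForm π L η) l.pt}

end Tulczyjew

end FieldTheory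

end

noncomputable section

namespace FieldTheory

/-! ### Differential forms in charts: smoothness, pull-back, exterior derivative -/

section FormsOnManifolds

/-! The statement is local, and in adapted coordinates everything except the Lagrangian is linear.
Let `P` (`jetProjCoord`) be the projection J¹(π ∘ ν) → J¹π read in coordinates, let a_w be the
covector p^i_{αi} du^α + p^i_α du^α_i at w, and let T w (`verticalCovector`) be its restriction to
vertical vectors. The Tulczyjew morphism A is the linear map w ↦ (P w, a_w ∧ d^m x), so A^*Θ has
coefficients linear in w and Ω̃ has constant coefficients: Ω̃(v_0, …, v_{m+1}) = -Σ (-1)^i (a_{v_i}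
∧ d^m x)(P v_0, …, P v_{m+1}), where P v_i is omitted from the i-th term. As a ∧ d^m x depends only
on the vertical part of a (`wedgeStdVolume_congr_iff`), the subspace ker P ∩ ker T lies in ker Ω̃.

Write Lη = g d^m x and let ∂g be the derivative of g along vertical vectors. Then S_ℒ is the set T w
= ∂g(P w). Since m ≥ 1, T maps ker P onto the space of all vertical covectors, so with a right
inverse R of T valued in ker P the shear w ↦ w - R(∂g(P w)) straightens S_ℒ to ker T, and the
tangent space is K = {v : T v = D(∂g)(P v)} (`exists_chart_lagrangianSet`).

K is isotropic: on K the covector a_{v_i} may be replaced by D²g(P v_i), and the sum becomes d(dg ∧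
d^m x) = d(d(g d^m x)) = 0. K is maximal modulo the kernel: P maps K onto the whole tangent space of
J¹π, so a vector orthogonal to K can be corrected by an element of K to a vector v with P v = 0.
Testing v on elements of K lying over a vertical vector and the standard frame gives T v = 0, so v
is in ker Ω̃.

Globally, A is defined pointwise in a chosen chart, so its independence of the chart is needed
before it can be differentiated. The value of a_w on a variation (U, A) is d(i_Y s) on the standard
frame, where s represents the jet w, and Y the variation; naturality of d then gives the
transformation law (`tulczyjewCovector_change`). Hence A is smooth, Ω̃ = -d(A^*Θ) because d commutes
with pull-back, and Ω̃ is closed because d² = 0. -/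

theorem contDiffAt_compContinuousLinearMap {V W U : Type*} [NormedAddCommGroup V] [NormedSpace ℝ V]
    [FiniteDimensional ℝ V] [NormedAddCommGroup W] [NormedSpace ℝ W]
    [NormedAddCommGroup U] [NormedSpace ℝ U] {k : ℕ} {x : U}
    {f : U → W [⋀^Fin k]→L[ℝ] ℝ} {g : U → V →L[ℝ] W} (hf : ContDiffAt ℝ ∞ f x)
    (hg : ContDiffAt ℝ ∞ g x) :
    ContDiffAt ℝ ∞ (fun x => (f x).compContinuousLinearMap (g x)) x := by
  -- A form is recovered linearly from its finitely many values on tuples of basis vectors, so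
  -- smoothness can be tested on values.
  have key : ∀ {h : U → V [⋀^Fin k]→L[ℝ] ℝ},
      (∀ v, ContDiffAt ℝ ∞ (fun x => h x v) x) → ContDiffAt ℝ ∞ h x := by
    intro h hh
    let b := Module.finBasis ℝ V
    let T : (V [⋀^Fin k]→L[ℝ] ℝ) →ₗ[ℝ] ((Fin k → Fin (Module.finrank ℝ V)) → ℝ) :=
      { toFun := fun a v => a (fun i => b (v i))
        map_add' := fun _ _ => rfl
        map_smul' := fun _ _ => rfl }
    have hT : LinearMap.ker T = ⊥ := by
      refine LinearMap.ker_eq_bot.2 fun x y hxy => ?_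
      have h1 : x.toMultilinearMap = y.toMultilinearMap :=
        Module.Basis.ext_multilinear (fun _ => b) fun v => congrFun hxy v
      ext v
      exact congrArg (fun g : MultilinearMap ℝ (fun _ : Fin k => V) ℝ => g v) h1
    obtain ⟨P, hP⟩ := T.exists_leftInverse_of_injective hT
    have h2 : ContDiffAt ℝ ∞ (fun x => T (h x)) x := contDiffAt_pi.2 fun v => hh _
    have h3 := (LinearMap.toContinuousLinearMap P).contDiff.contDiffAt.comp x h2
    refine h3.congr_of_eventuallyEq (Filter.Eventually.of_forall fun x => ?_)
    exact (LinearMap.congr_fun hP (h x)).symm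
  refine key fun v => ?_
  have h1 : ContDiffAt ℝ ∞ (fun x =>
      ContinuousMultilinearMap.compContinuousLinearMapContinuousMultilinear
      ℝ (fun _ : Fin k => V) (fun _ : Fin k => W) ℝ (fun _ => g x)) x :=
    (ContinuousMultilinearMap.contDiff _).contDiffAt.comp x (contDiffAt_pi.2 fun _ => hg)
  have h2 : ContDiffAt ℝ ∞ (fun x => (f x).toContinuousMultilinearMap) x :=
    (ContinuousAlternatingMap.toContinuousMultilinearMapLI (𝕜 := ℝ) (E := W) (F := ℝ)
      (ι := Fin k)).toContinuousLinearMap.contDiff.contDiffAt.comp x hf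
  exact (ContinuousMultilinearMap.apply ℝ (fun _ : Fin k => V) ℝ v).contDiff.contDiffAt.comp x
    (h1.clm_apply h2)

theorem minSmoothness_two_le_infty : minSmoothness ℝ 2 ≤ ∞ := by
  rw [minSmoothness_of_isRCLikeNormedField]
  exact WithTop.coe_le_coe.2 le_top

theorem contDiffAt_extDeriv {V : Type*} [NormedAddCommGroup V] [NormedSpace ℝ V] {k : ℕ}
    {a : V → V [⋀^Fin k]→L[ℝ] ℝ} {x : V} (h : ContDiffAt ℝ ∞ a x) :
    ContDiffAt ℝ ∞ (extDeriv a) x :=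
  ContDiffAt.comp (g := ContinuousAlternatingMap.alternatizeUncurryFinCLM (n := k) ℝ V ℝ) x
    (ContinuousLinearMap.contDiff _).contDiffAt (h.fderiv_right (m := ∞) (by simp))

variable {V W X Y : Type*} [NormedAddCommGroup V] [NormedSpace ℝ V] [FiniteDimensional ℝ V]
  [NormedAddCommGroup W] [NormedSpace ℝ W] [FiniteDimensional ℝ W] [TopologicalSpace X]
  [ChartedSpace V X] [TopologicalSpace Y] [ChartedSpace W Y]
  [IsManifold 𝓘(ℝ, V) ∞ X] [IsManifold 𝓘(ℝ, W) ∞ Y] {k : ℕ}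

/-- The expression of a form in a chart. -/
abbrev inChart (φ : OpenPartialHomeomorph X V) (a : X → V [⋀^Fin k]→L[ℝ] ℝ) :
    V → V [⋀^Fin k]→L[ℝ] ℝ :=
  pullback (V := V) (W := V) φ.symm a

/-- A form is smooth near `x` if its expression in some chart around `x` is. -/
def SmoothFormAt (a : X → V [⋀^Fin k]→L[ℝ] ℝ) (x : X) : Prop :=
  ∃ φ ∈ IsManifold.maximalAtlas 𝓘(ℝ, V) ∞ X, x ∈ φ.source ∧
    ContDiffAt ℝ ∞ (inChart φ a) (φ x)

theorem dmap_id (x : X) : dmap V V (id : X → X) x = ContinuousLinearMap.id ℝ V := mfderiv_id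

theorem pullback_id (a : X → V [⋀^Fin k]→L[ℝ] ℝ) : pullback (V := V) (W := V) (id : X → X) a = a := by
  funext x
  rw [pullback, dmap_id]
  rfl

theorem contDiffAt_writtenInCharts {f : X → Y} (hf : ContMDiff 𝓘(ℝ, V) 𝓘(ℝ, W) ∞ f)
    {φ : OpenPartialHomeomorph X V} (hφ : φ ∈ IsManifold.maximalAtlas 𝓘(ℝ, V) ∞ X)
    {ψ : OpenPartialHomeomorph Y W} (hψ : ψ ∈ IsManifold.maximalAtlas 𝓘(ℝ, W) ∞ Y)
    {y : V} (hy : y ∈ φ.target) (hy' : f (φ.symm y) ∈ ψ.source) :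
    ContDiffAt ℝ ∞ (ψ ∘ f ∘ φ.symm) y := by
  rw [← contMDiffAt_iff_contDiffAt]
  exact (contMDiffAt_of_mem_maximalAtlas hψ hy').comp y
    ((hf _).comp y (contMDiffAt_symm_of_mem_maximalAtlas hφ hy))

/-- The expression in charts of the pull-back of a form. -/
theorem pullback_symm_pullback {f : X → Y} (hf : ContMDiff 𝓘(ℝ, V) 𝓘(ℝ, W) ∞ f)
    {φ : OpenPartialHomeomorph X V} (hφ : φ ∈ IsManifold.maximalAtlas 𝓘(ℝ, V) ∞ X)
    {ψ : OpenPartialHomeomorph Y W} (hψ : ψ ∈ IsManifold.maximalAtlas 𝓘(ℝ, W) ∞ Y)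
    (a : Y → W [⋀^Fin k]→L[ℝ] ℝ) {y : V} (hy : y ∈ φ.target) (hy' : f (φ.symm y) ∈ ψ.source) :
    inChart φ (pullback (V := V) (W := W) f a) y =
      (inChart ψ a ((ψ ∘ f ∘ φ.symm) y)).compContinuousLinearMap
        (fderiv ℝ (ψ ∘ f ∘ φ.symm) y) := by
  have e1 : fderiv ℝ (ψ ∘ f ∘ φ.symm) y =
      (dmap W W ψ (f (φ.symm y))).comp ((dmap V W f (φ.symm y)).comp (dmap V V φ.symm y)) := by
    have h1 := dmap_comp (hf.mdifferentiable (by simp) (φ.symm y)) (mdiff_chart_symm hφ hy)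
    have h2 := dmap_comp (x := y) (f := f ∘ φ.symm) (mdiff_chart hψ hy')
      ((hf.mdifferentiable (by simp) (φ.symm y)).comp y (mdiff_chart_symm hφ hy))
    rw [h1] at h2
    rw [← mfderiv_eq_fderiv]
    exact h2
  have e2 := dmap_chart_symm_comp hψ hy'
  have e3 : ψ.symm (ψ (f (φ.symm y))) = f (φ.symm y) := ψ.left_inv hy'
  ext v
  rw [e1]
  change a (f (φ.symm y)) (fun i => dmap V W f (φ.symm y) (dmap V V φ.symm y (v i))) =
    a (ψ.symm (ψ (f (φ.symm y)))) (fun i => dmap W W ψ.symm (ψ (f (φ.symm y)))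
      (dmap W W ψ (f (φ.symm y)) (dmap V W f (φ.symm y) (dmap V V φ.symm y (v i)))))
  rw [e3]
  congr 1
  funext i
  exact (congrArg (fun T => T (dmap V W f (φ.symm y) (dmap V V φ.symm y (v i)))) e2).symm

theorem eventually_pullback_symm_pullback {f : X → Y} (hf : ContMDiff 𝓘(ℝ, V) 𝓘(ℝ, W) ∞ f)
    {φ : OpenPartialHomeomorph X V} (hφ : φ ∈ IsManifold.maximalAtlas 𝓘(ℝ, V) ∞ X)
    {ψ : OpenPartialHomeomorph Y W} (hψ : ψ ∈ IsManifold.maximalAtlas 𝓘(ℝ, W) ∞ Y)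
    (a : Y → W [⋀^Fin k]→L[ℝ] ℝ) {x : X} (hx : x ∈ φ.source) (hx' : f x ∈ ψ.source) :
    inChart φ (pullback (V := V) (W := W) f a) =ᶠ[𝓝 (φ x)] fun y =>
      (inChart ψ a ((ψ ∘ f ∘ φ.symm) y)).compContinuousLinearMap
        (fderiv ℝ (ψ ∘ f ∘ φ.symm) y) := by
  have h1 : φ.target ∈ 𝓝 (φ x) := φ.open_target.mem_nhds (φ.map_source hx)
  have h2 : ContinuousAt (f ∘ φ.symm) (φ x) := by
    refine ContinuousAt.comp ?_ (φ.symm.continuousAt (φ.map_source hx))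
    exact hf.continuous.continuousAt
  have h3 : (f ∘ φ.symm) ⁻¹' ψ.source ∈ 𝓝 (φ x) := by
    refine h2.preimage_mem_nhds (ψ.open_source.mem_nhds ?_)
    rwa [Function.comp_apply, φ.left_inv hx]
  filter_upwards [h1, h3] with y hy hy'
  exact pullback_symm_pullback hf hφ hψ a hy hy'

/-- Smoothness does not depend on the chart: the pull-back formula for the identity map, read in two
different charts, expresses one local form through the other and the smooth change of coordinates.
-/
theorem SmoothFormAt.contDiffAt {a : X → V [⋀^Fin k]→L[ℝ] ℝ} {x : X} (h : SmoothFormAt a x)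
    {φ : OpenPartialHomeomorph X V} (hφ : φ ∈ IsManifold.maximalAtlas 𝓘(ℝ, V) ∞ X)
    (hx : x ∈ φ.source) : ContDiffAt ℝ ∞ (inChart φ a) (φ x) := by
  obtain ⟨ψ, hψ, hx', h⟩ := h
  have h1 := eventually_pullback_symm_pullback (contMDiff_id (I := 𝓘(ℝ, V)) (M := X)) hφ hψ a hx hx'
  rw [pullback_id] at h1
  have h2 := contDiffAt_writtenInCharts (contMDiff_id (I := 𝓘(ℝ, V)) (M := X)) hφ hψ (φ.map_source hx)
    (by simpa [φ.left_inv hx] using hx')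
  refine ContDiffAt.congr_of_eventuallyEq ?_ h1
  refine contDiffAt_compContinuousLinearMap ?_ (h2.fderiv_right (m := ∞) (by simp))
  refine ContDiffAt.comp (g := inChart ψ a) _ ?_ h2
  simpa [φ.left_inv hx] using h

theorem SmoothFormAt.pullback_form {f : X → Y} (hf : ContMDiff 𝓘(ℝ, V) 𝓘(ℝ, W) ∞ f)
    {a : Y → W [⋀^Fin k]→L[ℝ] ℝ} {x : X} (h : SmoothFormAt a (f x)) :
    SmoothFormAt (pullback (V := V) (W := W) f a) x := by
  have hφ := IsManifold.chart_mem_maximalAtlas (I := 𝓘(ℝ, V)) (n := ∞) x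
  have hψ := IsManifold.chart_mem_maximalAtlas (I := 𝓘(ℝ, W)) (n := ∞) (f x)
  have hx := mem_chart_source V x
  have hx' := mem_chart_source W (f x)
  refine ⟨_, hφ, hx, ?_⟩
  have h1 := eventually_pullback_symm_pullback hf hφ hψ a hx hx'
  have h2 := contDiffAt_writtenInCharts hf hφ hψ ((chartAt V x).map_source hx)
    (by rwa [(chartAt V x).left_inv hx])
  refine ContDiffAt.congr_of_eventuallyEq ?_ h1
  refine contDiffAt_compContinuousLinearMap ?_ (h2.fderiv_right (m := ∞) (by simp))
  refine ContDiffAt.comp (g := inChart (chartAt W (f x)) a) _ ?_ h2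
  simpa [(chartAt V x).left_inv hx] using h.contDiffAt hψ hx'

theorem isSmoothForm_iff {a : X → V [⋀^Fin k]→L[ℝ] ℝ} :
    IsSmoothForm a ↔ ∀ x, SmoothFormAt a x := by
  constructor
  · intro h x
    refine ⟨chartAt V x, IsManifold.chart_mem_maximalAtlas x, mem_chart_source V x, ?_⟩
    exact (h x).contDiffAt ((chartAt V x).open_target.mem_nhds (mem_chart_target V x))
  · intro h p y hy
    have h1 := (h ((chartAt V p).symm y)).contDiffAt
      (IsManifold.chart_mem_maximalAtlas p) ((chartAt V p).map_target hy)
    rw [(chartAt V p).right_inv hy] at h1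
    exact h1.contDiffWithinAt

/-- The exterior derivative of the expression in charts of a pull-back. -/
theorem extDeriv_pullback_symm_pullback {f : X → Y} (hf : ContMDiff 𝓘(ℝ, V) 𝓘(ℝ, W) ∞ f)
    {φ : OpenPartialHomeomorph X V} (hφ : φ ∈ IsManifold.maximalAtlas 𝓘(ℝ, V) ∞ X)
    {ψ : OpenPartialHomeomorph Y W} (hψ : ψ ∈ IsManifold.maximalAtlas 𝓘(ℝ, W) ∞ Y)
    {a : Y → W [⋀^Fin k]→L[ℝ] ℝ} {x : X} (ha : SmoothFormAt a (f x))
    (hx : x ∈ φ.source) (hx' : f x ∈ ψ.source) :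
    (extDeriv (inChart φ (pullback (V := V) (W := W) f a))
        (φ x)).compContinuousLinearMap (dmap V V φ x) =
      ((extDeriv (inChart ψ a)
        (ψ (f x))).compContinuousLinearMap (dmap W W ψ (f x))).compContinuousLinearMap
          (dmap V W f x) := by
  have h1 := eventually_pullback_symm_pullback hf hφ hψ a hx hx'
  have h2 := contDiffAt_writtenInCharts hf hφ hψ (φ.map_source hx) (by rwa [φ.left_inv hx])
  have e0 : (ψ ∘ f ∘ φ.symm) (φ x) = ψ (f x) := by simp [φ.left_inv hx]
  have h3 : DifferentiableAt ℝ (inChart ψ a)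
      ((ψ ∘ f ∘ φ.symm) (φ x)) := by
    rw [e0]
    exact (ha.contDiffAt hψ hx').differentiableAt (by simp)
  rw [h1.extDeriv_eq, extDeriv_pullback (r := ∞) h3 h2 minSmoothness_two_le_infty, e0]
  have e1 : (fderiv ℝ (ψ ∘ f ∘ φ.symm) (φ x)).comp (dmap V V φ x) =
      (dmap W W ψ (f x)).comp (dmap V W f x) := by
    rw [← mfderiv_eq_fderiv]
    have h4 := dmap_comp (x := x) (g := ψ ∘ f ∘ φ.symm) (f := φ)
      (h2.differentiableAt (by simp)).mdifferentiableAt (mdiff_chart hφ hx)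
    have h5 := dmap_comp (x := x) (mdiff_chart hψ hx') (hf.mdifferentiable (by simp) x)
    have h6 : dmap V W ((ψ ∘ f ∘ φ.symm) ∘ φ) x = dmap V W (ψ ∘ f) x := by
      refine Filter.EventuallyEq.mfderiv_eq ?_
      filter_upwards [φ.open_source.mem_nhds hx] with y hy
      simp [φ.left_inv hy]
    rw [← h5, ← h6, h4]
    rfl
  ext v
  have := congrArg (fun T : V →L[ℝ] W => fun i => T (v i)) e1
  exact congrArg (extDeriv (inChart ψ a) (ψ (f x))) this

/-- The exterior derivative can be computed in any chart. -/
theorem dform_eq {a : X → V [⋀^Fin k]→L[ℝ] ℝ} {x : X} (ha : SmoothFormAt a x)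
    {φ : OpenPartialHomeomorph X V} (hφ : φ ∈ IsManifold.maximalAtlas 𝓘(ℝ, V) ∞ X)
    (hx : x ∈ φ.source) :
    dform a x = (extDeriv (inChart φ a)
      (φ x)).compContinuousLinearMap (dmap V V φ x) := by
  -- Naturality of d for the identity map, with the preferred chart on one side and `φ` on the
  -- other.
  have h := extDeriv_pullback_symm_pullback (contMDiff_id (I := 𝓘(ℝ, V)) (M := X))
    (IsManifold.chart_mem_maximalAtlas x) hφ ha (mem_chart_source V x) hx
  rw [pullback_id, dmap_id] at h
  exact h

theorem dform_pullback {f : X → Y} (hf : ContMDiff 𝓘(ℝ, V) 𝓘(ℝ, W) ∞ f)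
    {a : Y → W [⋀^Fin k]→L[ℝ] ℝ} {x : X} (ha : SmoothFormAt a (f x)) :
    dform (pullback (V := V) (W := W) f a) x = pullback (V := V) (W := W) f (dform a) x :=
  extDeriv_pullback_symm_pullback hf (IsManifold.chart_mem_maximalAtlas x)
    (IsManifold.chart_mem_maximalAtlas (f x)) ha (mem_chart_source V x) (mem_chart_source W (f x))

/-- The value `dform a x` is computed in the preferred chart at `x`, which varies with `x`. Chart
independence replaces these charts by the single chart `φ`, so that `dform a` can itself be
differentiated. -/
theorem pullback_symm_dform {a : X → V [⋀^Fin k]→L[ℝ] ℝ} (ha : ∀ x, SmoothFormAt a x)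
    {φ : OpenPartialHomeomorph X V} (hφ : φ ∈ IsManifold.maximalAtlas 𝓘(ℝ, V) ∞ X)
    {y : V} (hy : y ∈ φ.target) :
    inChart φ (dform a) y = extDeriv (inChart φ a) y := by
  rw [inChart, pullback, dform_eq (ha _) hφ (φ.map_target hy), φ.right_inv hy]
  ext v
  have h := dmap_chart_comp_symm hφ hy
  exact congrArg (extDeriv (inChart φ a) y)
    (congrArg (fun T : V →L[ℝ] V => fun i => T (v i)) h)

theorem eventually_pullback_symm_dform {a : X → V [⋀^Fin k]→L[ℝ] ℝ} (ha : ∀ x, SmoothFormAt a x)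
    {φ : OpenPartialHomeomorph X V} (hφ : φ ∈ IsManifold.maximalAtlas 𝓘(ℝ, V) ∞ X)
    {x : X} (hx : x ∈ φ.source) :
    inChart φ (dform a) =ᶠ[𝓝 (φ x)] extDeriv (inChart φ a) := by
  filter_upwards [φ.open_target.mem_nhds (φ.map_source hx)] with y hy
  exact pullback_symm_dform ha hφ hy

theorem smoothFormAt_dform {a : X → V [⋀^Fin k]→L[ℝ] ℝ} (ha : ∀ x, SmoothFormAt a x) (x : X) :
    SmoothFormAt (dform a) x := by
  have hφ := IsManifold.chart_mem_maximalAtlas (I := 𝓘(ℝ, V)) (n := ∞) x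
  have hx := mem_chart_source V x
  exact ⟨_, hφ, hx, (contDiffAt_extDeriv ((ha x).contDiffAt hφ hx)).congr_of_eventuallyEq
    (eventually_pullback_symm_dform ha hφ hx)⟩

theorem dform_dform {a : X → V [⋀^Fin k]→L[ℝ] ℝ} (ha : ∀ x, SmoothFormAt a x) (x : X) :
    dform (dform a) x = 0 := by
  have hφ := IsManifold.chart_mem_maximalAtlas (I := 𝓘(ℝ, V)) (n := ∞) x
  have hx := mem_chart_source V x
  rw [dform_eq (smoothFormAt_dform ha x) hφ hx,
    (eventually_pullback_symm_dform ha hφ hx).extDeriv_eq,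
    extDeriv_extDeriv_apply (r := ∞) ((ha x).contDiffAt hφ hx)
      minSmoothness_two_le_infty]
  rfl

theorem dform_neg (a : X → V [⋀^Fin k]→L[ℝ] ℝ) (x : X) : dform (-a) x = -dform a x := by
  have h : localForm (-a) x = -localForm a x := rfl
  rw [dform, dform, h, extDeriv, fderiv_neg]
  ext v
  simp [extDeriv, ContinuousAlternatingMap.alternatizeUncurryFin_apply]

end FormsOnManifolds

/-! ### The forms a ∧ d^m x and their dependence on a -/

section WedgeWithVolume

variable {m : ℕ} {G G' : Type*} [NormedAddCommGroup G] [NormedSpace ℝ G]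
  [NormedAddCommGroup G'] [NormedSpace ℝ G']

theorem wedgeStdVolume_add (a b : Euc m × G →L[ℝ] ℝ) :
    wedgeStdVolume (a + b) = wedgeStdVolume a + wedgeStdVolume b := by
  ext v
  rw [ContinuousAlternatingMap.add_apply]
  simp only [wedgeStdVolume_apply, ← Finset.sum_add_distrib]
  refine Finset.sum_congr rfl fun i _ => ?_
  rw [add_apply]
  ring

theorem wedgeStdVolume_smul (t : ℝ) (a : Euc m × G →L[ℝ] ℝ) :
    wedgeStdVolume (t • a) = t • wedgeStdVolume a := by
  ext v
  rw [ContinuousAlternatingMap.smul_apply]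
  simp only [wedgeStdVolume_apply, Finset.smul_sum]
  refine Finset.sum_congr rfl fun i _ => ?_
  rw [smul_apply]
  simp only [smul_eq_mul]
  ring

/-- In all terms of the alternating sum but the first, the vertical vector `v` remains among the
arguments of d^m x, which kills it. -/
theorem wedgeStdVolume_cons_of_fst_eq_zero (a : Euc m × G →L[ℝ] ℝ) {v : Euc m × G}
    (hv : v.1 = 0) (w : Fin m → Euc m × G) :
    wedgeStdVolume a (Fin.cons v w) =
      a v * (EuclideanSpace.basisFun (Fin m) ℝ).toBasis.det (fun j => (w j).1) := by
  rw [wedgeStdVolume_apply, Fin.sum_univ_succ, Finset.sum_eq_zero, add_zero]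
  · simp
  · intro i _
    have hm : 0 < m := i.pos
    obtain ⟨k, rfl⟩ : ∃ k, m = k + 1 := ⟨m - 1, by omega⟩
    rw [AlternatingMap.map_coord_zero _ 0, mul_zero, mul_zero]
    simp [Fin.removeNth, hv]

/-- The standard basis of `ℝ^m`, lifted to `ℝ^m × G`. -/
def stdFrame (m : ℕ) (G : Type*) [NormedAddCommGroup G] (j : Fin m) : Euc m × G :=
  (EuclideanSpace.single j (1 : ℝ), 0)

theorem det_single :
    (EuclideanSpace.basisFun (Fin m) ℝ).toBasis.det
      (fun j => EuclideanSpace.single j (1 : ℝ)) = 1 := by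
  have h : (fun j => EuclideanSpace.single j (1 : ℝ)) =
      (EuclideanSpace.basisFun (Fin m) ℝ).toBasis := by
    funext j
    simp
  rw [h, Module.Basis.det_self]

theorem wedgeStdVolume_cons_stdFrame (a : Euc m × G →L[ℝ] ℝ) (g : G) :
    wedgeStdVolume a (Fin.cons ((0 : Euc m), g) (stdFrame m G)) = a (0, g) := by
  rw [wedgeStdVolume_cons_of_fst_eq_zero a rfl]
  exact (congrArg (a (0, g) * ·) det_single).trans (mul_one _)

/-- A covector vanishing on vertical vectors comes from ℝ^m, so its wedge with d^m x is pulled back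
from an (m+1)-form on an m-dimensional space. -/
theorem wedgeStdVolume_eq_zero {a : Euc m × G →L[ℝ] ℝ} (h : ∀ g, a (0, g) = 0) :
    wedgeStdVolume a = 0 := by
  let b : Euc m →L[ℝ] Euc m [⋀^Fin m]→L[ℝ] ℝ :=
    (a.comp (ContinuousLinearMap.inl ℝ (Euc m) G)).smulRight (stdVolume m)
  ext v
  have h1 : wedgeStdVolume a v =
      (ContinuousAlternatingMap.alternatizeUncurryFin b).toAlternatingMap (fun i => (v i).1) := by
    change _ = ContinuousAlternatingMap.alternatizeUncurryFin b (fun i => (v i).1)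
    rw [wedgeStdVolume_apply, ContinuousAlternatingMap.alternatizeUncurryFin_apply]
    refine Finset.sum_congr rfl fun i _ => ?_
    have h2 : a (v i) = a ((v i).1, 0) := by
      have : v i = ((v i).1, 0) + (0, (v i).2) := by simp
      conv_lhs => rw [this, map_add, h, add_zero]
    rw [h2, zsmul_eq_mul]
    simp only [Int.cast_pow, Int.cast_neg, Int.cast_one]
    rfl
  -- The m + 1 projected vectors are linearly dependent in ℝ^m.
  rw [h1, AlternatingMap.map_linearDependent]
  · rfl
  · intro hli
    have := hli.fintype_card_le_finrank
    simp at this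

/-- The kernel of a ↦ a ∧ d^m x consists of the covectors that vanish on vertical vectors:
evaluating on (0, g) followed by the standard frame recovers a(0, g). Equations between such
(m+1)-forms thus become equations between vertical covectors. -/
theorem wedgeStdVolume_congr_iff {a b : Euc m × G →L[ℝ] ℝ} :
    wedgeStdVolume a = wedgeStdVolume b ↔ ∀ g, a (0, g) = b (0, g) := by
  constructor
  · intro h g
    rw [← wedgeStdVolume_cons_stdFrame, h, wedgeStdVolume_cons_stdFrame]
  · intro h
    have h1 : a = b + (a - b) := by abel
    rw [h1, wedgeStdVolume_add, wedgeStdVolume_eq_zero (a := a - b), add_zero]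
    intro g
    simp [h]

/-- The pull-back of `a ∧ d^m x` by a map that covers a linear map of the base. -/
theorem wedgeStdVolume_compContinuousLinearMap (a : Euc m × G' →L[ℝ] ℝ)
    {S : Euc m × G →L[ℝ] Euc m × G'} {D : Euc m →L[ℝ] Euc m} (h : ∀ v, (S v).1 = D v.1) :
    (wedgeStdVolume a).compContinuousLinearMap S =
      LinearMap.det (D : Euc m →ₗ[ℝ] Euc m) • wedgeStdVolume (a.comp S) := by
  ext v
  change wedgeStdVolume a (fun i => S (v i)) =
    LinearMap.det (D : Euc m →ₗ[ℝ] Euc m) • wedgeStdVolume (a.comp S) v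
  simp only [wedgeStdVolume_apply, Finset.smul_sum]
  refine Finset.sum_congr rfl fun i _ => ?_
  have := Module.Basis.det_comp (EuclideanSpace.basisFun (Fin m) ℝ).toBasis
    (D : Euc m →ₗ[ℝ] Euc m) (fun j => (i.removeNth v j).1)
  have h2 : (fun j => (i.removeNth (fun i => S (v i)) j).1) =
      (D : Euc m →ₗ[ℝ] Euc m) ∘ fun j => (i.removeNth v j).1 := by
    funext j
    exact h _
  rw [h2, this]
  simp only [ContinuousLinearMap.comp_apply, smul_eq_mul]
  ring

variable (m G) in
/-- The wedge product with `d^m x`, as a continuous linear map. -/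
def wedgeStdVolumeCLM [FiniteDimensional ℝ G] :
    (Euc m × G →L[ℝ] ℝ) →L[ℝ] (Euc m × G) [⋀^Fin (m + 1)]→L[ℝ] ℝ :=
  LinearMap.toContinuousLinearMap
    { toFun := wedgeStdVolume
      map_add' := wedgeStdVolume_add
      map_smul' := wedgeStdVolume_smul }

/-- `d (g d^m x) = dg ∧ d^m x`. -/
theorem extDeriv_smul_stdVolume {g : Euc m × G → ℝ} {y : Euc m × G}
    (hg : DifferentiableAt ℝ g y) :
    extDeriv (fun y => g y • (stdVolume m).compContinuousLinearMap
      (ContinuousLinearMap.fst ℝ (Euc m) G)) y = wedgeStdVolume (fderiv ℝ g y) := by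
  have h := hg.hasFDerivAt.smul_const ((stdVolume m).compContinuousLinearMap
    (ContinuousLinearMap.fst ℝ (Euc m) G))
  rw [extDeriv, wedgeStdVolume, h.fderiv]

end WedgeWithVolume

/-! ### Momenta of m-forms and contraction with vertical vectors -/

section Momenta

variable {m : ℕ} {F : Type*} [NormedAddCommGroup F] [NormedSpace ℝ F] [FiniteDimensional ℝ F]

theorem momentum_apply (a : (Euc m × F) [⋀^Fin m]→L[ℝ] ℝ) (i : Fin m) (u : F) :
    momentum a i u = a (Function.update (stdFrame m F) i (0, u)) := rfl

theorem momentum_add (a b : (Euc m × F) [⋀^Fin m]→L[ℝ] ℝ) (i : Fin m) :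
    momentum (a + b) i = momentum a i + momentum b i := by
  ext u
  simp [momentum_apply]

theorem momentum_smul (t : ℝ) (a : (Euc m × F) [⋀^Fin m]→L[ℝ] ℝ) (i : Fin m) :
    momentum (t • a) i = t • momentum a i := by
  ext u
  simp [momentum_apply]

/-- Moving the vertical vector from the i-th slot to the front costs (-1)^i. This is the sign that
appears in the alternating sum defining d, and it is why a divergence of momenta is an exterior
derivative. -/
theorem momentum_eq_cons {k : ℕ} (a : (Euc (k + 1) × F) [⋀^Fin (k + 1)]→L[ℝ] ℝ)
    (i : Fin (k + 1)) (u : F) :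
    momentum a i u = (-1) ^ (i : ℕ) *
      a (Fin.cons ((0 : Euc (k + 1)), u) (i.removeNth (stdFrame (k + 1) F))) := by
  rw [momentum_apply]
  have h := a.map_insertNth i ((0 : Euc (k + 1)), u) (i.removeNth (stdFrame (k + 1) F))
  rw [Fin.insertNth_removeNth, zsmul_eq_mul] at h
  rw [h]
  simp only [Int.cast_pow, Int.cast_neg, Int.cast_one]
  rfl

theorem alternatingMap_eq_zero_of_smul {ι U : Type*} [AddCommGroup U] [Module ℝ U]
    (f : U [⋀^ι]→ₗ[ℝ] ℝ) {v : ι → U} {i j : ι} (hij : i ≠ j) {e : U} {s t : ℝ}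
    (hi : v i = s • e) (hj : v j = t • e) : f v = 0 := by
  classical
  have h1 : v = Function.update (Function.update v j (t • e)) i (s • e) := by
    rw [← hi, ← hj]
    simp
  rw [h1, f.map_update_smul, Function.update_comm hij.symm, f.map_update_smul,
    f.map_eq_zero_of_eq _ _ hij]
  · simp
  · simp [Function.update_of_ne hij]

/-- The form `p ∧ d^{m-1} x_i`. -/
def momentumForm (p : F →L[ℝ] ℝ) (i : Fin m) : HForms (Euc m) F m 2 :=
  -- The form is d^m x pulled back by (x, u) ↦ x + (p(u) - x^i) e_i, a map that replaces the i-th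
  -- coordinate by p(u), hence dx^i by p.
  ⟨(stdVolume m).compContinuousLinearMap
    (ContinuousLinearMap.fst ℝ (Euc m) F +
      (p.comp (ContinuousLinearMap.snd ℝ (Euc m) F) -
        (EuclideanSpace.proj i).comp (ContinuousLinearMap.fst ℝ (Euc m) F)).smulRight
          (EuclideanSpace.single i (1 : ℝ))), by
    intro h v hv
    have e : ∀ j, (v j).1 = 0 → (ContinuousLinearMap.fst ℝ (Euc m) F +
      (p.comp (ContinuousLinearMap.snd ℝ (Euc m) F) -
        (EuclideanSpace.proj i).comp (ContinuousLinearMap.fst ℝ (Euc m) F)).smulRight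
          (EuclideanSpace.single i (1 : ℝ))) (v j) =
            p (v j).2 • EuclideanSpace.single i (1 : ℝ) := by
      intro j hj
      simp [hj]
    -- Vertical vectors are all sent to multiples of e_i, so two of them make the determinant
    -- vanish.
    exact alternatingMap_eq_zero_of_smul (EuclideanSpace.basisFun (Fin m) ℝ).toBasis.det
      (i := ⟨0, by omega⟩) (j := ⟨1, by omega⟩) (by simp)
      (e _ (hv _ (by simp))) (e _ (hv _ (by simp)))⟩

theorem momentumForm_apply (p : F →L[ℝ] ℝ) (i : Fin m) (v : Fin m → Euc m × F) :
    (momentumForm p i).form v = (EuclideanSpace.basisFun (Fin m) ℝ).toBasis.det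
      fun j => (v j).1 + (p (v j).2 - (v j).1 i) • EuclideanSpace.single i (1 : ℝ) := rfl

theorem momentum_momentumForm (p : F →L[ℝ] ℝ) (i j : Fin m) :
    momentum (momentumForm p i).form j = if j = i then p else 0 := by
  ext u
  rw [momentum_apply, momentumForm_apply]
  split_ifs with hij
  · subst hij
    have h : (fun l => (Function.update (stdFrame m F) j (0, u) l).1 +
        (p (Function.update (stdFrame m F) j (0, u) l).2 -
          (Function.update (stdFrame m F) j (0, u) l).1 j) • EuclideanSpace.single j (1 : ℝ)) =
        Function.update (fun l => EuclideanSpace.single l (1 : ℝ)) j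
          (p u • EuclideanSpace.single j (1 : ℝ)) := by
      funext l
      rcases eq_or_ne l j with rfl | hl
      · simp
      · simp [hl, hl.symm, stdFrame]
    rw [h, AlternatingMap.map_update_smul, Function.update_eq_self, det_single]
    simp
  -- For j ≠ i the i-th argument is still e_i, which is sent to e_i + (0 - 1) e_i = 0.
  · refine AlternatingMap.map_coord_zero _ i ?_
    have : i ≠ j := fun h => hij h.symm
    simp [this, stdFrame]

/-- Changing a later argument by a vertical vector adds a term with two vertical arguments, and a
2-horizontal form kills it. In degree one there are no later arguments. -/
theorem IsHorizontal.apply_cons_congr {k : ℕ} {B : Type*} [NormedAddCommGroup B] [NormedSpace ℝ B]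
    {a : (B × F) [⋀^Fin (k + 1)]→L[ℝ] ℝ}
    (ha : IsHorizontal (ContinuousLinearMap.fst ℝ B F) 2 a) {y : B × F} (hy : y.1 = 0)
    {v w : Fin k → B × F} (h : ∀ i, (v i).1 = (w i).1) :
    a (Fin.cons y v) = a (Fin.cons y w) := by
  rcases k with _ | k
  · rw [Subsingleton.elim v w]
  · refine apply_congr_radical (Ω := (a.curryLeft y).toAlternatingMap) fun i => ?_
    refine LinearMap.mem_ker.2 ?_
    ext x
    change a (Fin.cons y (Fin.cons (v i - w i) x)) = 0
    refine ha (by omega) _ ?_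
    refine Fin.cases (fun _ => hy) (Fin.cases (fun _ => ?_) fun j hj => ?_)
    · simp [h]
    · simp at hj

theorem hasFDerivAt_bilinear {X H K L : Type*} [NormedAddCommGroup X] [NormedSpace ℝ X]
    [NormedAddCommGroup H] [NormedSpace ℝ H] [NormedAddCommGroup K] [NormedSpace ℝ K]
    [NormedAddCommGroup L] [NormedSpace ℝ L] (Q : H →L[ℝ] K →L[ℝ] L) {a : X → H} {a' : X →L[ℝ] H}
    {b : X → K} {b' : X →L[ℝ] K} {x : X} (ha : HasFDerivAt a a' x) (hb : HasFDerivAt b b' x) :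
    HasFDerivAt (fun x => Q (a x) (b x)) ((Q (a x)).comp b' + (Q.comp a').flip (b x)) x :=
  (Q.hasFDerivAt.comp x ha).clm_apply hb

/-- The contraction of an `m`-form with a vertical vector, restricted to horizontal vectors. -/
def contraction (B F : Type*) [NormedAddCommGroup B] [NormedSpace ℝ B] [FiniteDimensional ℝ B]
    [NormedAddCommGroup F] [NormedSpace ℝ F] [FiniteDimensional ℝ F] (k : ℕ) :
    ((B × F) [⋀^Fin (k + 1)]→L[ℝ] ℝ) →L[ℝ] F →L[ℝ] B [⋀^Fin k]→L[ℝ] ℝ :=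
  LinearMap.toContinuousLinearMap (𝕜 := ℝ) (E := (B × F) [⋀^Fin (k + 1)]→L[ℝ] ℝ)
    (F' := F →L[ℝ] B [⋀^Fin k]→L[ℝ] ℝ)
    { toFun := fun a => LinearMap.toContinuousLinearMap (𝕜 := ℝ) (E := F)
        (F' := B [⋀^Fin k]→L[ℝ] ℝ)
        { toFun := fun y => (a.curryLeft (0, y)).compContinuousLinearMap
            (ContinuousLinearMap.inl ℝ B F)
          map_add' := fun y y' => by
            have h : ((0 : B), y + y') = (0, y) + (0, y') := by simp
            rw [h, map_add]
            rfl
          map_smul' := fun t y => by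
            have h : ((0 : B), t • y) = t • (0, y) := by simp
            rw [h, map_smul]
            rfl }
      map_add' := fun _ _ => rfl
      map_smul' := fun _ _ => rfl }

theorem contraction_apply {B : Type*} [NormedAddCommGroup B] [NormedSpace ℝ B]
    [FiniteDimensional ℝ B] {k : ℕ} (a : (B × F) [⋀^Fin (k + 1)]→L[ℝ] ℝ) (y : F)
    (v : Fin k → B) :
    contraction B F k a y v = a (Fin.cons ((0 : B), y) fun i => (v i, (0 : F))) := rfl

/-- The value of the exterior derivative of the `(m-1)`-form obtained by contracting a
`2`-horizontal `m`-form with a vertical vector. -/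
theorem extDeriv_contraction {k : ℕ} {a : Euc (k + 1) → (Euc (k + 1) × F) [⋀^Fin (k + 1)]→L[ℝ] ℝ}
    {a' : Euc (k + 1) →L[ℝ] (Euc (k + 1) × F) [⋀^Fin (k + 1)]→L[ℝ] ℝ}
    {Y : Euc (k + 1) → F} {Y' : Euc (k + 1) →L[ℝ] F} {x : Euc (k + 1)}
    (ha : HasFDerivAt a a' x) (hY : HasFDerivAt Y Y' x) :
    DifferentiableAt ℝ (fun x => contraction (Euc (k + 1)) F k (a x) (Y x)) x ∧
    extDeriv (fun x => contraction (Euc (k + 1)) F k (a x) (Y x)) x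
      (fun i => EuclideanSpace.single i (1 : ℝ)) =
      ∑ i, (momentum (a' (EuclideanSpace.single i 1)) i (Y x) +
        momentum (a x) i (Y' (EuclideanSpace.single i 1))) := by
  have h1 := hasFDerivAt_bilinear (H := (Euc (k + 1) × F) [⋀^Fin (k + 1)]→L[ℝ] ℝ)
    (L := Euc (k + 1) [⋀^Fin k]→L[ℝ] ℝ) (contraction (Euc (k + 1)) F k) ha hY
  refine ⟨h1.differentiableAt, ?_⟩
  rw [extDeriv, HasFDerivAt.fderiv h1, ContinuousAlternatingMap.alternatizeUncurryFin_apply]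
  refine Finset.sum_congr rfl fun i _ => ?_
  -- The i-th term of d is the derivative in the direction e_i evaluated on the other frame vectors.
  -- The product rule splits it in two, and the sign turns each part into an i-th momentum.
  rw [momentum_eq_cons, momentum_eq_cons, zsmul_eq_mul, ← mul_add]
  simp only [Int.cast_pow, Int.cast_neg, Int.cast_one]
  congr 1
  exact add_comm (a x (Fin.cons ((0 : Euc (k + 1)), Y' (EuclideanSpace.single i 1))
    (i.removeNth (stdFrame (k + 1) F)))) _

end Momenta

/-! ### Transformation law of the Tulczyjew covector -/

section ChangeOfCoordinates

variable {F : Type*} [NormedAddCommGroup F] [NormedSpace ℝ F] [FiniteDimensional ℝ F]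

theorem tulczyjewCovector_apply {m : ℕ} (w : Euc m ×
      ((F × HForms (Euc m) F m 2) × (Euc m →L[ℝ] F × HForms (Euc m) F m 2)))
    (x : Euc m) (U : F) (A : Euc m →L[ℝ] F) :
    tulczyjewCovector w (x, (U, A)) =
      ∑ i, (momentum (w.2.2 (EuclideanSpace.single i 1)).2.form i U +
        momentum w.2.1.2.form i (A (EuclideanSpace.single i 1))) := by
  simp [tulczyjewCovector]

/-- The inclusion of the horizontal forms in the space of all forms. -/
def HForms.formCLM (B F : Type*) [NormedAddCommGroup B] [NormedSpace ℝ B] [FiniteDimensional ℝ B]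
    [NormedAddCommGroup F] [NormedSpace ℝ F] [FiniteDimensional ℝ F] (k r : ℕ) :
    HForms B F k r →L[ℝ] (B × F) [⋀^Fin k]→L[ℝ] ℝ :=
  (horizontalSubmodule B F k r).subtypeL

theorem HForms.formCLM_apply {B F : Type*} [NormedAddCommGroup B] [NormedSpace ℝ B]
    [FiniteDimensional ℝ B] [NormedAddCommGroup F] [NormedSpace ℝ F] [FiniteDimensional ℝ F]
    {k r : ℕ} (a : HForms B F k r) : HForms.formCLM B F k r a = a.form := rfl

theorem fst_fderiv {B G G' : Type*} [NormedAddCommGroup B] [NormedSpace ℝ B]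
    [NormedAddCommGroup G] [NormedSpace ℝ G] [NormedAddCommGroup G'] [NormedSpace ℝ G']
    {J : B × G → B × G'} {χ : B → B} {y : B × G} (hJ : DifferentiableAt ℝ J y)
    (hχ : DifferentiableAt ℝ χ y.1) (h : ∀ᶠ y' in 𝓝 y, (J y').1 = χ y'.1) (v : B × G) :
    (fderiv ℝ J y v).1 = fderiv ℝ χ y.1 v.1 := by
  have e1 := hJ.hasFDerivAt.fst
  have e2 := hχ.hasFDerivAt.comp y (hasFDerivAt_fst (p := y))
  have e3 : (fun y => (J y).1) =ᶠ[𝓝 y] χ ∘ Prod.fst := h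
  exact congrArg (fun L => L v) ((e2.congr_of_eventuallyEq e3).unique e1).symm

theorem topForm_comp {m : ℕ} (f : Euc m [⋀^Fin m]→L[ℝ] ℝ) (D : Euc m →L[ℝ] Euc m)
    (v : Fin m → Euc m) :
    f (fun i => D (v i)) = LinearMap.det (D : Euc m →ₗ[ℝ] Euc m) * f v := by
  have h := f.toAlternatingMap.eq_smul_basis_det (EuclideanSpace.basisFun (Fin m) ℝ).toBasis
  have h1 : ∀ v, f v = f.toAlternatingMap (EuclideanSpace.basisFun (Fin m) ℝ).toBasis *
      (EuclideanSpace.basisFun (Fin m) ℝ).toBasis.det v := fun v =>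
    congrArg (fun g : Euc m [⋀^Fin m]→ₗ[ℝ] ℝ => g v) h
  have h2 := Module.Basis.det_comp (EuclideanSpace.basisFun (Fin m) ℝ).toBasis
    (D : Euc m →ₗ[ℝ] Euc m) v
  rw [h1 v, h1, mul_left_comm, ← h2]
  rfl

-- By `extDeriv_contraction`, the covector at `w` evaluated on (U, A) is d(i_Y s) on the standard
-- frame, for any s and Y with first-order data `w` and (U, A). A change of coordinates pulls the
-- (m-1)-form i_Y s back by the base map `χ`, d commutes with this pull-back, and in top degree the
-- pull-back multiplies by det Dχ. Here `τ`, `χ` and `T` play the role of the changes of coordinates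
-- on E, M and Λ^m_2 E, `ψ` is a local inverse of `χ`, and `A'` is the slope component of the
-- transported variation.
set_option maxHeartbeats 800000 in
theorem tulczyjewCovector_change {k : ℕ}
    {τ : Euc (k + 1) × F → Euc (k + 1) × F} {χ ψ : Euc (k + 1) → Euc (k + 1)}
    {T : Euc (k + 1) × (F × HForms (Euc (k + 1)) F (k + 1) 2) →
      Euc (k + 1) × (F × HForms (Euc (k + 1)) F (k + 1) 2)}
    {w w' : Euc (k + 1) × ((F × HForms (Euc (k + 1)) F (k + 1) 2) ×
      (Euc (k + 1) →L[ℝ] F × HForms (Euc (k + 1)) F (k + 1) 2))}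
    (hτ : ContDiffAt ℝ ∞ τ (w.1, w.2.1.1)) (hχ : ContDiffAt ℝ ∞ χ w.1)
    (hψ : ContDiffAt ℝ ∞ ψ (χ w.1))
    (hτχ : ∀ᶠ y in 𝓝 (w.1, w.2.1.1), (τ y).1 = χ y.1)
    (hψχ : ∀ᶠ x in 𝓝 w.1, ψ (χ x) = x)
    (hT : DifferentiableAt ℝ T (w.1, w.2.1))
    (hTω : ∀ᶠ q in 𝓝 (w.1, w.2.1), q.2.2.form =
      (T q).2.2.form.compContinuousLinearMap (fderiv ℝ τ (q.1, q.2.1)))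
    (h1 : w'.2.1 = (T (w.1, w.2.1)).2)
    (h2 : w'.2.2 = (ContinuousLinearMap.snd ℝ _ _).comp ((fderiv ℝ T (w.1, w.2.1)).comp
      ((ContinuousLinearMap.inl ℝ _ _ + (ContinuousLinearMap.inr ℝ _ _).comp w.2.2).comp
        (fderiv ℝ ψ (χ w.1)))))
    (U : F) (A : Euc (k + 1) →L[ℝ] F) {A' : Euc (k + 1) →L[ℝ] F}
    (hA' : ∀ e, A' e = (fderiv ℝ (fderiv ℝ τ) (w.1, w.2.1.1) (0, U)
      (fderiv ℝ ψ (χ w.1) e, (w.2.2 (fderiv ℝ ψ (χ w.1) e)).1)).2 +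
        (fderiv ℝ τ (w.1, w.2.1.1) (0, A (fderiv ℝ ψ (χ w.1) e))).2) :
    LinearMap.det (fderiv ℝ χ w.1 : Euc (k + 1) →ₗ[ℝ] Euc (k + 1)) *
      tulczyjewCovector w' (0, ((fderiv ℝ τ (w.1, w.2.1.1) (0, U)).2, A')) =
      tulczyjewCovector w (0, (U, A)) := by
  obtain ⟨x₀, ⟨u₀, ω₀⟩, Z⟩ := w
  simp only at *
  have hx₀ : ψ (χ x₀) = x₀ := hψχ.self_of_nhds
  have hψ' := (hψ.differentiableAt (by simp)).hasFDerivAt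
  set Dψ := fderiv ℝ ψ (χ x₀) with hDψ
  -- Affine representatives of the jet and of the variation suffice, because only values and first
  -- derivatives at `x₀` enter.
  set σ : Euc (k + 1) → F := fun x => u₀ + (Z (x - x₀)).1 with hσ
  set ω₁ : Euc (k + 1) → HForms (Euc (k + 1)) F (k + 1) 2 := fun x => ω₀ + (Z (x - x₀)).2 with hω₁
  set Y : Euc (k + 1) → F := fun x => U + A (x - x₀) with hY
  have hsub : HasFDerivAt (fun x : Euc (k + 1) => x - x₀) (ContinuousLinearMap.id ℝ _) x₀ :=
    (hasFDerivAt_id x₀).sub_const x₀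
  have hZ := Z.hasFDerivAt.comp x₀ hsub
  have hσ' : HasFDerivAt σ ((ContinuousLinearMap.fst ℝ _ _).comp Z) x₀ := hZ.fst.const_add u₀
  have hω' : HasFDerivAt ω₁ ((ContinuousLinearMap.snd ℝ _ _).comp Z) x₀ := hZ.snd.const_add ω₀
  have hY' : HasFDerivAt Y A x₀ := (A.hasFDerivAt.comp x₀ hsub).const_add U
  have hσ0 : σ x₀ = u₀ := by simp [hσ]
  have hω0 : ω₁ x₀ = ω₀ := by simp [hω₁]
  have hY0 : Y x₀ = U := by simp [hY]
  have hs : HasFDerivAt (fun x => (x, (σ x, ω₁ x))) (ContinuousLinearMap.inl ℝ _ _ +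
      (ContinuousLinearMap.inr ℝ (Euc (k + 1)) _).comp Z) x₀ := by
    refine ((hasFDerivAt_id x₀).prodMk (hσ'.prodMk hω')).congr_fderiv ?_
    ext1 v
    simp
  have hq : HasFDerivAt (fun x => (x, σ x)) ((ContinuousLinearMap.id ℝ _).prod
      ((ContinuousLinearMap.fst ℝ _ _).comp Z)) x₀ := (hasFDerivAt_id x₀).prodMk hσ'
  have hTs : HasFDerivAt (fun x' => T (ψ x', (σ (ψ x'), ω₁ (ψ x'))))
      ((fderiv ℝ T (x₀, u₀, ω₀)).comp ((ContinuousLinearMap.inl ℝ _ _ +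
        (ContinuousLinearMap.inr ℝ (Euc (k + 1)) _).comp Z).comp Dψ)) (χ x₀) := by
    refine HasFDerivAt.comp (g := T) (χ x₀) ?_ (HasFDerivAt.comp
      (g := fun x => (x, (σ x, ω₁ x))) (χ x₀) (by rwa [hx₀]) hψ')
    simp only [hx₀, hσ0, hω0]
    exact hT.hasFDerivAt
  have ha : HasFDerivAt (fun x' => (T (ψ x', (σ (ψ x'), ω₁ (ψ x')))).2.2.form)
      ((HForms.formCLM (Euc (k + 1)) F (k + 1) 2).comp ((ContinuousLinearMap.snd ℝ _ _).comp
        ((ContinuousLinearMap.snd ℝ _ _).comp ((fderiv ℝ T (x₀, u₀, ω₀)).comp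
          ((ContinuousLinearMap.inl ℝ _ _ +
        (ContinuousLinearMap.inr ℝ (Euc (k + 1)) _).comp Z).comp Dψ))))) (χ x₀) :=
    (HForms.formCLM (Euc (k + 1)) F (k + 1) 2).hasFDerivAt.comp (χ x₀) hTs.snd.snd
  have hYψ : HasFDerivAt (fun x' => ((0 : Euc (k + 1)), Y (ψ x')))
      ((ContinuousLinearMap.inr ℝ (Euc (k + 1)) F).comp (A.comp Dψ)) (χ x₀) :=
    (ContinuousLinearMap.inr ℝ (Euc (k + 1)) F).hasFDerivAt.comp (χ x₀)
      (HasFDerivAt.comp (g := Y) (χ x₀) (by rwa [hx₀]) hψ')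
  have hDτ : HasFDerivAt (fun x' => fderiv ℝ τ (ψ x', σ (ψ x')))
      ((fderiv ℝ (fderiv ℝ τ) (x₀, u₀)).comp (((ContinuousLinearMap.id ℝ _).prod
      ((ContinuousLinearMap.fst ℝ _ _).comp Z)).comp Dψ)) (χ x₀) := by
    refine HasFDerivAt.comp (g := fderiv ℝ τ) (χ x₀) ?_ (HasFDerivAt.comp
      (g := fun x => (x, σ x)) (χ x₀) (by rwa [hx₀]) hψ')
    simp only [hx₀, hσ0]
    exact ((hτ.fderiv_right (m := ∞) (by simp)).differentiableAt (by simp)).hasFDerivAt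
  -- The variation in the new coordinates is Dτ(0, Y) along the section; its derivative contains a
  -- second derivative of `τ`, which must match the one in `A'`.
  have hYt := (hDτ.clm_apply hYψ).snd
  obtain ⟨hdβ, hβ⟩ := extDeriv_contraction ha hYt
  obtain ⟨-, hβ₀⟩ := extDeriv_contraction
    ((HForms.formCLM (Euc (k + 1)) F (k + 1) 2).hasFDerivAt.comp x₀ hω') hY'
  have hfst : ∀ᶠ y in 𝓝 (x₀, u₀), ∀ v, (fderiv ℝ τ y v).1 = fderiv ℝ χ y.1 v.1 := by
    have d1 := (hτ.of_le (m := 1) (by simp)).eventually (by simp)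
    have d2 := (continuousAt_fst (p := (x₀, u₀))).eventually
      ((hχ.of_le (m := 1) (by simp)).eventually (by simp))
    filter_upwards [d1, d2, hτχ.eventually_nhds] with y d1 d2 d3 v
    exact fst_fderiv (d1.differentiableAt (by simp)) (d2.differentiableAt (by simp)) d3 v
  -- Near `x₀` the contracted form in the old coordinates is the pull-back by `χ` of the one in the
  -- new coordinates. An identity on a neighbourhood is needed, since it is about to be
  -- differentiated.
  have key : (fun x => contraction (Euc (k + 1)) F k
      ((HForms.formCLM (Euc (k + 1)) F (k + 1) 2 ∘ ω₁) x) (Y x)) =ᶠ[𝓝 x₀] fun x =>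
      (contraction (Euc (k + 1)) F k (T (ψ (χ x), (σ (ψ (χ x)), ω₁ (ψ (χ x))))).2.2.form
        (fderiv ℝ τ (ψ (χ x), σ (ψ (χ x))) (0, Y (ψ (χ x)))).2).compContinuousLinearMap
          (fderiv ℝ χ x) := by
    have e1 := hs.continuousAt.eventually (p := fun q => q.2.2.form =
      (T q).2.2.form.compContinuousLinearMap (fderiv ℝ τ (q.1, q.2.1)))
      (by simpa only [hσ0, hω0] using hTω)
    have e2 := hq.continuousAt.eventually
      (p := fun y => ∀ v, (fderiv ℝ τ y v).1 = fderiv ℝ χ y.1 v.1) (by simpa only [hσ0] using hfst)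
    filter_upwards [hψχ, e1, e2] with x hx e1 e2
    rw [hx]
    have e3 : (HForms.formCLM (Euc (k + 1)) F (k + 1) 2 ∘ ω₁) x = (ω₁ x).form := rfl
    rw [e3, e1]
    ext v
    rw [contraction_apply]
    change (T (x, σ x, ω₁ x)).2.2.form (fun i => fderiv ℝ τ (x, σ x)
      (Fin.cons (α := fun _ => Euc (k + 1) × F) ((0 : Euc (k + 1)), Y x) (fun i => (v i, (0 : F))) i)) =
      contraction (Euc (k + 1)) F k _ _ (fun i => fderiv ℝ χ x (v i))
    rw [contraction_apply]
    have e4 : (fun i => fderiv ℝ τ (x, σ x)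
        (Fin.cons (α := fun _ => Euc (k + 1) × F) ((0 : Euc (k + 1)), Y x)
          (fun i => (v i, (0 : F))) i)) =
        Fin.cons (α := fun _ => Euc (k + 1) × F)
          ((0 : Euc (k + 1)), (fderiv ℝ τ (x, σ x) (0, Y x)).2)
          (fun i => fderiv ℝ τ (x, σ x) (v i, 0)) := by
      funext i
      refine Fin.cases ?_ (fun i => rfl) i
      refine Prod.ext ?_ rfl
      have := e2 (0, Y x)
      simpa using this
    rw [e4]
    -- Dτ(v, 0) has a vertical component besides Dχ v; by 2-horizontality it does not matter next to
    -- the vertical vector in the first slot.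
    exact IsHorizontal.apply_cons_congr (T (x, σ x, ω₁ x)).2.2.2 rfl fun i => e2 (v i, 0)
  have hpb := extDeriv_pullback (f := χ) (x := x₀) (r := ∞) hdβ hχ minSmoothness_two_le_infty
  rw [← key.extDeriv_eq] at hpb
  have hfin := congrArg (fun f : Euc (k + 1) [⋀^Fin (k + 1)]→L[ℝ] ℝ =>
    f (fun i => EuclideanSpace.single i (1 : ℝ))) hpb
  rw [hβ₀, ContinuousAlternatingMap.compContinuousLinearMap_apply] at hfin
  -- The pulled-back top-degree form is evaluated on Dχ e_1, …, Dχ e_m, which produces the factor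
  -- det Dχ.
  have hdet := topForm_comp (extDeriv (fun x' => contraction (Euc (k + 1)) F k
    (T (ψ x', (σ (ψ x'), ω₁ (ψ x')))).2.2.form
        (fderiv ℝ τ (ψ x', σ (ψ x')) (0, Y (ψ x'))).2) (χ x₀)) (fderiv ℝ χ x₀)
        (fun i => EuclideanSpace.single i (1 : ℝ))
  rw [hβ] at hdet
  -- Differentiating Dτ(0, Y) along the section puts (0, U) in the second slot of D²τ, while
  -- prolonging the variation to jets puts it in the first.
  have hsymm : ∀ v v', fderiv ℝ (fderiv ℝ τ) (x₀, u₀) v v' =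
      fderiv ℝ (fderiv ℝ τ) (x₀, u₀) v' v := fun v v' =>
    ((hτ.isSymmSndFDerivAt minSmoothness_two_le_infty).eq v v')
  rw [tulczyjewCovector_apply, tulczyjewCovector_apply]
  simp only [hY0, hx₀, hσ0, hω0, Function.comp_apply, HForms.formCLM_apply,
    ContinuousLinearMap.comp_apply, ContinuousLinearMap.coe_snd'] at hfin hdet
  refine Eq.trans ?_ (hdet.symm.trans hfin.symm)
  congr 1
  refine Finset.sum_congr rfl fun i _ => ?_
  rw [h1, h2, hA', hsymm, add_comm (fderiv ℝ (fderiv ℝ τ) (x₀, u₀) _ _).2]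
  rfl

end ChangeOfCoordinates

/-! ### Changes of jet coordinates and the projection to J¹π -/

section Invariance

/-- The derivative is computed along the line t ↦ (x₀, u₀ + tU, A₀ + tA). The new slope is a product
of Dτ, the old slope and Dψ; only the first two factors vary, and the product rule gives the two
terms. -/
theorem fderiv_jet_vertical {B F : Type*} [NormedAddCommGroup B] [NormedSpace ℝ B]
    [NormedAddCommGroup F] [NormedSpace ℝ F] {τ : B × F → B × F} {ψ χ : B → B}
    {J : B × (F × (B →L[ℝ] F)) → B × (F × (B →L[ℝ] F))} {y : B × (F × (B →L[ℝ] F))}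
    (hτ : ContDiffAt ℝ ∞ τ (y.1, y.2.1)) (hJ : DifferentiableAt ℝ J y)
    (hJτ : ∀ᶠ w in 𝓝 y, J w = ((τ (w.1, w.2.1)).1, ((τ (w.1, w.2.1)).2,
      (ContinuousLinearMap.snd ℝ B F).comp ((fderiv ℝ τ (w.1, w.2.1)).comp
        ((ContinuousLinearMap.inl ℝ B F + (ContinuousLinearMap.inr ℝ B F).comp w.2.2).comp
          (fderiv ℝ ψ (τ (w.1, w.2.1)).1))))))
    (hτχ : ∀ᶠ y' in 𝓝 (y.1, y.2.1), (τ y').1 = χ y'.1) (U : F) (A : B →L[ℝ] F) :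
    fderiv ℝ J y (0, (U, A)) = (0, ((fderiv ℝ τ (y.1, y.2.1) (0, U)).2,
      (ContinuousLinearMap.snd ℝ B F).comp
        (((fderiv ℝ (fderiv ℝ τ) (y.1, y.2.1) (0, U)).comp
          (ContinuousLinearMap.inl ℝ B F + (ContinuousLinearMap.inr ℝ B F).comp y.2.2) +
        (fderiv ℝ τ (y.1, y.2.1)).comp ((ContinuousLinearMap.inr ℝ B F).comp A)).comp
          (fderiv ℝ ψ (χ y.1))))) := by
  obtain ⟨x₀, u₀, A₀⟩ := y
  have hγ : HasDerivAt (fun t : ℝ => (x₀, (u₀ + t • U, A₀ + t • A))) (0, (U, A)) 0 := by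
    have h1 : HasDerivAt (fun t : ℝ => u₀ + t • U) U 0 := by
      simpa using ((hasDerivAt_id (0 : ℝ)).smul_const U).const_add u₀
    have h2 : HasDerivAt (fun t : ℝ => A₀ + t • A) A 0 := by
      simpa using ((hasDerivAt_id (0 : ℝ)).smul_const A).const_add A₀
    exact (hasDerivAt_const _ _).prodMk (h1.prodMk h2)
  have hγ' : HasDerivAt (fun t : ℝ => (x₀, u₀ + t • U)) (0, U) 0 := by
    have h1 : HasDerivAt (fun t : ℝ => u₀ + t • U) U 0 := by
      simpa using ((hasDerivAt_id (0 : ℝ)).smul_const U).const_add u₀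
    exact (hasDerivAt_const _ _).prodMk h1
  have hA : HasDerivAt (fun t : ℝ => ContinuousLinearMap.inl ℝ B F +
      (ContinuousLinearMap.inr ℝ B F).comp (A₀ + t • A)) ((ContinuousLinearMap.inr ℝ B F).comp A)
      0 := by
    have h2 : HasDerivAt (fun t : ℝ => A₀ + t • A) A 0 := by
      simpa using ((hasDerivAt_id (0 : ℝ)).smul_const A).const_add A₀
    have h3 := (hasDerivAt_const (0 : ℝ) (ContinuousLinearMap.inr ℝ B F)).clm_comp h2
    simpa using h3.const_add (ContinuousLinearMap.inl ℝ B F)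
  have h0 : (fun t : ℝ => (x₀, (u₀ + t • U, A₀ + t • A))) 0 = (x₀, (u₀, A₀)) := by simp
  have h0' : (fun t : ℝ => (x₀, u₀ + t • U)) 0 = (x₀, u₀) := by simp
  have hJγ : HasDerivAt (fun t : ℝ => J (x₀, (u₀ + t • U, A₀ + t • A)))
      (fderiv ℝ J (x₀, (u₀, A₀)) (0, (U, A))) 0 :=
    HasFDerivAt.comp_hasDerivAt (f := fun t : ℝ => (x₀, (u₀ + t • U, A₀ + t • A))) 0
      (by simp only [zero_smul, add_zero]; exact hJ.hasFDerivAt) hγ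
  have hτγ : HasDerivAt (fun t : ℝ => (τ (x₀, u₀ + t • U)).2)
      (fderiv ℝ τ (x₀, u₀) (0, U)).2 0 :=
    (ContinuousLinearMap.snd ℝ B F).hasFDerivAt.comp_hasDerivAt 0
      (HasFDerivAt.comp_hasDerivAt (f := fun t : ℝ => (x₀, u₀ + t • U)) (f' := (0, U)) 0
        (by
          simp only [zero_smul, add_zero]
          exact (hτ.differentiableAt (by simp)).hasFDerivAt) hγ')
  have hDτγ : HasDerivAt (fun t : ℝ => fderiv ℝ τ (x₀, u₀ + t • U))
      (fderiv ℝ (fderiv ℝ τ) (x₀, u₀) (0, U)) 0 :=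
    HasFDerivAt.comp_hasDerivAt (f := fun t : ℝ => (x₀, u₀ + t • U)) (f' := (0, U)) 0
      (by
        simp only [zero_smul, add_zero]
        exact ((hτ.fderiv_right (m := ∞) (by simp)).differentiableAt (by simp)).hasFDerivAt) hγ'
  have h4 := ((hasDerivAt_const (0 : ℝ) (ContinuousLinearMap.snd ℝ B F)).clm_comp
    (hDτγ.clm_comp (hA.clm_comp (hasDerivAt_const (0 : ℝ) (fderiv ℝ ψ (χ x₀))))))
  have h5 := (hasDerivAt_const (0 : ℝ) (χ x₀)).prodMk (hτγ.prodMk h4)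
  -- As `τ` covers `χ`, the base point of the image stays at χ(x₀), so Dψ is a constant factor along
  -- the line.
  have h6 : (fun t : ℝ => J (x₀, (u₀ + t • U, A₀ + t • A))) =ᶠ[𝓝 0] fun t =>
      (χ x₀, ((τ (x₀, u₀ + t • U)).2, (ContinuousLinearMap.snd ℝ B F).comp
        ((fderiv ℝ τ (x₀, u₀ + t • U)).comp ((ContinuousLinearMap.inl ℝ B F +
          (ContinuousLinearMap.inr ℝ B F).comp (A₀ + t • A)).comp (fderiv ℝ ψ (χ x₀)))))) := by
    have e1 := hγ.continuousAt.eventually (by rw [h0]; exact hJτ)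
    have e2 := hγ'.continuousAt.eventually (by rw [h0']; exact hτχ)
    filter_upwards [e1, e2] with t e1 e2
    rw [e1, e2]
  rw [(hJγ.congr_of_eventuallyEq h6.symm).unique h5]
  simp only [zero_smul, add_zero, ContinuousLinearMap.zero_comp, ContinuousLinearMap.comp_zero,
    zero_add]
  refine Prod.ext rfl (Prod.ext rfl ?_)
  ext v
  simp

variable {B F : Type*} [NormedAddCommGroup B] [NormedSpace ℝ B] [FiniteDimensional ℝ B]
  [NormedAddCommGroup F] [NormedSpace ℝ F] [FiniteDimensional ℝ F]
  {M E : Type*} [TopologicalSpace M] [ChartedSpace B M] [IsManifold 𝓘(ℝ, B) ∞ M]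
  [TopologicalSpace E] [ChartedSpace (B × F) E] [IsManifold 𝓘(ℝ, B × F) ∞ E]
  {π : E → M} {k r : ℕ}

theorem FiberedChart.trans_fst (c c' : FiberedChart B F π) {y : B × F}
    (hy : y ∈ (c.total.symm.trans c'.total).source) :
    ((c'.total ∘ c.total.symm) y).1 = (c'.base ∘ c.base.symm) y.1 := by
  have h1 : y ∈ c.total.target := hy.1
  have h2 : c.total.symm y ∈ c'.total.source := hy.2
  have h3 := c.base_proj h1
  change (c'.total (c.total.symm y)).1 = c'.base (c.base.symm y.1)
  rw [c'.comm _ h2, ← h3, c.base.left_inv (c.mapsTo _ (c.total.map_target h1))]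

theorem FiberedChart.eventually_trans_fst (c c' : FiberedChart B F π) {u : E}
    (hu : u ∈ c.total.source) (hu' : u ∈ c'.total.source) :
    ∀ᶠ y in 𝓝 (c.total u), ((c'.total ∘ c.total.symm) y).1 = (c'.base ∘ c.base.symm) y.1 := by
  refine Filter.eventually_of_mem ((c.total.symm.trans c'.total).open_source.mem_nhds ?_)
    fun y hy => c.trans_fst c' hy
  exact ⟨c.total.map_source hu, by simpa [c.total.left_inv hu] using hu'⟩

theorem contDiffAt_chart_trans {V X : Type*} [NormedAddCommGroup V] [NormedSpace ℝ V]
    [TopologicalSpace X] [ChartedSpace V X] [IsManifold 𝓘(ℝ, V) ∞ X]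
    {φ φ' : OpenPartialHomeomorph X V}
    (hφ : φ ∈ IsManifold.maximalAtlas 𝓘(ℝ, V) ∞ X)
    (hφ' : φ' ∈ IsManifold.maximalAtlas 𝓘(ℝ, V) ∞ X) {x : X} (hx : x ∈ φ.source)
    (hx' : x ∈ φ'.source) : ContDiffAt ℝ ∞ (φ' ∘ φ.symm) (φ x) := by
  refine (contDiffOn_chart_trans hφ hφ').contDiffAt
    ((φ.symm.trans φ').open_source.mem_nhds ⟨φ.map_source hx, ?_⟩)
  simpa [φ.left_inv hx] using hx'

/-- The projection `(x, (u, p)) ↦ (x, u)`. -/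
def projBaseFst (B F H : Type*) [NormedAddCommGroup B] [NormedSpace ℝ B]
    [NormedAddCommGroup F] [NormedSpace ℝ F] [NormedAddCommGroup H] [NormedSpace ℝ H] :
    B × (F × H) →L[ℝ] B × F :=
  (ContinuousLinearMap.fst ℝ B _).prod ((ContinuousLinearMap.fst ℝ F _).comp
    (ContinuousLinearMap.snd ℝ B (F × H)))

/-- In induced charts the bundle projection forgets the form coordinate, so it is linear and equals
its own differential. -/
theorem dmap_total_comp_dmap_pt [IsFibered B F π] (c : FiberedChart B F π) (l : Lam B F π k r)
    (hl : l.pt ∈ c.total.source) :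
    (dmap (B × F) (B × F) c.total l.pt).comp
      (dmap (B × (F × HForms B F k r)) (B × F) Lam.pt l) =
      (projBaseFst B F (HForms B F k r)).comp
        (dmap (B × (F × HForms B F k r)) (B × (F × HForms B F k r))
          (Lam.fiberedChart c).total l) := by
  have hl2 : l ∈ (Lam.fiberedChart (k := k) (r := r) c).total.source := hl
  set P := projBaseFst B F (HForms B F k r) with hP
  have e1 : dmap (B × (F × HForms B F k r)) (B × F) P
      ((Lam.fiberedChart (k := k) (r := r) c).total l) = P := by
    rw [dmap, mfderiv_eq_fderiv]
    exact P.hasFDerivAt.fderiv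
  rw [← e1, ← dmap_comp (mdiff_chart c.total_mem hl)
    (Lam.contMDiff_pt.mdifferentiable (by simp) l),
    ← dmap_comp (P.differentiableAt.mdifferentiableAt)
      (mdiff_chart (Lam.fiberedChart (k := k) (r := r) c).total_mem hl2)]
  rfl

/-- The coordinates of the jet `j¹(ν ∘ s)` in terms of those of `j¹ s`. -/
theorem slope_jetProj [IsFibered B F π] (c : FiberedChart B F π)
    (z : J1 B (F × HForms B F k r) (Lam.toBase : Lam B F π k r → M))
    (hz : z.pt.pt ∈ c.total.source) :
    J1.slope c (jetProj z) =
      (ContinuousLinearMap.fst ℝ F (HForms B F k r)).comp (J1.slope (Lam.fiberedChart c) z) := by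
  rw [J1.slope, J1.slope]
  ext v
  exact congrArg (fun L : B × (F × HForms B F k r) →L[ℝ] B × F =>
    (L (z.lin (dmap B B c.base.symm (c.base (π z.pt.pt)) v))).2) (dmap_total_comp_dmap_pt c z.pt hz)

theorem J1.fiberedChart_total_apply [IsFibered B F π] (c : FiberedChart B F π) (z : J1 B F π) :
    (J1.fiberedChart c).total z = ((c.total z.pt).1, ((c.total z.pt).2, z.slope c)) := rfl

theorem fiberedChart_total_jetProj [IsFibered B F π] (c : FiberedChart B F π)
    (z : J1 B (F × HForms B F k r) (Lam.toBase : Lam B F π k r → M))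
    (hz : z.pt.pt ∈ c.total.source) :
    (J1.fiberedChart c).total (jetProj z) =
      (((J1.fiberedChart (Lam.fiberedChart c)).total z).1,
        (((J1.fiberedChart (Lam.fiberedChart c)).total z).2.1.1,
          (ContinuousLinearMap.fst ℝ F (HForms B F k r)).comp
            ((J1.fiberedChart (Lam.fiberedChart c)).total z).2.2)) := by
  rw [J1.fiberedChart_total_apply, slope_jetProj c z hz]
  rfl

end Invariance

/-! ### The Tulczyjew morphism does not depend on the coordinates -/

section Invariance

variable {k : ℕ} {F : Type*} [NormedAddCommGroup F] [NormedSpace ℝ F] [FiniteDimensional ℝ F]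
  {M E : Type*} [TopologicalSpace M] [ChartedSpace (Euc (k + 1)) M]
  [IsManifold 𝓘(ℝ, Euc (k + 1)) ∞ M]
  [TopologicalSpace E] [ChartedSpace (Euc (k + 1) × F) E]
  [IsManifold 𝓘(ℝ, Euc (k + 1) × F) ∞ E] {π : E → M} [IsFibered (Euc (k + 1)) F π]

/-- This is the coordinate identity `tulczyjewCovector_change` for actual changes of adapted charts.
The derivative of the jet transition along (0, g) is the prolonged variation given by
`fderiv_jet_vertical`. -/
theorem det_mul_tulczyjewCovector (c c' : FiberedChart (Euc (k + 1)) F π)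
    (z : JetMom (k + 1) F π) (hz : z.pt.pt ∈ c.total.source) (hz' : z.pt.pt ∈ c'.total.source)
    (g : F × (Euc (k + 1) →L[ℝ] F)) :
    LinearMap.det (fderiv ℝ (c'.base ∘ c.base.symm) (jetMomCoord c z).1 :
        Euc (k + 1) →ₗ[ℝ] Euc (k + 1)) *
      tulczyjewCovector (jetMomCoord c' z)
        (fderiv ℝ ((J1.fiberedChart c').total ∘ (J1.fiberedChart c).total.symm)
          ((J1.fiberedChart c).total (jetProj z)) (0, g)) =
      tulczyjewCovector (jetMomCoord c z) (0, g) := by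
  obtain ⟨U, A⟩ := g
  set C := Lam.fiberedChart (k := k + 1) (r := 2) c with hC
  set C' := Lam.fiberedChart (k := k + 1) (r := 2) c' with hC'
  set w := jetMomCoord c z with hw
  set w' := jetMomCoord c' z with hw'
  set τ := c'.total ∘ c.total.symm with hτ_def
  set χ := c'.base ∘ c.base.symm with hχ_def
  set ψ := c.base ∘ c'.base.symm with hψ_def
  set T := C'.total ∘ C.total.symm with hT_def
  have hzb : π z.pt.pt ∈ c.base.source := c.mapsTo _ hz
  have hzb' : π z.pt.pt ∈ c'.base.source := c'.mapsTo _ hz'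
  have hy : (w.1, w.2.1.1) = c.total z.pt.pt := rfl
  have hw1 : w.1 = c.base (π z.pt.pt) := c.comm _ hz
  have hq : (w.1, w.2.1) = C.total z.pt := rfl
  have hzC : z.pt ∈ C.total.source := hz
  have hzC' : z.pt ∈ C'.total.source := hz'
  have hχw : χ w.1 = c'.base (π z.pt.pt) := by
    rw [hw1, hχ_def, Function.comp_apply, c.base.left_inv hzb]
  have hτ : ContDiffAt ℝ ∞ τ (w.1, w.2.1.1) := by
    rw [hy]
    exact contDiffAt_chart_trans c.total_mem c'.total_mem hz hz'
  have hχ : ContDiffAt ℝ ∞ χ w.1 := by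
    rw [hw1]
    exact contDiffAt_chart_trans c.base_mem c'.base_mem hzb hzb'
  have hψ : ContDiffAt ℝ ∞ ψ (χ w.1) := by
    rw [hχw]
    exact contDiffAt_chart_trans c'.base_mem c.base_mem hzb' hzb
  have hτχ : ∀ᶠ y in 𝓝 (w.1, w.2.1.1), (τ y).1 = χ y.1 := by
    rw [hy]
    exact c.eventually_trans_fst c' hz hz'
  have hψχ : ∀ᶠ x in 𝓝 w.1, ψ (χ x) = x := by
    rw [hw1]
    refine Filter.eventually_of_mem ((c.base.symm.trans c'.base).open_source.mem_nhds
      ⟨c.base.map_source hzb, by simpa [c.base.left_inv hzb] using hzb'⟩) fun x hx => ?_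
    have h1 : c.base.symm x ∈ c'.base.source := hx.2
    change c.base (c'.base.symm (c'.base (c.base.symm x))) = x
    rw [c'.base.left_inv h1, c.base.right_inv hx.1]
  have hT : DifferentiableAt ℝ T (w.1, w.2.1) := by
    rw [hq]
    exact (contDiffAt_chart_trans C.total_mem C'.total_mem hzC hzC').differentiableAt (by simp)
  -- The transition formula is used from `c'` back to `c`, so that the old form appears as the
  -- pull-back of the new one by Dτ.
  have hTω : ∀ᶠ q in 𝓝 (w.1, w.2.1), q.2.2.form =
      (T q).2.2.form.compContinuousLinearMap (fderiv ℝ τ (q.1, q.2.1)) := by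
    rw [hq]
    refine Filter.eventually_of_mem ((C.total.symm.trans C'.total).open_source.mem_nhds
      ⟨C.total.map_source hzC, by simpa [C.total.left_inv hzC] using hzC'⟩) fun q hq => ?_
    have h1 : q ∈ C.total.target := hq.1
    have h2 : C.total.symm q ∈ C'.total.source := hq.2
    have h3 : C'.total.symm (T q) = C.total.symm q := C'.total.left_inv h2
    have hTq : T q ∈ ((Lam.chart (k := k + 1) (r := 2) c').symm.trans (Lam.chart c)).source := by
      refine ⟨C'.total.map_source h2, ?_⟩
      change C'.total.symm (T q) ∈ C.total.source
      rw [h3]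
      exact C.total.map_target h1
    have h4 : ((Lam.chart (k := k + 1) (r := 2) c').symm.trans (Lam.chart c)) (T q) = q := by
      change C.total (C'.total.symm (T q)) = q
      rw [h3, C.total.right_inv h1]
    obtain ⟨e1, e2, e3⟩ := Lam.chart_trans_apply c' c hTq
    have h5 : (c.total ∘ c'.total.symm) ((T q).1, (T q).2.1) = (q.1, q.2.1) := by
      refine Prod.ext ?_ ?_
      · rw [← e1, h4]
      · rw [← e2, h4]
    rw [h4, h5] at e3
    exact e3
  have hsrc : w ∈ ((J1.chart C).symm.trans (J1.chart C')).source := by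
    have h1 : z ∈ (J1.chart C).source := hz
    refine ⟨(J1.chart C).map_source h1, ?_⟩
    change (J1.chart C).symm ((J1.chart C) z) ∈ (J1.chart C').source
    rw [(J1.chart C).left_inv h1]
    exact hz'
  have hww' : ((J1.chart C).symm.trans (J1.chart C')) w = w' := by
    have h1 : z ∈ (J1.chart C).source := hz
    change (J1.chart C') ((J1.chart C).symm ((J1.chart C) z)) = (J1.chart C') z
    rw [(J1.chart C).left_inv h1]
  have happ := J1.chart_trans_apply C C' hsrc
  rw [hww'] at happ
  have hTfst : ((C'.total ∘ C.total.symm) (w.1, w.2.1)).1 = χ w.1 :=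
    (C.eventually_trans_fst C' hzC hzC').self_of_nhds
  have h1 : w'.2.1 = (T (w.1, w.2.1)).2 := by rw [happ]
  have h2 : w'.2.2 = (ContinuousLinearMap.snd ℝ _ _).comp ((fderiv ℝ T (w.1, w.2.1)).comp
      ((ContinuousLinearMap.inl ℝ _ _ + (ContinuousLinearMap.inr ℝ _ _).comp w.2.2).comp
        (fderiv ℝ ψ (χ w.1)))) := by
    rw [happ, hTfst]
    rfl
  -- the jet transition
  have hyJ := fiberedChart_total_jetProj c z hz
  have hp : jetProj z ∈ (J1.fiberedChart c).total.source := hz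
  have hp' : jetProj z ∈ (J1.fiberedChart c').total.source := hz'
  have hJ := (contDiffAt_chart_trans (J1.fiberedChart c).total_mem (J1.fiberedChart c').total_mem
    hp hp').differentiableAt (by simp)
  have hJτ := Filter.eventually_of_mem (((J1.fiberedChart c).total.symm.trans
    (J1.fiberedChart c').total).open_source.mem_nhds
      ⟨(J1.fiberedChart c).total.map_source hp,
        by simpa [(J1.fiberedChart c).total.left_inv hp] using hp'⟩)
    fun y hy => J1.chart_trans_apply c c' hy
  rw [hyJ] at hJ hJτ ⊢
  have hDJ := fderiv_jet_vertical (ψ := ψ) (χ := χ) hτ hJ hJτ hτχ U A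
  rw [hDJ]
  refine tulczyjewCovector_change hτ hχ hψ hτχ hψχ hT hTω h1 h2 U A fun e => ?_
  simp only [ContinuousLinearMap.comp_apply, add_apply, ContinuousLinearMap.coe_snd',
    ContinuousLinearMap.inl_apply, ContinuousLinearMap.inr_apply, Prod.snd_add,
    ContinuousLinearMap.coe_fst', Prod.mk_add_mk, add_zero, zero_add]
  rfl

/-- The expression defining the Tulczyjew morphism is the same in all adapted coordinates. -/
theorem tulczyjewIn_eq (c c' : FiberedChart (Euc (k + 1)) F π)
    (z : JetMom (k + 1) F π) (hz : z.pt.pt ∈ c.total.source) (hz' : z.pt.pt ∈ c'.total.source) :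
    tulczyjewIn c z hz = tulczyjewIn c' z hz' := by
  have hp : jetProj z ∈ (J1.fiberedChart c).total.source := hz
  have hp' : jetProj z ∈ (J1.fiberedChart c').total.source := hz'
  set y := (J1.fiberedChart c).total (jetProj z) with hy
  set J := (J1.fiberedChart c').total ∘ (J1.fiberedChart c).total.symm with hJ_def
  have hJ : DifferentiableAt ℝ J y := (contDiffAt_chart_trans (J1.fiberedChart c).total_mem
    (J1.fiberedChart c').total_mem hp hp').differentiableAt (by simp)
  have hw1 : y.1 = c.base (π z.pt.pt) := c.comm _ hz
  have hχ : DifferentiableAt ℝ (c'.base ∘ c.base.symm) y.1 := by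
    rw [hw1]
    exact (contDiffAt_chart_trans c.base_mem c'.base_mem (c.mapsTo _ hz)
      (c'.mapsTo _ hz')).differentiableAt (by simp)
  have hfst := fst_fderiv hJ hχ ((J1.fiberedChart c).eventually_trans_fst (J1.fiberedChart c') hp hp')
  -- Pulling back a ∧ d^m x produces the determinant of the base change. It is absorbed into the
  -- covector, and only vertical parts have to be compared.
  have key : (tulczyjewCoord (jetMomCoord c' z)).compContinuousLinearMap (fderiv ℝ J y) =
      tulczyjewCoord (jetMomCoord c z) := by
    rw [tulczyjewCoord, wedgeStdVolume_compContinuousLinearMap _ hfst, ← wedgeStdVolume_smul,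
      tulczyjewCoord, wedgeStdVolume_congr_iff]
    intro g
    exact det_mul_tulczyjewCovector c c' z hz hz' g
  have hdm : (fderiv ℝ J y).comp (dmap (Euc (k + 1) × (F × (Euc (k + 1) →L[ℝ] F)))
        (Euc (k + 1) × (F × (Euc (k + 1) →L[ℝ] F))) (J1.fiberedChart c).total (jetProj z)) =
      dmap (Euc (k + 1) × (F × (Euc (k + 1) →L[ℝ] F)))
        (Euc (k + 1) × (F × (Euc (k + 1) →L[ℝ] F))) (J1.fiberedChart c').total (jetProj z) := by
    have h1 := dmap_chart_trans (J1.fiberedChart c).total_mem (J1.fiberedChart c').total_mem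
      ((J1.fiberedChart c).total.map_source hp)
      (by rwa [(J1.fiberedChart c).total.left_inv hp])
    rw [← h1, ContinuousLinearMap.comp_assoc,
      dmap_chart_symm_comp (J1.fiberedChart c).total_mem hp,
      (J1.fiberedChart c).total.left_inv hp, ContinuousLinearMap.comp_id]
  refine Lam.ext rfl ?_
  change (tulczyjewCoord (jetMomCoord c z)).compContinuousLinearMap
    (dmap (Euc (k + 1) × (F × (Euc (k + 1) →L[ℝ] F)))
        (Euc (k + 1) × (F × (Euc (k + 1) →L[ℝ] F))) (J1.fiberedChart c).total (jetProj z)) =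
    (tulczyjewCoord (jetMomCoord c' z)).compContinuousLinearMap
      (dmap (Euc (k + 1) × (F × (Euc (k + 1) →L[ℝ] F)))
        (Euc (k + 1) × (F × (Euc (k + 1) →L[ℝ] F))) (J1.fiberedChart c').total (jetProj z))
  rw [← key, ← hdm]
  rfl

/-- Removes the pointwise choice of coordinates: on the whole domain of `c` the morphism is given by
one formula, which can be differentiated. -/
theorem tulczyjew_eq (c : FiberedChart (Euc (k + 1)) F π) (z : JetMom (k + 1) F π)
    (hz : z.pt.pt ∈ c.total.source) : tulczyjew π z = tulczyjewIn c z hz :=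
  tulczyjewIn_eq _ c z _ hz

end Invariance

theorem fderiv_continuousLinearMap {X Y : Type*} [NormedAddCommGroup X] [NormedSpace ℝ X]
    [NormedAddCommGroup Y] [NormedSpace ℝ Y] (L : X →L[ℝ] Y) {x : X} : fderiv ℝ L x = L := L.fderiv

/-! ### The tautological form in coordinates -/

section TautologicalForm

variable {B F : Type*} [NormedAddCommGroup B] [NormedSpace ℝ B] [FiniteDimensional ℝ B]
  [NormedAddCommGroup F] [NormedSpace ℝ F] [FiniteDimensional ℝ F]
  {M E : Type*} [TopologicalSpace M] [ChartedSpace B M] [IsManifold 𝓘(ℝ, B) ∞ M]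
  [TopologicalSpace E] [ChartedSpace (B × F) E] [IsManifold 𝓘(ℝ, B × F) ∞ E]
  {π : E → M} [IsFibered B F π] {k r : ℕ}

/-- The last coordinate of a point of Λᵏ_r E is the form itself read in the chart, and the bundle
projection is a constant linear map. Hence the coefficients of Θ are linear in the coordinates. -/
theorem Lam.inChart_theta (c : FiberedChart B F π) {w : B × (F × HForms B F k r)}
    (hw : w ∈ (Lam.fiberedChart (k := k) (r := r) c).total.target) :
    inChart (Lam.fiberedChart (k := k) (r := r) c).total (Lam.theta π k r) w =
      w.2.2.form.compContinuousLinearMap (projBaseFst B F (HForms B F k r)) := by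
  have hw' : (w.1, w.2.1) ∈ c.total.target := hw
  have h1 : (Lam.fiberedChart (k := k) (r := r) c).total.symm w =
    Lam.ofCoord c (w.1, w.2.1) hw' w.2.2 := Lam.chart_symm_apply c hw'
  have h2 := (Lam.fiberedChart (k := k) (r := r) c).total.map_target hw
  have h3 := dmap_total_comp_dmap_pt c _ h2
  have h4 := dmap_chart_comp_symm (Lam.fiberedChart (k := k) (r := r) c).total_mem hw
  have h5 := congrArg (fun L => ContinuousLinearMap.comp L (dmap (B × (F × HForms B F k r))
    (B × (F × HForms B F k r)) (Lam.fiberedChart (k := k) (r := r) c).total.symm w)) h3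
  simp only [ContinuousLinearMap.comp_assoc, h4, ContinuousLinearMap.comp_id] at h5
  have h6 : ((Lam.fiberedChart (k := k) (r := r) c).total.symm w).form =
      w.2.2.form.compContinuousLinearMap (dmap (B × F) (B × F) c.total
        ((Lam.fiberedChart (k := k) (r := r) c).total.symm w).pt) := by
    rw [h1]
    rfl
  rw [inChart, pullback, Lam.theta, h6, ← h5]
  rfl

theorem Lam.smoothFormAt_theta (l : Lam B F π k r) : SmoothFormAt (Lam.theta π k r) l := by
  let c : FiberedChart B F π := FiberedChart.around l.pt
  have hl : l ∈ (Lam.fiberedChart (k := k) (r := r) c).total.source := FiberedChart.mem_around l.pt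
  refine ⟨_, (Lam.fiberedChart (k := k) (r := r) c).total_mem, hl, ?_⟩
  have h1 : ContDiffAt ℝ ∞ (fun w : B × (F × HForms B F k r) =>
      w.2.2.form.compContinuousLinearMap (projBaseFst B F (HForms B F k r)))
      ((Lam.fiberedChart (k := k) (r := r) c).total l) :=
    contDiffAt_compContinuousLinearMap
      ((HForms.contDiff_form B F k r).comp contDiff_snd.snd).contDiffAt contDiffAt_const
  refine h1.congr_of_eventuallyEq (Filter.eventually_of_mem
    ((Lam.fiberedChart (k := k) (r := r) c).total.open_target.mem_nhds
      ((Lam.fiberedChart (k := k) (r := r) c).total.map_source hl)) fun w hw => ?_)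
  exact Lam.inChart_theta c hw

end TautologicalForm

/-! ### The Tulczyjew morphism as a linear map -/

section TulczyjewSmooth

variable {m : ℕ} {F : Type*} [NormedAddCommGroup F] [NormedSpace ℝ F] [FiniteDimensional ℝ F]

/-- The coordinate space of `J¹(π ∘ ν)`. -/
abbrev JetMomSpace (m : ℕ) (F : Type*) [NormedAddCommGroup F] [NormedSpace ℝ F]
    [FiniteDimensional ℝ F] : Type _ :=
  Euc m × ((F × HForms (Euc m) F m 2) × (Euc m →L[ℝ] F × HForms (Euc m) F m 2))

theorem HForms.form_add {B : Type*} [NormedAddCommGroup B] [NormedSpace ℝ B]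
    [FiniteDimensional ℝ B] {k r : ℕ} (a b : HForms B F k r) :
    (a + b).form = a.form + b.form := rfl

theorem HForms.form_smul {B : Type*} [NormedAddCommGroup B] [NormedSpace ℝ B]
    [FiniteDimensional ℝ B] {k r : ℕ} (t : ℝ) (a : HForms B F k r) :
    (t • a).form = t • a.form := rfl

theorem tulczyjewCovector_add (w w' : JetMomSpace m F) :
    tulczyjewCovector (w + w') = tulczyjewCovector w + tulczyjewCovector w' := by
  refine ContinuousLinearMap.ext fun ⟨x, U, A⟩ => ?_
  rw [add_apply]
  simp only [tulczyjewCovector_apply, ← Finset.sum_add_distrib]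
  refine Finset.sum_congr rfl fun i _ => ?_
  simp only [Prod.snd_add, Prod.fst_add, add_apply, HForms.form_add, momentum_add]
  ring

theorem tulczyjewCovector_smul (t : ℝ) (w : JetMomSpace m F) :
    tulczyjewCovector (t • w) = t • tulczyjewCovector w := by
  refine ContinuousLinearMap.ext fun ⟨x, U, A⟩ => ?_
  rw [smul_apply]
  simp only [tulczyjewCovector_apply, Finset.smul_sum]
  refine Finset.sum_congr rfl fun i _ => ?_
  simp only [Prod.smul_snd, Prod.smul_fst, smul_apply, HForms.form_smul, momentum_smul, smul_add]

variable (m F) in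
/-- The covector `p^i_{αi} du^α + p^i_α du^α_i`, as a linear function of the coordinates. -/
def tulczyjewCovectorCLM :
    JetMomSpace m F →L[ℝ] Euc m × (F × (Euc m →L[ℝ] F)) →L[ℝ] ℝ :=
  LinearMap.toContinuousLinearMap (𝕜 := ℝ) (E := JetMomSpace m F)
    (F' := Euc m × (F × (Euc m →L[ℝ] F)) →L[ℝ] ℝ)
    { toFun := tulczyjewCovector
      map_add' := tulczyjewCovector_add
      map_smul' := tulczyjewCovector_smul }

variable (m F) in
/-- The form `(p^i_{αi} du^α + p^i_α du^α_i) ∧ d^m x`, as a linear function of the coordinates. -/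
def tulczyjewCoordCLM :
    JetMomSpace m F →L[ℝ] (Euc m × (F × (Euc m →L[ℝ] F))) [⋀^Fin (m + 1)]→L[ℝ] ℝ :=
  (wedgeStdVolumeCLM m (F × (Euc m →L[ℝ] F))).comp (tulczyjewCovectorCLM m F)

variable (m F) in
/-- The projection `J¹(π ∘ ν) → J¹π` in coordinates. -/
def jetProjCoord : JetMomSpace m F →L[ℝ] Euc m × (F × (Euc m →L[ℝ] F)) :=
  LinearMap.toContinuousLinearMap (𝕜 := ℝ) (E := JetMomSpace m F)
    (F' := Euc m × (F × (Euc m →L[ℝ] F)))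
    { toFun := fun w => (w.1, (w.2.1.1, (ContinuousLinearMap.fst ℝ F _).comp w.2.2))
      map_add' := fun w w' => by
        refine Prod.ext rfl (Prod.ext rfl ?_)
        exact ContinuousLinearMap.comp_add _ _ _
      map_smul' := fun t w => by
        refine Prod.ext rfl (Prod.ext rfl ?_)
        exact ContinuousLinearMap.comp_smul _ _ _ }

theorem jetProjCoord_apply (w : JetMomSpace m F) : jetProjCoord m F w =
    (w.1, (w.2.1.1, (ContinuousLinearMap.fst ℝ F (HForms (Euc m) F m 2)).comp w.2.2)) := rfl

variable (m F) in
/-- The Tulczyjew morphism in coordinates. -/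
def tulczyjewMap : JetMomSpace m F →L[ℝ]
    Euc m × ((F × (Euc m →L[ℝ] F)) × HForms (Euc m) (F × (Euc m →L[ℝ] F)) (m + 1) 2) :=
  LinearMap.toContinuousLinearMap (𝕜 := ℝ) (E := JetMomSpace m F)
    (F' := Euc m × ((F × (Euc m →L[ℝ] F)) × HForms (Euc m) (F × (Euc m →L[ℝ] F)) (m + 1) 2))
    { toFun := fun w => ((jetProjCoord m F w).1, ((jetProjCoord m F w).2,
        (⟨tulczyjewCoord w, tulczyjewCoord_isHorizontal w⟩ :
          horizontalSubmodule (Euc m) (F × (Euc m →L[ℝ] F)) (m + 1) 2)))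
      map_add' := fun w w' => by
        rw [map_add]
        refine Prod.ext rfl (Prod.ext rfl (HForms.ext ?_))
        exact map_add (tulczyjewCoordCLM m F) w w'
      map_smul' := fun t w => by
        rw [map_smul]
        refine Prod.ext rfl (Prod.ext rfl (HForms.ext ?_))
        exact map_smul (tulczyjewCoordCLM m F) t w }

theorem tulczyjewMap_form (w : JetMomSpace m F) :
    (tulczyjewMap m F w).2.2.form = tulczyjewCoord w := rfl

end TulczyjewSmooth

/-! ### Smoothness of the morphism; closedness and coordinate expression of Ω̃ -/

section TulczyjewSmooth

variable {k : ℕ} {F : Type*} [NormedAddCommGroup F] [NormedSpace ℝ F] [FiniteDimensional ℝ F]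
  {M E : Type*} [TopologicalSpace M] [ChartedSpace (Euc (k + 1)) M]
  [IsManifold 𝓘(ℝ, Euc (k + 1)) ∞ M]
  [TopologicalSpace E] [ChartedSpace (Euc (k + 1) × F) E]
  [IsManifold 𝓘(ℝ, Euc (k + 1) × F) ∞ E] {π : E → M} [IsFibered (Euc (k + 1)) F π]

/-- The chart of `J¹(π ∘ ν)` induced by adapted coordinates. -/
abbrev jetMomChart (c : FiberedChart (Euc (k + 1)) F π) :
    OpenPartialHomeomorph (JetMom (k + 1) F π) (JetMomSpace (k + 1) F) :=
  (J1.fiberedChart (Lam.fiberedChart (k := k + 1) (r := 2) c)).total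

theorem jetMomChart_mem (c : FiberedChart (Euc (k + 1)) F π) :
    jetMomChart c ∈ IsManifold.maximalAtlas 𝓘(ℝ, JetMomSpace (k + 1) F) ∞ (JetMom (k + 1) F π) :=
  (J1.fiberedChart (Lam.fiberedChart (k := k + 1) (r := 2) c)).total_mem

/-- The chart of `Λ^{m+1}_2 J¹π` induced by adapted coordinates. -/
abbrev lamJetChart (c : FiberedChart (Euc (k + 1)) F π) :
    OpenPartialHomeomorph (Lam (Euc (k + 1)) (F × (Euc (k + 1) →L[ℝ] F))
      (J1.toBase : J1 (Euc (k + 1)) F π → M) (k + 1 + 1) 2)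
      (Euc (k + 1) × ((F × (Euc (k + 1) →L[ℝ] F)) ×
        HForms (Euc (k + 1)) (F × (Euc (k + 1) →L[ℝ] F)) (k + 1 + 1) 2)) :=
  (Lam.fiberedChart (k := k + 1 + 1) (r := 2) (J1.fiberedChart c)).total

/-- The form is defined by pulling the coordinate expression back by the differential of the chart
of J¹π; reading it in the induced chart composes with the inverse differential, and the two cancel.
What remains is linear. -/
theorem lamJetChart_tulczyjew (c : FiberedChart (Euc (k + 1)) F π) {z : JetMom (k + 1) F π}
    (hz : z ∈ (jetMomChart c).source) :
    lamJetChart c (tulczyjew π z) = tulczyjewMap (k + 1) F (jetMomChart c z) := by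
  have hz' : z.pt.pt ∈ c.total.source := hz
  have hp : jetProj z ∈ (J1.fiberedChart c).total.source := hz'
  rw [tulczyjew_eq c z hz']
  have h1 : ((J1.fiberedChart c).total (jetProj z)) = jetProjCoord (k + 1) F (jetMomChart c z) :=
    fiberedChart_total_jetProj c z hz'
  have h11 := congrArg Prod.fst h1
  have h12 := congrArg Prod.snd h1
  refine Prod.ext h11 (Prod.ext h12 (HForms.ext ?_))
  have hl : (tulczyjewIn c z hz').pt ∈ (J1.fiberedChart c).total.source := hp
  have h2 : (lamJetChart c (tulczyjewIn c z hz')).2.2 =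
      Lam.coeff (J1.fiberedChart c) (tulczyjewIn c z hz') hl := dif_pos hl
  rw [h2, tulczyjewMap_form]
  have h3 := dmap_chart_comp_symm (J1.fiberedChart c).total_mem
    ((J1.fiberedChart c).total.map_source hp)
  rw [(J1.fiberedChart c).total.left_inv hp] at h3
  ext v
  exact congrArg (tulczyjewCoord (jetMomCoord c z)) (funext fun i => congrArg (fun L => L (v i)) h3)

theorem contMDiff_tulczyjew : ContMDiff 𝓘(ℝ, JetMomSpace (k + 1) F)
    𝓘(ℝ, Euc (k + 1) × ((F × (Euc (k + 1) →L[ℝ] F)) ×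
        HForms (Euc (k + 1)) (F × (Euc (k + 1) →L[ℝ] F)) (k + 1 + 1) 2)) ∞ (tulczyjew (m := k + 1) (F := F) π) := by
  intro z
  let c : FiberedChart (Euc (k + 1)) F π := FiberedChart.around z.pt.pt
  have hz : z ∈ (jetMomChart c).source := FiberedChart.mem_around z.pt.pt
  -- Both memberships say that the point of E under q is in the domain of `c`.
  have hsrc : ∀ q ∈ (jetMomChart c).source, tulczyjew π q ∈ (lamJetChart c).source := fun q hq => hq
  have h1 := contMDiffAt_of_mem_maximalAtlas (jetMomChart_mem c) hz
  have h2 := (tulczyjewMap (k + 1) F).contDiff (n := ∞) |>.contDiffAt (x := jetMomChart c z)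
    |>.contMDiffAt
  have h3 : ContMDiffAt 𝓘(ℝ, Euc (k + 1) × ((F × (Euc (k + 1) →L[ℝ] F)) ×
        HForms (Euc (k + 1)) (F × (Euc (k + 1) →L[ℝ] F)) (k + 1 + 1) 2))
        𝓘(ℝ, Euc (k + 1) × ((F × (Euc (k + 1) →L[ℝ] F)) ×
        HForms (Euc (k + 1)) (F × (Euc (k + 1) →L[ℝ] F)) (k + 1 + 1) 2)) ∞
        (lamJetChart c).symm (tulczyjewMap (k + 1) F (jetMomChart c z)) := by
    rw [← lamJetChart_tulczyjew c hz]
    exact contMDiffAt_symm_of_mem_maximalAtlas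
      (Lam.fiberedChart (k := k + 1 + 1) (r := 2) (J1.fiberedChart c)).total_mem
      ((lamJetChart c).map_source (hsrc z hz))
  refine (h3.comp z (h2.comp z h1)).congr_of_eventuallyEq ?_
  filter_upwards [(jetMomChart c).open_source.mem_nhds hz] with q hq
  simp only [Function.comp_apply]
  rw [← lamJetChart_tulczyjew c hq, (lamJetChart c).left_inv (hsrc q hq)]

variable (π) in
/-- The pull-back by the Tulczyjew morphism of the tautological form. -/
def thetaTilde : JetMom (k + 1) F π → JetMomSpace (k + 1) F [⋀^Fin (k + 1 + 1)]→L[ℝ] ℝ :=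
  pullback (tulczyjew π) (Lam.theta (J1.toBase : J1 (Euc (k + 1)) F π → M) (k + 1 + 1) 2)

theorem smoothFormAt_thetaTilde (z : JetMom (k + 1) F π) : SmoothFormAt (thetaTilde π) z :=
  SmoothFormAt.pullback_form contMDiff_tulczyjew (Lam.smoothFormAt_theta _)

/-- Since the morphism is smooth, d commutes with the pull-back by it and Ω̃ is exact. This yields
both smoothness and closedness. -/
theorem omegaTilde_eq : omegaTilde (m := k + 1) (F := F) π = -dform (thetaTilde π) := by
  funext z
  rw [Pi.neg_apply, thetaTilde, dform_pullback contMDiff_tulczyjew (Lam.smoothFormAt_theta _)]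
  rfl

theorem SmoothFormAt.neg {V X : Type*} [NormedAddCommGroup V] [NormedSpace ℝ V]
    [TopologicalSpace X] [ChartedSpace V X] {j : ℕ} {a : X → V [⋀^Fin j]→L[ℝ] ℝ} {x : X}
    (h : SmoothFormAt a x) : SmoothFormAt (-a) x := by
  obtain ⟨φ, hφ, hx, h⟩ := h
  exact ⟨φ, hφ, hx, h.neg⟩

theorem isPremultisymplectic_omegaTilde :
    IsPremultisymplectic (omegaTilde (m := k + 1) (F := F) π) := by
  rw [omegaTilde_eq]
  refine ⟨isSmoothForm_iff.2 fun z => (smoothFormAt_dform smoothFormAt_thetaTilde z).neg,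
    fun z => ?_⟩
  rw [dform_neg, dform_dform smoothFormAt_thetaTilde, neg_zero]

theorem inChart_thetaTilde (c : FiberedChart (Euc (k + 1)) F π) {w : JetMomSpace (k + 1) F}
    (hw : w ∈ (jetMomChart c).target) : inChart (jetMomChart c) (thetaTilde π) w =
      (tulczyjewCoord w).compContinuousLinearMap (jetProjCoord (k + 1) F) := by
  have hz := (jetMomChart c).map_target hw
  have hsrc : ∀ q ∈ (jetMomChart c).source, tulczyjew π q ∈ (lamJetChart c).source := fun q hq => hq
  have hloc : ∀ w ∈ (jetMomChart c).target,
      (lamJetChart c ∘ tulczyjew π ∘ (jetMomChart c).symm) w = tulczyjewMap (k + 1) F w := by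
    intro w hw
    rw [Function.comp_apply, Function.comp_apply,
      lamJetChart_tulczyjew c ((jetMomChart c).map_target hw), (jetMomChart c).right_inv hw]
  have hev : (lamJetChart c ∘ tulczyjew π ∘ (jetMomChart c).symm) =ᶠ[𝓝 w] tulczyjewMap (k + 1) F :=
    Filter.eventually_of_mem ((jetMomChart c).open_target.mem_nhds hw) hloc
  have htgt : tulczyjewMap (k + 1) F w ∈ (lamJetChart c).target := by
    rw [← hloc w hw]
    exact (lamJetChart c).map_source (hsrc _ hz)
  rw [thetaTilde, pullback_symm_pullback contMDiff_tulczyjew (jetMomChart_mem c)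
    (Lam.fiberedChart (k := k + 1 + 1) (r := 2) (J1.fiberedChart c)).total_mem _ hw (hsrc _ hz),
    hev.fderiv_eq, fderiv_continuousLinearMap (tulczyjewMap (k + 1) F), hloc w hw,
    Lam.inChart_theta (J1.fiberedChart c) htgt]
  rfl

variable (k F) in
/-- The coordinate expression of `A^*Θ`, as a linear function of the coordinates. -/
def thetaCoord : JetMomSpace (k + 1) F →L[ℝ] JetMomSpace (k + 1) F [⋀^Fin (k + 1 + 1)]→L[ℝ] ℝ :=
  (ContinuousAlternatingMap.compContinuousLinearMapCLM (jetProjCoord (k + 1) F)).comp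
    (tulczyjewCoordCLM (k + 1) F)

variable (k F) in
/-- The coordinate expression of `Ω̃`. -/
def omegaCoord : JetMomSpace (k + 1) F [⋀^Fin (k + 1 + 1 + 1)]→L[ℝ] ℝ :=
  -ContinuousAlternatingMap.alternatizeUncurryFin (thetaCoord k F)

/-- A^*Θ is linear in the coordinates, so its derivative is constant and Ω̃ is a single fixed
alternating form in every induced chart. The Lagrangian property is thereby reduced to linear
algebra. -/
theorem omegaTilde_eq_omegaCoord (c : FiberedChart (Euc (k + 1)) F π) {z : JetMom (k + 1) F π}
    (hz : z ∈ (jetMomChart c).source) : omegaTilde (m := k + 1) (F := F) π z =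
      (omegaCoord k F).compContinuousLinearMap
        (dmap (JetMomSpace (k + 1) F) (JetMomSpace (k + 1) F) (jetMomChart c) z) := by
  have h1 : inChart (jetMomChart c) (thetaTilde π) =ᶠ[𝓝 (jetMomChart c z)] thetaCoord k F :=
    Filter.eventually_of_mem ((jetMomChart c).open_target.mem_nhds ((jetMomChart c).map_source hz))
      fun w hw => inChart_thetaTilde c hw
  rw [omegaTilde_eq, Pi.neg_apply, dform_eq (smoothFormAt_thetaTilde z) (jetMomChart_mem c) hz,
    h1.extDeriv_eq, extDeriv, fderiv_continuousLinearMap (X := JetMomSpace (k + 1) F)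
      (Y := JetMomSpace (k + 1) F [⋀^Fin (k + 1 + 1)]→L[ℝ] ℝ) (thetaCoord k F)]
  rfl

theorem omegaCoord_apply (v : Fin (k + 1 + 1 + 1) → JetMomSpace (k + 1) F) :
    omegaCoord k F v = -∑ i : Fin (k + 1 + 1 + 1), (-1 : ℝ) ^ (i : ℕ) *
      wedgeStdVolume (G := F × (Euc (k + 1) →L[ℝ] F)) (tulczyjewCovector (v i))
        (fun j => jetProjCoord (k + 1) F (i.removeNth v j)) := by
  have h : omegaCoord k F v =
      -(ContinuousAlternatingMap.alternatizeUncurryFin (thetaCoord k F)) v := rfl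
  rw [h, ContinuousAlternatingMap.alternatizeUncurryFin_apply]
  refine congrArg Neg.neg (Finset.sum_congr rfl fun i _ => ?_)
  rw [zsmul_eq_mul]
  simp only [Int.cast_pow, Int.cast_neg, Int.cast_one]
  rfl

end TulczyjewSmooth

/-! ### A criterion for Lagrangian subspaces of the quotient -/

section LagrangianCriterion

variable {U : Type*} [AddCommGroup U] [Module ℝ U] {k : ℕ}

theorem reducedForm_cons (Ω : U [⋀^Fin (k + 1)]→ₗ[ℝ] ℝ) (v : U) (x : Fin k → U) :
    (reducedForm Ω).curryLeft ((radical Ω).mkQ v) (fun i => (radical Ω).mkQ (x i)) =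
      Ω (Fin.cons v x) := by
  conv_rhs => rw [← reducedForm_mkQ Ω]
  rw [AlternatingMap.curryLeft_apply_apply, AlternatingMap.compLinearMap_apply]
  congr 1
  funext i
  refine Fin.cases rfl (fun i => rfl) i

/-- A subspace is mapped to a `k`-Lagrangian subspace of the quotient by the kernel of a
`(k+1)`-form if it is isotropic and maximal with this property modulo the kernel. -/
theorem isLagrangianSubspace_map {Ω : U [⋀^Fin (k + 1)]→ₗ[ℝ] ℝ} {K : Submodule ℝ U}
    (h₁ : ∀ v : Fin (k + 1) → U, (∀ i, v i ∈ K) → Ω v = 0)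
    (h₂ : ∀ v, (∀ x : Fin k → U, (∀ i, x i ∈ K) → Ω (Fin.cons v x) = 0) →
      ∃ a ∈ K, v - a ∈ radical Ω) :
    IsLagrangianSubspace (reducedForm Ω) k (K.map (radical Ω).mkQ) := by
  refine le_antisymm ?_ ?_
  · rintro _ ⟨v, hv, rfl⟩ x hx
    -- The order of orthogonality equals the number of remaining slots, so every entry of the test
    -- tuple lies in the image of K and can be lifted.
    choose y hy hyx using fun i => hx i i.2
    have h : x = fun i => (radical Ω).mkQ (y i) := funext fun i => (hyx i).symm
    rw [h, reducedForm_cons]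
    exact h₁ _ (Fin.cases hv hy)
  · intro q hq
    obtain ⟨v, rfl⟩ := (radical Ω).mkQ_surjective q
    obtain ⟨a, ha, hav⟩ := h₂ v fun x hx => by
      rw [← reducedForm_cons]
      exact hq _ fun i _ => ⟨x i, hx i, rfl⟩
    refine ⟨a, ha, ?_⟩
    have := (Submodule.Quotient.mk_eq_zero (radical Ω)).2 hav
    rw [Submodule.Quotient.mk_sub, sub_eq_zero] at this
    exact this.symm

end LagrangianCriterion

/-! ### Tangent spaces of submanifolds; shears -/

section Submanifolds

variable {V X : Type*} [NormedAddCommGroup V] [NormedSpace ℝ V] [FiniteDimensional ℝ V]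
  [TopologicalSpace X] [ChartedSpace V X] [IsManifold 𝓘(ℝ, V) ∞ X]

theorem trans_mem_maximalAtlas {φ : OpenPartialHomeomorph X V}
    (hφ : φ ∈ IsManifold.maximalAtlas 𝓘(ℝ, V) ∞ X) {e : OpenPartialHomeomorph V V}
    (he : e ∈ contDiffGroupoid ∞ 𝓘(ℝ, V)) :
    φ.trans e ∈ IsManifold.maximalAtlas 𝓘(ℝ, V) ∞ X := by
  refine mem_maximalAtlas_iff.2 fun e' he' => ?_
  obtain ⟨h₁, h₂⟩ := mem_maximalAtlas_iff.1 hφ e' he'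
  constructor
  · have h := StructureGroupoid.trans _ (StructureGroupoid.symm _ he) h₁
    rwa [← OpenPartialHomeomorph.trans_assoc,
      ← OpenPartialHomeomorph.trans_symm_eq_symm_trans_symm] at h
  · have h := StructureGroupoid.trans _ h₂ he
    rwa [OpenPartialHomeomorph.trans_assoc] at h

/-- The tangent space of a submanifold that is a linear subspace in a chart. -/
theorem mem_tangentSubspace_iff {S : Set X} {φ : OpenPartialHomeomorph X V}
    (hφ : φ ∈ IsManifold.maximalAtlas 𝓘(ℝ, V) ∞ X) {W : Submodule ℝ V}
    (hS : ∀ q ∈ φ.source, q ∈ S ↔ φ q ∈ W) {p : X} (hp : p ∈ φ.source) (hpS : p ∈ S) (v : V) :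
    v ∈ tangentSubspace V S p ↔ dmap V V φ p v ∈ W := by
  constructor
  · have hle : tangentSubspace V S p ≤ W.comap (dmap V V φ p : V →ₗ[ℝ] V) := by
      refine Submodule.span_le.2 ?_
      rintro _ ⟨γ, rfl, hγ, hγS, rfl⟩
      have hd := hγ.mdifferentiableAt (by simp)
      change dmap V V φ (γ 0) (dmap ℝ V γ 0 1) ∈ W
      have h1 : (dmap V V φ (γ 0)).comp (dmap ℝ V γ 0) = fderiv ℝ (φ ∘ γ) 0 := by
        rw [← dmap_comp (mdiff_chart hφ hp) hd]
        exact mfderiv_eq_fderiv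
      have h2 : DifferentiableAt ℝ (φ ∘ γ) 0 :=
        mdifferentiableAt_iff_differentiableAt.1 ((mdiff_chart hφ hp).comp 0 hd)
      have h3 : dmap V V φ (γ 0) (dmap ℝ V γ 0 1) = deriv (φ ∘ γ) 0 := by
        rw [← fderiv_apply_one_eq_deriv, ← h1]
        rfl
      rw [h3]
      have h4 : ∀ᶠ t in 𝓝 (0 : ℝ), (φ ∘ γ) t ∈ W := by
        filter_upwards [hγS, hd.continuousAt.eventually (φ.open_source.mem_nhds hp)] with t h h'
        exact (hS _ h').1 h
      -- A projection onto W fixes a curve that stays in W, hence it fixes its velocity, which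
      -- therefore lies in W.
      obtain ⟨N, hN⟩ := Submodule.ClosedComplemented.of_finiteDimensional W
      have h5 := (N.hasFDerivAt.comp_hasDerivAt 0 h2.hasDerivAt)
      have h6 := W.subtypeL.hasFDerivAt.comp_hasDerivAt 0 h5
      have h7 : (W.subtypeL ∘ N ∘ φ ∘ γ) =ᶠ[𝓝 0] φ ∘ γ := by
        filter_upwards [h4] with t h4
        exact congrArg W.subtypeL (hN ⟨_, h4⟩)
      have h8 := (h6.congr_of_eventuallyEq h7.symm).unique h2.hasDerivAt
      rw [← h8]
      exact (N _).2
    exact fun h => hle h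
  · intro hv
    have hW : φ p ∈ W := (hS p hp).1 hpS
    -- A straight segment in the chart stays in W and has the prescribed velocity.
    let γ₀ : ℝ → V := fun t => φ p + t • dmap V V φ p v
    have h0 : γ₀ 0 = φ p := by simp [γ₀]
    have hγ₀ : ContDiff ℝ ∞ γ₀ := by fun_prop
    have hd0 : HasDerivAt γ₀ (dmap V V φ p v) 0 := by
      have h := ((hasDerivAt_id (0 : ℝ)).smul_const (dmap V V φ p v)).const_add (φ p)
      rwa [one_smul] at h
    have ht : φ p ∈ φ.target := φ.map_source hp
    refine Submodule.subset_span ⟨φ.symm ∘ γ₀, ?_, ?_, ?_, ?_⟩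
    · simp [h0, φ.left_inv hp]
    · refine ContMDiffAt.comp 0 ?_ hγ₀.contDiffAt.contMDiffAt
      rw [h0]
      exact contMDiffAt_symm_of_mem_maximalAtlas hφ ht
    · have h1 : ∀ᶠ t in 𝓝 (0 : ℝ), γ₀ t ∈ φ.target :=
        hγ₀.continuous.continuousAt.eventually (by rw [h0]; exact φ.open_target.mem_nhds ht)
      filter_upwards [h1] with t h1
      refine (hS _ (φ.map_target h1)).2 ?_
      rw [φ.right_inv h1]
      exact W.add_mem hW (W.smul_mem t hv)
    · have h2 : dmap ℝ V (φ.symm ∘ γ₀) 0 = (dmap V V φ.symm (γ₀ 0)).comp (dmap ℝ V γ₀ 0) := by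
        refine dmap_comp ?_ (hγ₀.contDiffAt.differentiableAt (by simp)).mdifferentiableAt
        rw [h0]
        exact mdiff_chart_symm hφ ht
      have h3 : dmap ℝ V γ₀ 0 1 = dmap V V φ p v := by
        rw [dmap, mfderiv_eq_fderiv]
        exact hd0.deriv
      rw [h2, h0, ContinuousLinearMap.comp_apply, h3]
      exact (congrArg (fun L : V →L[ℝ] V => L v) (dmap_chart_symm_comp hφ hp)).symm

variable {Y Q : Type*} [NormedAddCommGroup Y] [NormedSpace ℝ Y]
  [NormedAddCommGroup Q] [NormedSpace ℝ Q]

/-- The change of coordinates `w ↦ w - R (f (P w))`, where `P ∘ R = 0`. -/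
def shear (P : V →L[ℝ] Y) (R : Q →L[ℝ] V) (hPR : ∀ q, P (R q) = 0) (f : Y → Q) {O : Set Y}
    (hO : IsOpen O) (hf : ContDiffOn ℝ ∞ f O) : OpenPartialHomeomorph V V where
  toFun w := w - R (f (P w))
  invFun w := w + R (f (P w))
  source := P ⁻¹' O
  target := P ⁻¹' O
  map_source' w hw := by simpa [hPR] using hw
  map_target' w hw := by simpa [hPR] using hw
  left_inv' w _ := by simp [hPR]
  right_inv' w _ := by simp [hPR]
  open_source := hO.preimage P.continuous
  open_target := hO.preimage P.continuous
  continuousOn_toFun := continuousOn_id.sub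
    (R.continuous.comp_continuousOn (hf.continuousOn.comp P.continuous.continuousOn fun _ h => h))
  continuousOn_invFun := continuousOn_id.add
    (R.continuous.comp_continuousOn (hf.continuousOn.comp P.continuous.continuousOn fun _ h => h))

theorem shear_mem_contDiffGroupoid (P : V →L[ℝ] Y) (R : Q →L[ℝ] V) (hPR : ∀ q, P (R q) = 0)
    (f : Y → Q) {O : Set Y} (hO : IsOpen O) (hf : ContDiffOn ℝ ∞ f O) :
    shear P R hPR f hO hf ∈ contDiffGroupoid ∞ 𝓘(ℝ, V) := by
  have h : ContDiffOn ℝ ∞ (fun w => R (f (P w))) (P ⁻¹' O) :=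
    R.contDiff.comp_contDiffOn (hf.comp P.contDiff.contDiffOn fun _ h => h)
  rw [contDiffGroupoid, mem_groupoid_of_pregroupoid]
  constructor
  · have h1 := contDiffOn_id.sub h
    simpa [contDiffPregroupoid, shear, Function.comp_def] using h1
  · have h1 := contDiffOn_id.add h
    simpa [contDiffPregroupoid, shear, Function.comp_def] using h1

end Submanifolds

theorem hasFDerivAt_continuousLinearMap_comp {X Y Z : Type*} [NormedAddCommGroup X]
    [NormedSpace ℝ X] [NormedAddCommGroup Y] [NormedSpace ℝ Y] [NormedAddCommGroup Z]
    [NormedSpace ℝ Z] (T : Y →L[ℝ] Z) {f : X → Y} {f' : X →L[ℝ] Y} {x : X}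
    (hf : HasFDerivAt f f' x) : HasFDerivAt (fun x => T (f x)) (T.comp f') x :=
  T.hasFDerivAt.comp x hf

/-- The sum is d(dg ∧ d^m x) evaluated on u, and dg ∧ d^m x = d(g d^m x) near y, so it vanishes by
d² = 0. Isotropy of the tangent spaces of S_ℒ rests on this identity. -/
theorem sum_wedgeStdVolume_fderiv_fderiv {m : ℕ} {G : Type*} [NormedAddCommGroup G]
    [NormedSpace ℝ G] [FiniteDimensional ℝ G] {g : Euc m × G → ℝ} {y : Euc m × G}
    (hg : ContDiffAt ℝ ∞ g y) (u : Fin (m + 1 + 1) → Euc m × G) :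
    ∑ i : Fin (m + 1 + 1), (-1 : ℝ) ^ (i : ℕ) *
      wedgeStdVolume (fderiv ℝ (fderiv ℝ g) y (u i)) (fun j => i.removeNth u j) = 0 := by
  have hg' : ContDiffAt ℝ ∞ (fderiv ℝ g) y := hg.fderiv_right (m := ∞) (by simp)
  have h2 : HasFDerivAt (fun y => wedgeStdVolume (fderiv ℝ g y))
      ((wedgeStdVolumeCLM m G).comp (fderiv ℝ (fderiv ℝ g) y)) y :=
    hasFDerivAt_continuousLinearMap_comp (Y := Euc m × G →L[ℝ] ℝ)
      (Z := (Euc m × G) [⋀^Fin (m + 1)]→L[ℝ] ℝ) (wedgeStdVolumeCLM m G)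
      (hg'.differentiableAt (by simp)).hasFDerivAt
  have h3 : (fun y => extDeriv (fun y => g y • (stdVolume m).compContinuousLinearMap
      (ContinuousLinearMap.fst ℝ (Euc m) G)) y) =ᶠ[𝓝 y]
      fun y => wedgeStdVolume (fderiv ℝ g y) := by
    filter_upwards [(hg.of_le (show (1 : WithTop ℕ∞) ≤ ∞ from by simp)).eventually (by simp)]
      with x hx
    exact extDeriv_smul_stdVolume (hx.differentiableAt (by simp))
  have h4 : extDeriv (fun y => wedgeStdVolume (fderiv ℝ g y)) y = 0 := by
    rw [← h3.extDeriv_eq]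
    have h5 : ContDiffAt ℝ ∞ (fun y => g y • (stdVolume m).compContinuousLinearMap
        (ContinuousLinearMap.fst ℝ (Euc m) G)) y :=
      ContDiffAt.comp (g := ContinuousLinearMap.toSpanSingleton ℝ
        ((stdVolume m).compContinuousLinearMap (ContinuousLinearMap.fst ℝ (Euc m) G))) y
        (ContinuousLinearMap.contDiff _).contDiffAt hg
    exact extDeriv_extDeriv_apply (r := ∞) h5 minSmoothness_two_le_infty
  rw [extDeriv, h2.fderiv] at h4
  have h5 := congrArg (fun a : (Euc m × G) [⋀^Fin (m + 1 + 1)]→L[ℝ] ℝ => a u) h4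
  rw [ContinuousAlternatingMap.alternatizeUncurryFin_apply] at h5
  refine Eq.trans (Finset.sum_congr rfl fun i _ => ?_) h5
  simp only [zsmul_eq_mul, Int.cast_pow, Int.cast_neg, Int.cast_one]
  rfl

theorem cons_sub_apply {V : Type*} [NormedAddCommGroup V] [NormedSpace ℝ V] {n : ℕ}
    (f : V [⋀^Fin (n + 1)]→L[ℝ] ℝ) (v a : V) (x : Fin n → V) :
    f (Fin.cons (v - a) x) = f (Fin.cons v x) - f (Fin.cons a x) := by
  have h := f.toContinuousMultilinearMap.cons_add x (v - a) a
  rw [sub_add_cancel] at h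
  exact eq_sub_of_add_eq h.symm

/-! ### Linear algebra of Ω̃ in coordinates -/

section LinearModel

variable {k : ℕ} {F : Type*} [NormedAddCommGroup F] [NormedSpace ℝ F] [FiniteDimensional ℝ F]

/-- The forms p ∧ d^{m-1} x_i have p as i-th momentum and all other momenta zero, so their sums
realise any family of momenta. -/
theorem exists_momentum_eq {m : ℕ} (p : Fin m → F →L[ℝ] ℝ) :
    ∃ a : HForms (Euc m) F m 2, ∀ j, momentum a.form j = p j := by
  let T (j : Fin m) : HForms (Euc m) F m 2 →ₗ[ℝ] F →L[ℝ] ℝ :=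
    { toFun := fun a => momentum a.form j
      map_add' := fun a b => momentum_add _ _ j
      map_smul' := fun t a => momentum_smul t _ j }
  refine ⟨∑ i, momentumForm (p i) i, fun j => ?_⟩
  change T j (∑ i, momentumForm (p i) i) = p j
  rw [map_sum]
  have h : ∀ i, T j (momentumForm (p i) i) = if j = i then p i else 0 := fun i =>
    momentum_momentumForm (p i) i j
  simp [h]

theorem eq_sum_smulRight {m : ℕ} (A : Euc m →L[ℝ] F) :
    A = ∑ i, (EuclideanSpace.proj i : Euc m →L[ℝ] ℝ).smulRight
      (A (EuclideanSpace.single i (1 : ℝ))) := by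
  refine ContinuousLinearMap.ext fun x => ?_
  have hx : x = ∑ i, x i • EuclideanSpace.single i (1 : ℝ) := by
    have := (EuclideanSpace.basisFun (Fin m) ℝ).sum_repr x
    simpa using this.symm
  conv_lhs => rw [hx, map_sum]
  simp

variable (k F) in
/-- The restriction of the covector `p^i_{αi} du^α + p^i_α du^α_i` to vertical vectors. -/
def verticalCovector : JetMomSpace (k + 1) F →L[ℝ] (F × (Euc (k + 1) →L[ℝ] F)) →L[ℝ] ℝ :=
  LinearMap.toContinuousLinearMap (𝕜 := ℝ) (E := JetMomSpace (k + 1) F)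
    (F' := (F × (Euc (k + 1) →L[ℝ] F)) →L[ℝ] ℝ)
    { toFun := fun w => (tulczyjewCovector w).comp (ContinuousLinearMap.inr ℝ (Euc (k + 1)) _)
      map_add' := fun w w' => by
        rw [tulczyjewCovector_add]
        rfl
      map_smul' := fun t w => by
        rw [tulczyjewCovector_smul]
        rfl }

theorem verticalCovector_apply (w : JetMomSpace (k + 1) F) (g : F × (Euc (k + 1) →L[ℝ] F)) :
    verticalCovector k F w g = tulczyjewCovector w (0, g) := rfl

/-- The momenta p^i_α are free, which prescribes the du^α_i part, and the divergence p^i_{αi} is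
made arbitrary by letting a single momentum vary in a single direction. All of this happens over a
fixed vector of J¹π. -/
theorem exists_verticalCovector_eq (q : (F × (Euc (k + 1) →L[ℝ] F)) →L[ℝ] ℝ) :
    ∃ w : JetMomSpace (k + 1) F, jetProjCoord (k + 1) F w = 0 ∧ verticalCovector k F w = q := by
  -- As A = Σ dx^i ⊗ A e_i, the functional A ↦ q(0, A) is determined by the covectors u ↦ q(0, dx^i
  -- ⊗ u), which are taken as momenta.
  obtain ⟨a, ha⟩ := exists_momentum_eq (m := k + 1) (F := F) fun i =>
    q.comp ((ContinuousLinearMap.inr ℝ F _).comp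
      (ContinuousLinearMap.smulRightL ℝ (Euc (k + 1)) F (EuclideanSpace.proj i)))
  let b : HForms (Euc (k + 1)) F (k + 1) 2 :=
    momentumForm (q.comp (ContinuousLinearMap.inl ℝ F _)) 0
  -- Only the derivative along the coordinate with index 0 is nonzero, so the divergence reduces to
  -- the momentum of `b` with that index. Such a coordinate exists because m = k + 1.
  let Ξ : Euc (k + 1) →L[ℝ] F × HForms (Euc (k + 1)) F (k + 1) 2 :=
    (EuclideanSpace.proj (0 : Fin (k + 1)) : Euc (k + 1) →L[ℝ] ℝ).smulRight (0, b)
  refine ⟨(0, ((0, a), Ξ)), ?_, ?_⟩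
  · rw [jetProjCoord_apply]
    refine Prod.ext rfl (Prod.ext rfl ?_)
    ext x
    simp [Ξ]
  · refine ContinuousLinearMap.ext fun ⟨U, A⟩ => ?_
    rw [verticalCovector_apply, tulczyjewCovector_apply, Finset.sum_add_distrib]
    have h1 : ∀ i, momentum (Ξ (EuclideanSpace.single i 1)).2.form i U =
        if i = 0 then q (U, 0) else 0 := by
      intro i
      have h2 : (Ξ (EuclideanSpace.single i 1)).2 = (if i = 0 then (1 : ℝ) else 0) • b := by
        have h4 : Ξ (EuclideanSpace.single i 1) = (if i = 0 then (1 : ℝ) else 0) • ((0 : F), b) := by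
          simp [Ξ, eq_comm]
        rw [h4]
        rfl
      rw [h2, HForms.form_smul, momentum_smul, smul_apply]
      have h3 : momentum b.form i = _ := momentum_momentumForm _ 0 i
      rw [h3]
      split_ifs with h
      · simp
      · simp
    have h2 : ∑ i, momentum a.form i (A (EuclideanSpace.single i 1)) = q (0, A) := by
      simp only [ha]
      conv_rhs => rw [eq_sum_smulRight A]
      have h3 : ((0 : F), ∑ i, (EuclideanSpace.proj i : Euc (k + 1) →L[ℝ] ℝ).smulRight
          (A (EuclideanSpace.single i (1 : ℝ)))) = ∑ i, ((0 : F), (EuclideanSpace.proj i :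
            Euc (k + 1) →L[ℝ] ℝ).smulRight (A (EuclideanSpace.single i (1 : ℝ)))) := by
        exact map_sum (ContinuousLinearMap.inr ℝ F (Euc (k + 1) →L[ℝ] F))
          (fun i => (EuclideanSpace.proj i : Euc (k + 1) →L[ℝ] ℝ).smulRight
            (A (EuclideanSpace.single i (1 : ℝ)))) Finset.univ
      rw [h3, map_sum]
      rfl
    simp only [h1, h2, Finset.sum_ite_eq', Finset.mem_univ, if_true]
    rw [← map_add]
    simp

variable (k F) in
-- Choosing the preimages linearly gives the direction R of the shear: it moves the value of T
-- arbitrarily without changing the point of J¹π.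
theorem exists_section_verticalCovector :
    ∃ R : ((F × (Euc (k + 1) →L[ℝ] F)) →L[ℝ] ℝ) →L[ℝ] JetMomSpace (k + 1) F,
      (∀ q, jetProjCoord (k + 1) F (R q) = 0) ∧ ∀ q, verticalCovector k F (R q) = q := by
  let N : Submodule ℝ (JetMomSpace (k + 1) F) :=
    LinearMap.ker (jetProjCoord (k + 1) F).toLinearMap
  let T : N →ₗ[ℝ] (F × (Euc (k + 1) →L[ℝ] F)) →L[ℝ] ℝ :=
    (verticalCovector k F).toLinearMap.comp N.subtype
  have hT : LinearMap.range T = ⊤ := by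
    refine LinearMap.range_eq_top.2 fun q => ?_
    obtain ⟨w, hw, hwq⟩ := exists_verticalCovector_eq q
    exact ⟨⟨w, hw⟩, hwq⟩
  obtain ⟨s, hs⟩ := T.exists_rightInverse_of_surjective hT
  refine ⟨LinearMap.toContinuousLinearMap (𝕜 := ℝ)
    (E := (F × (Euc (k + 1) →L[ℝ] F)) →L[ℝ] ℝ) (F' := JetMomSpace (k + 1) F) (N.subtype.comp s),
    fun q => (s q).2, fun q => LinearMap.congr_fun hs q⟩

/-- The point with given coordinates in `J¹π` and vanishing momenta. -/
def zeroMomenta (y : Euc (k + 1) × (F × (Euc (k + 1) →L[ℝ] F))) : JetMomSpace (k + 1) F :=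
  (y.1, ((y.2.1, 0), (ContinuousLinearMap.inl ℝ F _).comp y.2.2))

theorem jetProjCoord_zeroMomenta (y : Euc (k + 1) × (F × (Euc (k + 1) →L[ℝ] F))) :
    jetProjCoord (k + 1) F (zeroMomenta y) = y := by
  rw [jetProjCoord_apply, zeroMomenta]
  refine Prod.ext rfl (Prod.ext rfl ?_)
  rfl

theorem verticalCovector_zeroMomenta (y : Euc (k + 1) × (F × (Euc (k + 1) →L[ℝ] F))) :
    verticalCovector k F (zeroMomenta y) = 0 := by
  have h0 : ∀ i, momentum (0 : HForms (Euc (k + 1)) F (k + 1) 2).form i = 0 := by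
    intro i
    have := momentum_smul (0 : ℝ) (0 : HForms (Euc (k + 1)) F (k + 1) 2).form i
    rw [← HForms.form_smul, zero_smul, zero_smul] at this
    exact this
  refine ContinuousLinearMap.ext fun ⟨U, A⟩ => ?_
  rw [verticalCovector_apply, tulczyjewCovector_apply]
  refine Finset.sum_eq_zero fun i _ => ?_
  have h1 : ((zeroMomenta y).2.2 (EuclideanSpace.single i 1)).2 = 0 := rfl
  have h2 : (zeroMomenta y).2.1.2 = 0 := rfl
  rw [h1, h2, h0]
  simp

/-- The first term has a covector with zero vertical part, and every other term has P v = 0 among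
its arguments. Hence ker P ∩ ker T is contained in the kernel of Ω̃. -/
theorem omegaCoord_cons_eq_zero {v : JetMomSpace (k + 1) F} (hP : jetProjCoord (k + 1) F v = 0)
    (hT : verticalCovector k F v = 0) (x : Fin (k + 1 + 1) → JetMomSpace (k + 1) F) :
    omegaCoord k F (Fin.cons v x) = 0 := by
  rw [omegaCoord_apply, neg_eq_zero]
  refine Finset.sum_eq_zero fun i _ => ?_
  refine Fin.cases ?_ (fun i => ?_) i
  · rw [wedgeStdVolume_eq_zero]
    · simp
    · intro g
      exact congrArg (fun L => L g) hT
  · rw [ContinuousAlternatingMap.map_coord_zero _ (0 : Fin (k + 1 + 1)), mul_zero]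
    simpa [Fin.removeNth] using hP

/-- Only the first term of the sum lacks P v = 0 as an argument, so pairing such a v with other
vectors sees nothing but its covector. -/
theorem omegaCoord_cons_of_jetProjCoord_eq_zero {v : JetMomSpace (k + 1) F}
    (hP : jetProjCoord (k + 1) F v = 0) (x : Fin (k + 1 + 1) → JetMomSpace (k + 1) F) :
    omegaCoord k F (Fin.cons v x) = -wedgeStdVolume (G := F × (Euc (k + 1) →L[ℝ] F))
      (tulczyjewCovector v) (fun j => jetProjCoord (k + 1) F (x j)) := by
  rw [omegaCoord_apply, Fin.sum_univ_succ, Finset.sum_eq_zero, add_zero]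
  · simp
  · intro i _
    rw [ContinuousAlternatingMap.map_coord_zero _ (0 : Fin (k + 1 + 1)), mul_zero]
    simpa [Fin.removeNth] using hP

/-! ### The linear subspace generated by the second derivative of g -/

section Generating

variable {g : Euc (k + 1) × (F × (Euc (k + 1) →L[ℝ] F)) → ℝ}
  {y : Euc (k + 1) × (F × (Euc (k + 1) →L[ℝ] F))}

variable (g y) in
/-- The subspace `p^i_{αi} du^α + p^i_α du^α_i = D(∂g)`, the restriction to vertical vectors of
the second derivative of `g`. -/
def generatedSubspace : Submodule ℝ (JetMomSpace (k + 1) F) where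
  carrier := {v | verticalCovector k F v =
    (fderiv ℝ (fderiv ℝ g) y (jetProjCoord (k + 1) F v)).comp (ContinuousLinearMap.inr ℝ _ _)}
  add_mem' {v w} hv hw := by
    simp only [mem_ofPred_eq, map_add, ContinuousLinearMap.add_comp] at *
    rw [hv, hw]
  zero_mem' := by simp
  smul_mem' t v hv := by
    simp only [mem_ofPred_eq, map_smul, ContinuousLinearMap.smul_comp] at *
    rw [hv]

theorem mem_generatedSubspace {v : JetMomSpace (k + 1) F} : v ∈ generatedSubspace g y ↔
    verticalCovector k F v = (fderiv ℝ (fderiv ℝ g) y (jetProjCoord (k + 1) F v)).comp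
      (ContinuousLinearMap.inr ℝ _ _) := Iff.rfl

/-- The lift with zero momenta has the right projection; adding a value of the section R fixes its
vertical covector without moving that projection. -/
theorem exists_mem_generatedSubspace (x : Euc (k + 1) × (F × (Euc (k + 1) →L[ℝ] F))) :
    ∃ v ∈ generatedSubspace g y, jetProjCoord (k + 1) F v = x := by
  obtain ⟨R, hR, hR'⟩ := exists_section_verticalCovector k F
  let q := (fderiv ℝ (fderiv ℝ g) y x).comp
    (ContinuousLinearMap.inr ℝ (Euc (k + 1)) (F × (Euc (k + 1) →L[ℝ] F)))
  have h : jetProjCoord (k + 1) F (zeroMomenta x + R q) = x := by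
    rw [map_add, hR, jetProjCoord_zeroMomenta, add_zero]
  refine ⟨_, ?_, h⟩
  rw [mem_generatedSubspace, h, map_add, hR', verticalCovector_zeroMomenta, zero_add]

/-- On this subspace each covector agrees with the second derivative of g on vertical vectors, and
after wedging with d^m x nothing else is seen. The sum is then the one that vanishes by d² = 0. -/
theorem omegaCoord_generatedSubspace (hg : ContDiffAt ℝ ∞ g y)
    (v : Fin (k + 1 + 1 + 1) → JetMomSpace (k + 1) F) (hv : ∀ i, v i ∈ generatedSubspace g y) :
    omegaCoord k F v = 0 := by
  have h1 : ∀ i, wedgeStdVolume (G := F × (Euc (k + 1) →L[ℝ] F)) (tulczyjewCovector (v i)) =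
      wedgeStdVolume (fderiv ℝ (fderiv ℝ g) y (jetProjCoord (k + 1) F (v i))) := fun i =>
    wedgeStdVolume_congr_iff.2 fun w => congrArg (fun T => T w) (hv i)
  rw [omegaCoord_apply, neg_eq_zero]
  simp only [h1]
  exact sum_wedgeStdVolume_fderiv_fderiv hg fun i => jetProjCoord (k + 1) F (v i)

/-- Maximality: the subspace projects onto everything, so P v can be cancelled by an element a of
it. By isotropy v - a is still orthogonal, and then Ω̃ sees only its vertical covector. -/
theorem exists_sub_mem_of_omegaCoord_eq_zero (hg : ContDiffAt ℝ ∞ g y)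
    (v : JetMomSpace (k + 1) F)
    (hv : ∀ x : Fin (k + 1 + 1) → JetMomSpace (k + 1) F, (∀ i, x i ∈ generatedSubspace g y) →
      omegaCoord k F (Fin.cons v x) = 0) :
    ∃ a ∈ generatedSubspace g y, jetProjCoord (k + 1) F (v - a) = 0 ∧
      verticalCovector k F (v - a) = 0 := by
  obtain ⟨a, ha, hav⟩ := exists_mem_generatedSubspace (g := g) (y := y) (jetProjCoord (k + 1) F v)
  have hP : jetProjCoord (k + 1) F (v - a) = 0 := by rw [map_sub, hav, sub_self]
  refine ⟨a, ha, hP, ContinuousLinearMap.ext fun w => ?_⟩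
  -- The test vectors lie over the vertical vector w and the standard frame, where a ∧ d^m x takes
  -- the value a(0, w).
  choose x hx hxw using fun i => exists_mem_generatedSubspace (g := g) (y := y)
    ((Fin.cons ((0 : Euc (k + 1)), w) (stdFrame (k + 1) (F × (Euc (k + 1) →L[ℝ] F))) :
      Fin (k + 1 + 1) → Euc (k + 1) × (F × (Euc (k + 1) →L[ℝ] F))) i)
  have h1 : omegaCoord k F (Fin.cons (v - a) x) = 0 := by
    have h2 : ∀ i, (Fin.cons a x : Fin (k + 1 + 1 + 1) → JetMomSpace (k + 1) F) i ∈
        generatedSubspace g y := by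
      intro i
      refine Fin.cases ?_ (fun j => ?_) i
      · rw [Fin.cons_zero]
        exact ha
      · rw [Fin.cons_succ]
        exact hx j
    rw [cons_sub_apply, hv x hx, omegaCoord_generatedSubspace hg _ h2, sub_zero]
  rw [omegaCoord_cons_of_jetProjCoord_eq_zero hP] at h1
  simp only [hxw] at h1
  rw [wedgeStdVolume_cons_stdFrame, neg_eq_zero] at h1
  exact h1

end Generating

end LinearModel

theorem eq_smul_stdVolume {m : ℕ} (a : Euc m [⋀^Fin m]→L[ℝ] ℝ) :
    a = a (fun i => EuclideanSpace.single i 1) • stdVolume m := by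
  refine ContinuousAlternatingMap.toAlternatingMap_injective ?_
  have h := a.toAlternatingMap.eq_smul_basis_det (EuclideanSpace.basisFun (Fin m) ℝ).toBasis
  have h2 : ((EuclideanSpace.basisFun (Fin m) ℝ).toBasis : Fin m → Euc m) =
      fun i => EuclideanSpace.single i (1 : ℝ) := by
    funext i
    simp
  rw [h2] at h
  exact h

theorem dmap_symm_apply {V X : Type*} [NormedAddCommGroup V] [NormedSpace ℝ V]
    [TopologicalSpace X] [ChartedSpace V X] [IsManifold 𝓘(ℝ, V) ∞ X]
    {φ : OpenPartialHomeomorph X V} (hφ : φ ∈ IsManifold.maximalAtlas 𝓘(ℝ, V) ∞ X) {x : X}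
    (hx : x ∈ φ.source) (v : V) : dmap V V φ x (dmap V V φ.symm (φ x) v) = v := by
  have h := dmap_chart_comp_symm hφ (φ.map_source hx)
  rw [φ.left_inv hx] at h
  exact congrArg (fun T : V →L[ℝ] V => T v) h

theorem compContinuousLinearMap_dmap_inj {V X : Type*} [NormedAddCommGroup V] [NormedSpace ℝ V]
    [TopologicalSpace X] [ChartedSpace V X] [IsManifold 𝓘(ℝ, V) ∞ X]
    {φ : OpenPartialHomeomorph X V} (hφ : φ ∈ IsManifold.maximalAtlas 𝓘(ℝ, V) ∞ X) {x : X}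
    (hx : x ∈ φ.source) {n : ℕ} {a b : V [⋀^Fin n]→L[ℝ] ℝ} :
    a.compContinuousLinearMap (dmap V V φ x) = b.compContinuousLinearMap (dmap V V φ x) ↔
      a = b := by
  refine ⟨fun h => ContinuousAlternatingMap.ext fun v => ?_, fun h => h ▸ rfl⟩
  have h1 : a (fun i => dmap V V φ x (dmap V V φ.symm (φ x) (v i))) =
      b (fun i => dmap V V φ x (dmap V V φ.symm (φ x) (v i))) :=
    congrArg (fun a => a fun i => dmap V V φ.symm (φ x) (v i)) h
  simpa only [dmap_symm_apply hφ hx] using h1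

/-! ### The Lagrangian density and the local equations of S_ℒ -/

section LagrangianDensity

variable {k : ℕ} {F : Type*} [NormedAddCommGroup F] [NormedSpace ℝ F] [FiniteDimensional ℝ F]
  {M E : Type*} [TopologicalSpace M] [ChartedSpace (Euc (k + 1)) M]
  [IsManifold 𝓘(ℝ, Euc (k + 1)) ∞ M]
  [TopologicalSpace E] [ChartedSpace (Euc (k + 1) × F) E]
  [IsManifold 𝓘(ℝ, Euc (k + 1) × F) ∞ E] {π : E → M} [IsFibered (Euc (k + 1)) F π]

/-- The chart of `J¹π` induced by adapted coordinates. -/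
abbrev jetChart (c : FiberedChart (Euc (k + 1)) F π) :
    OpenPartialHomeomorph (J1 (Euc (k + 1)) F π)
      (Euc (k + 1) × (F × (Euc (k + 1) →L[ℝ] F))) :=
  (J1.fiberedChart c).total

theorem jetChart_mem (c : FiberedChart (Euc (k + 1)) F π) :
    jetChart c ∈ IsManifold.maximalAtlas 𝓘(ℝ, Euc (k + 1) × (F × (Euc (k + 1) →L[ℝ] F))) ∞
      (J1 (Euc (k + 1)) F π) :=
  (J1.fiberedChart c).total_mem

/-- The coefficient of the Lagrangian density `L η = g d^m x` in adapted coordinates. -/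
def lagrangianCoeff (c : FiberedChart (Euc (k + 1)) F π) (L : J1 (Euc (k + 1)) F π → ℝ)
    (η : M → Euc (k + 1) [⋀^Fin (k + 1)]→L[ℝ] ℝ)
    (y : Euc (k + 1) × (F × (Euc (k + 1) →L[ℝ] F))) : ℝ :=
  L ((jetChart c).symm y) * inChart c.base η y.1 fun i => EuclideanSpace.single i 1

theorem fst_mem_base_target (c : FiberedChart (Euc (k + 1)) F π)
    {y : Euc (k + 1) × (F × (Euc (k + 1) →L[ℝ] F))} (hy : y ∈ (jetChart c).target) :
    y.1 ∈ c.base.target := by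
  rw [← (J1.fiberedChart c).base_proj hy]
  exact c.base.map_source ((J1.fiberedChart c).mapsTo _ ((jetChart c).map_target hy))

/-- The projection to M is (x, u, u_x) ↦ x in the charts, and a top-degree form on the base is a
function times d^m x, so the density is a single function times the pulled-back d^m x. -/
theorem inChart_lagrangianForm (c : FiberedChart (Euc (k + 1)) F π)
    (L : J1 (Euc (k + 1)) F π → ℝ) (η : M → Euc (k + 1) [⋀^Fin (k + 1)]→L[ℝ] ℝ)
    {y : Euc (k + 1) × (F × (Euc (k + 1) →L[ℝ] F))} (hy : y ∈ (jetChart c).target) :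
    inChart (jetChart c) (lagrangianForm π L η) y = lagrangianCoeff c L η y •
      (stdVolume (k + 1)).compContinuousLinearMap
        (ContinuousLinearMap.fst ℝ (Euc (k + 1)) (F × (Euc (k + 1) →L[ℝ] F))) := by
  have h1 := (J1.fiberedChart c).dmap_proj_comp_symm hy
  have h2 : J1.toBase ((jetChart c).symm y) = c.base.symm y.1 := by
    rw [← (J1.fiberedChart c).base_proj hy]
    exact (c.base.left_inv ((J1.fiberedChart c).mapsTo _ ((jetChart c).map_target hy))).symm
  have h3 := eq_smul_stdVolume (inChart c.base η y.1)
  refine ContinuousAlternatingMap.ext fun v => ?_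
  have h4 : inChart (jetChart c) (lagrangianForm π L η) y v = L ((jetChart c).symm y) *
      η (J1.toBase ((jetChart c).symm y)) (fun i => ((dmap _ (Euc (k + 1))
        (J1.toBase : J1 (Euc (k + 1)) F π → M) ((jetChart c).symm y)).comp
          (dmap _ _ (jetChart c).symm y)) (v i)) := rfl
  rw [h4, h1, h2]
  have h5 := congrArg (fun a => a fun i => (v i).1) h3
  exact (congrArg (L ((jetChart c).symm y) * ·) h5).trans (mul_assoc _ _ _).symm

theorem contDiffAt_lagrangianCoeff (c : FiberedChart (Euc (k + 1)) F π)
    {L : J1 (Euc (k + 1)) F π → ℝ}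
    (hL : ContMDiff 𝓘(ℝ, Euc (k + 1) × (F × (Euc (k + 1) →L[ℝ] F))) 𝓘(ℝ, ℝ) ∞ L)
    {η : M → Euc (k + 1) [⋀^Fin (k + 1)]→L[ℝ] ℝ} (hη : IsSmoothForm η)
    {y : Euc (k + 1) × (F × (Euc (k + 1) →L[ℝ] F))} (hy : y ∈ (jetChart c).target) :
    ContDiffAt ℝ ∞ (lagrangianCoeff c L η) y := by
  have h1 : ContDiffAt ℝ ∞ (L ∘ (jetChart c).symm) y := by
    rw [← contMDiffAt_iff_contDiffAt]
    exact hL.contMDiffAt.comp y (contMDiffAt_symm_of_mem_maximalAtlas (jetChart_mem c) hy)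
  have hy1 := fst_mem_base_target c hy
  have h2 : ContDiffAt ℝ ∞ (inChart c.base η) y.1 := by
    have := (isSmoothForm_iff.1 hη (c.base.symm y.1)).contDiffAt c.base_mem
      (c.base.map_target hy1)
    rwa [c.base.right_inv hy1] at this
  have h3 : ContDiffAt ℝ ∞ (fun y : Euc (k + 1) × (F × (Euc (k + 1) →L[ℝ] F)) =>
      inChart c.base η y.1 fun i => EuclideanSpace.single i 1) y :=
    ContDiffAt.comp (g := ContinuousAlternatingMap.apply ℝ (Euc (k + 1)) ℝ
      (fun i : Fin (k + 1) => EuclideanSpace.single i (1 : ℝ))) y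
      (ContinuousLinearMap.contDiff _).contDiffAt (h2.comp y contDiffAt_fst)
  exact h1.mul h3

theorem smoothFormAt_lagrangianForm {L : J1 (Euc (k + 1)) F π → ℝ}
    (hL : ContMDiff 𝓘(ℝ, Euc (k + 1) × (F × (Euc (k + 1) →L[ℝ] F))) 𝓘(ℝ, ℝ) ∞ L)
    {η : M → Euc (k + 1) [⋀^Fin (k + 1)]→L[ℝ] ℝ} (hη : IsSmoothForm η)
    (z : J1 (Euc (k + 1)) F π) : SmoothFormAt (lagrangianForm π L η) z := by
  obtain ⟨c, hc⟩ := FiberedChart.exists_mem (B := Euc (k + 1)) (F := F) (π := π) z.pt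
  have hz : z ∈ (jetChart c).source := hc
  have hy := (jetChart c).map_source hz
  refine ⟨jetChart c, jetChart_mem c, hz, ?_⟩
  have h : ContDiffAt ℝ ∞ (fun y => lagrangianCoeff c L η y •
      (stdVolume (k + 1)).compContinuousLinearMap
        (ContinuousLinearMap.fst ℝ (Euc (k + 1)) (F × (Euc (k + 1) →L[ℝ] F)))) (jetChart c z) :=
    ContDiffAt.comp (g := ContinuousLinearMap.toSpanSingleton ℝ
      ((stdVolume (k + 1)).compContinuousLinearMap
        (ContinuousLinearMap.fst ℝ (Euc (k + 1)) (F × (Euc (k + 1) →L[ℝ] F))))) _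
      (ContinuousLinearMap.contDiff _).contDiffAt (contDiffAt_lagrangianCoeff c hL hη hy)
  exact h.congr_of_eventuallyEq (Filter.eventually_of_mem
    ((jetChart c).open_target.mem_nhds hy) fun y hy => inChart_lagrangianForm c L η hy)

theorem dform_lagrangianForm (c : FiberedChart (Euc (k + 1)) F π) {L : J1 (Euc (k + 1)) F π → ℝ}
    (hL : ContMDiff 𝓘(ℝ, Euc (k + 1) × (F × (Euc (k + 1) →L[ℝ] F))) 𝓘(ℝ, ℝ) ∞ L)
    {η : M → Euc (k + 1) [⋀^Fin (k + 1)]→L[ℝ] ℝ} (hη : IsSmoothForm η)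
    {z : J1 (Euc (k + 1)) F π} (hz : z ∈ (jetChart c).source) :
    dform (lagrangianForm π L η) z =
      (wedgeStdVolume (fderiv ℝ (lagrangianCoeff c L η) (jetChart c z))).compContinuousLinearMap
        (dmap _ _ (jetChart c) z) := by
  have hy := (jetChart c).map_source hz
  have h : inChart (jetChart c) (lagrangianForm π L η) =ᶠ[𝓝 (jetChart c z)] fun y =>
      lagrangianCoeff c L η y • (stdVolume (k + 1)).compContinuousLinearMap
        (ContinuousLinearMap.fst ℝ (Euc (k + 1)) (F × (Euc (k + 1) →L[ℝ] F))) :=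
    Filter.eventually_of_mem ((jetChart c).open_target.mem_nhds hy)
      fun y hy => inChart_lagrangianForm c L η hy
  rw [dform_eq (smoothFormAt_lagrangianForm hL hη z) (jetChart_mem c) hz, h.extDeriv_eq,
    extDeriv_smul_stdVolume ((contDiffAt_lagrangianCoeff c hL hη hy).differentiableAt (by simp))]

/-- In coordinates, `S_ℒ` is given by `p^i_{αi} = ∂g/∂u^α`, `p^i_α = ∂g/∂u^α_i`. -/
theorem mem_lagrangianSet_iff (c : FiberedChart (Euc (k + 1)) F π) {L : J1 (Euc (k + 1)) F π → ℝ}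
    (hL : ContMDiff 𝓘(ℝ, Euc (k + 1) × (F × (Euc (k + 1) →L[ℝ] F))) 𝓘(ℝ, ℝ) ∞ L)
    {η : M → Euc (k + 1) [⋀^Fin (k + 1)]→L[ℝ] ℝ} (hη : IsSmoothForm η)
    {z : JetMom (k + 1) F π} (hz : z ∈ (jetMomChart c).source) :
    z ∈ lagrangianSet π L η ↔ verticalCovector k F (jetMomChart c z) =
      (fderiv ℝ (lagrangianCoeff c L η) (jetProjCoord (k + 1) F (jetMomChart c z))).comp
        (ContinuousLinearMap.inr ℝ _ _) := by
  have hz' : z.pt.pt ∈ c.total.source := hz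
  have hp : jetProj z ∈ (jetChart c).source := hz'
  have h1 : jetChart c (jetProj z) = jetProjCoord (k + 1) F (jetMomChart c z) :=
    fiberedChart_total_jetProj c z hz'
  have h2 : z ∈ lagrangianSet π L η ↔ (tulczyjew π z).form =
    dform (lagrangianForm π L η) (tulczyjew π z).pt := Iff.rfl
  rw [h2, tulczyjew_eq c z hz']
  have h3 : (tulczyjewIn c z hz').pt = jetProj z := rfl
  have h4 : (tulczyjewIn c z hz').form = (wedgeStdVolume (G := F × (Euc (k + 1) →L[ℝ] F))
    (tulczyjewCovector (jetMomChart c z))).compContinuousLinearMap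
      (dmap _ _ (jetChart c) (jetProj z)) := rfl
  rw [h3, h4, dform_lagrangianForm c hL hη hp, h1]
  -- The invertible differential of the chart cancels, and equality of the two wedge products is
  -- equality of the vertical covectors.
  rw [compContinuousLinearMap_dmap_inj (jetChart_mem c) hp, wedgeStdVolume_congr_iff, ContinuousLinearMap.ext_iff]
  rfl

end LagrangianDensity

/-! ### Straightening a set given by an equation T w = f (P w) -/

section Submanifolds

variable {V X : Type*} [NormedAddCommGroup V] [NormedSpace ℝ V] [FiniteDimensional ℝ V]
  [TopologicalSpace X] [ChartedSpace V X] [IsManifold 𝓘(ℝ, V) ∞ X]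
  {Y Q : Type*} [NormedAddCommGroup Y] [NormedSpace ℝ Y] [NormedAddCommGroup Q] [NormedSpace ℝ Q]

theorem contDiffOn_continuousLinearMap_comp {U : Type*} [NormedAddCommGroup U] [NormedSpace ℝ U]
    (T : Y →L[ℝ] Q) {f : U → Y} {s : Set U} (hf : ContDiffOn ℝ ∞ f s) :
    ContDiffOn ℝ ∞ (fun x => T (f x)) s := T.contDiff.comp_contDiffOn hf

/-- A subset that is given by an equation `T w = f (P w)` in a chart, where the linear map `T` has
a right inverse with values in the kernel of `P`, is a linear subspace in another chart. -/
theorem exists_chart_of_eq {S : Set X} {φ : OpenPartialHomeomorph X V}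
    (hφ : φ ∈ IsManifold.maximalAtlas 𝓘(ℝ, V) ∞ X) {P : V →L[ℝ] Y} {T : V →L[ℝ] Q}
    {R : Q →L[ℝ] V} (hPR : ∀ q, P (R q) = 0) (hTR : ∀ q, T (R q) = q) {f : Y → Q} {O : Set Y}
    (hO : IsOpen O) (hf : ContDiffOn ℝ ∞ f O) (hφO : ∀ q ∈ φ.source, P (φ q) ∈ O)
    (hS : ∀ q ∈ φ.source, q ∈ S ↔ T (φ q) = f (P (φ q))) :
    ∃ ψ ∈ IsManifold.maximalAtlas 𝓘(ℝ, V) ∞ X, ψ.source = φ.source ∧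
      (∀ q ∈ φ.source, q ∈ S ↔ ψ q ∈ LinearMap.ker T.toLinearMap) ∧
      ∀ p ∈ φ.source, ∀ v, dmap V V ψ p v ∈ LinearMap.ker T.toLinearMap ↔
        T (dmap V V φ p v) = fderiv ℝ f (P (φ p)) (P (dmap V V φ p v)) := by
  -- Since T ∘ R = id, the map T sends the sheared point w - R (f (P w)) to T w - f (P w), so the
  -- equation becomes linear.
  let e := shear P R hPR f hO hf
  have he : e ∈ contDiffGroupoid ∞ 𝓘(ℝ, V) := shear_mem_contDiffGroupoid P R hPR f hO hf
  refine ⟨φ.trans e, trans_mem_maximalAtlas hφ he, ?_, fun q hq => ?_, fun p hp v => ?_⟩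
  · rw [OpenPartialHomeomorph.trans_source]
    exact inter_eq_left.2 fun q hq => hφO q hq
  · have h : (φ.trans e) q = φ q - R (f (P (φ q))) := rfl
    rw [hS q hq, h, LinearMap.mem_ker, ContinuousLinearMap.coe_coe, map_sub, hTR, sub_eq_zero]
  · have h1 : HasFDerivAt e (ContinuousLinearMap.id ℝ V -
        R.comp ((fderiv ℝ f (P (φ p))).comp P)) (φ p) := by
      have hf' : HasFDerivAt f (fderiv ℝ f (P (φ p))) (P (φ p)) :=
        ((hf.contDiffAt (hO.mem_nhds (hφO p hp))).differentiableAt (by simp)).hasFDerivAt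
      exact (hasFDerivAt_id (φ p)).sub
        (R.hasFDerivAt.comp (φ p) (hf'.comp (φ p) P.hasFDerivAt))
    have h2 : dmap V V (φ.trans e) p = (fderiv ℝ e (φ p)).comp (dmap V V φ p) := by
      have h3 : dmap V V e (φ p) = fderiv ℝ e (φ p) := mfderiv_eq_fderiv
      rw [← h3]
      exact dmap_comp h1.differentiableAt.mdifferentiableAt (mdiff_chart hφ hp)
    rw [h2, h1.fderiv, LinearMap.mem_ker, ContinuousLinearMap.coe_coe]
    simp only [ContinuousLinearMap.comp_apply, sub_apply, ContinuousLinearMap.id_apply, map_sub,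
      hTR, sub_eq_zero]

end Submanifolds

/-! ### S_ℒ as a Lagrangian submanifold -/

section LagrangianSubmanifold

variable {k : ℕ} {F : Type*} [NormedAddCommGroup F] [NormedSpace ℝ F] [FiniteDimensional ℝ F]
  {M E : Type*} [TopologicalSpace M] [ChartedSpace (Euc (k + 1)) M]
  [IsManifold 𝓘(ℝ, Euc (k + 1)) ∞ M]
  [TopologicalSpace E] [ChartedSpace (Euc (k + 1) × F) E]
  [IsManifold 𝓘(ℝ, Euc (k + 1) × F) ∞ E] {π : E → M} [IsFibered (Euc (k + 1)) F π]

variable (k F) in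
/-- The restriction of covectors to vertical vectors. -/
def restrictVertical : (Euc (k + 1) × (F × (Euc (k + 1) →L[ℝ] F)) →L[ℝ] ℝ) →L[ℝ]
    (F × (Euc (k + 1) →L[ℝ] F)) →L[ℝ] ℝ :=
  (ContinuousLinearMap.compL ℝ (F × (Euc (k + 1) →L[ℝ] F))
    (Euc (k + 1) × (F × (Euc (k + 1) →L[ℝ] F))) ℝ).flip (ContinuousLinearMap.inr ℝ _ _)

theorem restrictVertical_apply (a : Euc (k + 1) × (F × (Euc (k + 1) →L[ℝ] F)) →L[ℝ] ℝ) :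
    restrictVertical k F a = a.comp (ContinuousLinearMap.inr ℝ _ _) := rfl

theorem contDiffAt_fderiv_lagrangianCoeff (c : FiberedChart (Euc (k + 1)) F π)
    {L : J1 (Euc (k + 1)) F π → ℝ}
    (hL : ContMDiff 𝓘(ℝ, Euc (k + 1) × (F × (Euc (k + 1) →L[ℝ] F))) 𝓘(ℝ, ℝ) ∞ L)
    {η : M → Euc (k + 1) [⋀^Fin (k + 1)]→L[ℝ] ℝ} (hη : IsSmoothForm η)
    {y : Euc (k + 1) × (F × (Euc (k + 1) →L[ℝ] F))} (hy : y ∈ (jetChart c).target) :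
    ContDiffAt ℝ ∞ (fderiv ℝ (lagrangianCoeff c L η)) y :=
  (contDiffAt_lagrangianCoeff c hL hη hy).fderiv_right (m := ∞) (by simp)

/-- The function `∂g` defining `S_ℒ` in coordinates. -/
def verticalDerivative (c : FiberedChart (Euc (k + 1)) F π) (L : J1 (Euc (k + 1)) F π → ℝ)
    (η : M → Euc (k + 1) [⋀^Fin (k + 1)]→L[ℝ] ℝ)
    (y : Euc (k + 1) × (F × (Euc (k + 1) →L[ℝ] F))) : (F × (Euc (k + 1) →L[ℝ] F)) →L[ℝ] ℝ :=
  restrictVertical k F (fderiv ℝ (lagrangianCoeff c L η) y)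

theorem contDiffOn_verticalDerivative (c : FiberedChart (Euc (k + 1)) F π)
    {L : J1 (Euc (k + 1)) F π → ℝ}
    (hL : ContMDiff 𝓘(ℝ, Euc (k + 1) × (F × (Euc (k + 1) →L[ℝ] F))) 𝓘(ℝ, ℝ) ∞ L)
    {η : M → Euc (k + 1) [⋀^Fin (k + 1)]→L[ℝ] ℝ} (hη : IsSmoothForm η) :
    ContDiffOn ℝ ∞ (verticalDerivative c L η) (jetChart c).target :=
  contDiffOn_continuousLinearMap_comp (U := Euc (k + 1) × (F × (Euc (k + 1) →L[ℝ] F)))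
    (Y := Euc (k + 1) × (F × (Euc (k + 1) →L[ℝ] F)) →L[ℝ] ℝ)
    (Q := (F × (Euc (k + 1) →L[ℝ] F)) →L[ℝ] ℝ) (restrictVertical k F)
    (f := fderiv ℝ (lagrangianCoeff c L η)) fun _ hy => (contDiffAt_fderiv_lagrangianCoeff c hL hη hy).contDiffWithinAt

theorem fderiv_verticalDerivative (c : FiberedChart (Euc (k + 1)) F π)
    {L : J1 (Euc (k + 1)) F π → ℝ}
    (hL : ContMDiff 𝓘(ℝ, Euc (k + 1) × (F × (Euc (k + 1) →L[ℝ] F))) 𝓘(ℝ, ℝ) ∞ L)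
    {η : M → Euc (k + 1) [⋀^Fin (k + 1)]→L[ℝ] ℝ} (hη : IsSmoothForm η)
    {y : Euc (k + 1) × (F × (Euc (k + 1) →L[ℝ] F))} (hy : y ∈ (jetChart c).target) :
    fderiv ℝ (verticalDerivative c L η) y =
      (restrictVertical k F).comp (fderiv ℝ (fderiv ℝ (lagrangianCoeff c L η)) y) :=
  (hasFDerivAt_continuousLinearMap_comp (X := Euc (k + 1) × (F × (Euc (k + 1) →L[ℝ] F)))
    (Y := Euc (k + 1) × (F × (Euc (k + 1) →L[ℝ] F)) →L[ℝ] ℝ)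
    (Z := (F × (Euc (k + 1) →L[ℝ] F)) →L[ℝ] ℝ) (restrictVertical k F)
    (f := fderiv ℝ (lagrangianCoeff c L η))
    ((contDiffAt_fderiv_lagrangianCoeff c hL hη hy).differentiableAt (by simp)).hasFDerivAt).fderiv

theorem jetProjCoord_mem_target (c : FiberedChart (Euc (k + 1)) F π) {q : JetMom (k + 1) F π}
    (hq : q ∈ (jetMomChart c).source) :
    jetProjCoord (k + 1) F (jetMomChart c q) ∈ (jetChart c).target := by
  have hp : jetProj q ∈ (jetChart c).source := hq
  have h : jetChart c (jetProj q) = jetProjCoord (k + 1) F (jetMomChart c q) :=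
    fiberedChart_total_jetProj c q hq
  rw [← h]
  exact (jetChart c).map_source hp

theorem mem_lagrangianSet_iff_verticalDerivative (c : FiberedChart (Euc (k + 1)) F π)
    {L : J1 (Euc (k + 1)) F π → ℝ}
    (hL : ContMDiff 𝓘(ℝ, Euc (k + 1) × (F × (Euc (k + 1) →L[ℝ] F))) 𝓘(ℝ, ℝ) ∞ L)
    {η : M → Euc (k + 1) [⋀^Fin (k + 1)]→L[ℝ] ℝ} (hη : IsSmoothForm η)
    {q : JetMom (k + 1) F π} (hq : q ∈ (jetMomChart c).source) : q ∈ lagrangianSet π L η ↔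
      verticalCovector k F (jetMomChart c q) =
        verticalDerivative c L η (jetProjCoord (k + 1) F (jetMomChart c q)) := by
  rw [mem_lagrangianSet_iff c hL hη hq, verticalDerivative, restrictVertical_apply]

/-- The equation T w = ∂g(P w) is straightened by the shear along R, and its linearisation at a
point is the subspace generated by the second derivative of g there. -/
theorem exists_chart_lagrangianSet (c : FiberedChart (Euc (k + 1)) F π)
    {L : J1 (Euc (k + 1)) F π → ℝ}
    (hL : ContMDiff 𝓘(ℝ, Euc (k + 1) × (F × (Euc (k + 1) →L[ℝ] F))) 𝓘(ℝ, ℝ) ∞ L)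
    {η : M → Euc (k + 1) [⋀^Fin (k + 1)]→L[ℝ] ℝ} (hη : IsSmoothForm η) :
    ∃ ψ ∈ IsManifold.maximalAtlas 𝓘(ℝ, JetMomSpace (k + 1) F) ∞ (JetMom (k + 1) F π),
      ψ.source = (jetMomChart c).source ∧
      (∀ q ∈ (jetMomChart c).source, q ∈ lagrangianSet π L η ↔
        ψ q ∈ LinearMap.ker (verticalCovector k F).toLinearMap) ∧
      ∀ p ∈ (jetMomChart c).source, ∀ v,
        dmap (JetMomSpace (k + 1) F) (JetMomSpace (k + 1) F) ψ p v ∈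
          LinearMap.ker (verticalCovector k F).toLinearMap ↔
        dmap (JetMomSpace (k + 1) F) (JetMomSpace (k + 1) F) (jetMomChart c) p v ∈
          generatedSubspace (lagrangianCoeff c L η)
            (jetProjCoord (k + 1) F (jetMomChart c p)) := by
  obtain ⟨R, hPR, hTR⟩ := exists_section_verticalCovector k F
  obtain ⟨ψ, hψ, h1, h2, h3⟩ := exists_chart_of_eq (V := JetMomSpace (k + 1) F)
    (X := JetMom (k + 1) F π) (Y := Euc (k + 1) × (F × (Euc (k + 1) →L[ℝ] F)))
    (Q := (F × (Euc (k + 1) →L[ℝ] F)) →L[ℝ] ℝ) (jetMomChart_mem c) hPR hTR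
    (jetChart c).open_target (contDiffOn_verticalDerivative c hL hη)
    (fun q hq => jetProjCoord_mem_target c hq)
    (fun q hq => mem_lagrangianSet_iff_verticalDerivative c hL hη hq)
  refine ⟨ψ, hψ, h1, h2, fun p hp v => (h3 p hp v).trans ?_⟩
  rw [mem_generatedSubspace, fderiv_verticalDerivative c hL hη (jetProjCoord_mem_target c hp)]
  rfl

theorem mem_tangentSubspace_lagrangianSet_iff (c : FiberedChart (Euc (k + 1)) F π)
    {L : J1 (Euc (k + 1)) F π → ℝ}
    (hL : ContMDiff 𝓘(ℝ, Euc (k + 1) × (F × (Euc (k + 1) →L[ℝ] F))) 𝓘(ℝ, ℝ) ∞ L)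
    {η : M → Euc (k + 1) [⋀^Fin (k + 1)]→L[ℝ] ℝ} (hη : IsSmoothForm η)
    {z : JetMom (k + 1) F π} (hz : z ∈ (jetMomChart c).source) (hzS : z ∈ lagrangianSet π L η)
    (v : JetMomSpace (k + 1) F) :
    v ∈ tangentSubspace (JetMomSpace (k + 1) F) (lagrangianSet π L η) z ↔
      dmap (JetMomSpace (k + 1) F) (JetMomSpace (k + 1) F) (jetMomChart c) z v ∈
        generatedSubspace (lagrangianCoeff c L η)
          (jetProjCoord (k + 1) F (jetMomChart c z)) := by
  obtain ⟨ψ, hψ, h1, h2, h3⟩ := exists_chart_lagrangianSet c hL hη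
  rw [← h3 z hz, mem_tangentSubspace_iff hψ (by rwa [h1]) (by rwa [h1]) hzS]

/-- The set `S_ℒ` is an `(m+1)`-Lagrangian submanifold of `J¹(π ∘ ν)`. -/
theorem isLagrangianSubmanifold_lagrangianSet {L : J1 (Euc (k + 1)) F π → ℝ}
    (hL : ContMDiff 𝓘(ℝ, Euc (k + 1) × (F × (Euc (k + 1) →L[ℝ] F))) 𝓘(ℝ, ℝ) ∞ L)
    {η : M → Euc (k + 1) [⋀^Fin (k + 1)]→L[ℝ] ℝ} (hη : IsSmoothForm η) :
    IsLagrangianSubmanifold (omegaTilde (m := k + 1) (F := F) π) (k + 1 + 1)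
      (lagrangianSet (m := k + 1) (F := F) π L η) := by
  constructor
  -- The model subspace ker T is the same in all straightened charts, hence the dimension is
  -- constant.
  · refine ⟨Module.finrank ℝ (LinearMap.ker (verticalCovector k F).toLinearMap), fun z hz => ?_⟩
    obtain ⟨c, hc⟩ := FiberedChart.exists_mem (B := Euc (k + 1)) (F := F) (π := π) z.pt.pt
    obtain ⟨ψ, hψ, h1, h2, -⟩ := exists_chart_lagrangianSet c hL hη
    refine ⟨ψ, hψ, ?_, _, rfl, ?_⟩
    · rw [h1]
      exact hc
    · rwa [h1]
  · intro z hzS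
    obtain ⟨c, hc⟩ := FiberedChart.exists_mem (B := Euc (k + 1)) (F := F) (π := π) z.pt.pt
    have hz : z ∈ (jetMomChart c).source := hc
    have hp : jetProj z ∈ (jetChart c).source := hc
    have hy : jetChart c (jetProj z) = jetProjCoord (k + 1) F (jetMomChart c z) :=
      fiberedChart_total_jetProj c z hc
    have hg : ContDiffAt ℝ ∞ (lagrangianCoeff c L η)
        (jetProjCoord (k + 1) F (jetMomChart c z)) := by
      rw [← hy]
      exact contDiffAt_lagrangianCoeff c hL hη ((jetChart c).map_source hp)
    have hT := mem_tangentSubspace_lagrangianSet_iff c hL hη hz hzS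
    have hΩ : ∀ v, omegaTilde π z v = omegaCoord k F fun i =>
        dmap (JetMomSpace (k + 1) F) (JetMomSpace (k + 1) F) (jetMomChart c) z (v i) := by
      intro v
      rw [omegaTilde_eq_omegaCoord c hz]
      rfl
    have hD := dmap_symm_apply (jetMomChart_mem c) hz
    have hcons : ∀ v (x : Fin (k + 1 + 1) → JetMomSpace (k + 1) F), (fun i =>
        dmap (JetMomSpace (k + 1) F) (JetMomSpace (k + 1) F) (jetMomChart c) z
          ((Fin.cons v x : Fin (k + 1 + 1 + 1) → JetMomSpace (k + 1) F) i)) =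
        Fin.cons (dmap (JetMomSpace (k + 1) F) (JetMomSpace (k + 1) F) (jetMomChart c) z v)
          fun i => dmap (JetMomSpace (k + 1) F) (JetMomSpace (k + 1) F) (jetMomChart c) z (x i) := by
      intro v x
      funext i
      refine Fin.cases ?_ (fun j => ?_) i <;> simp
    refine isLagrangianSubspace_map (fun v hv => ?_) fun v hv => ?_
    · exact (hΩ v).trans (omegaCoord_generatedSubspace hg _ fun i => (hT _).1 (hv i))
    · obtain ⟨a, ha, hPa, hTa⟩ := exists_sub_mem_of_omegaCoord_eq_zero hg
        (dmap (JetMomSpace (k + 1) F) (JetMomSpace (k + 1) F) (jetMomChart c) z v) fun x hx => by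
          -- Test vectors in coordinates are carried back to the manifold by the inverse
          -- differential of the chart, where they are tangent to S_ℒ.
          have h := hv (fun i => dmap (JetMomSpace (k + 1) F) (JetMomSpace (k + 1) F)
            (jetMomChart c).symm (jetMomChart c z) (x i)) fun i => by
              rw [hT, hD]
              exact hx i
          have h' := (hΩ _).symm.trans h
          rw [hcons] at h'
          simpa only [hD] using h'
      refine ⟨dmap (JetMomSpace (k + 1) F) (JetMomSpace (k + 1) F)
        (jetMomChart c).symm (jetMomChart c z) a, ?_, ?_⟩
      · rw [hT, hD]
        exact ha
      -- Radicality is checked in coordinates, where the difference has zero projection and zero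
      -- vertical covector.
      · refine LinearMap.mem_ker.2 (AlternatingMap.ext fun x => ?_)
        refine (hΩ (Fin.cons _ x)).trans ?_
        rw [hcons, map_sub, hD]
        exact omegaCoord_cons_eq_zero hPa hTa _

end LagrangianSubmanifold

end FieldTheory

end

theorem mainTheorem3 (m n : ℕ) (hm : 1 ≤ m)
    {M : Type*} [TopologicalSpace M] [ChartedSpace (EuclideanSpace ℝ (Fin m)) M]
    [IsManifold 𝓘(ℝ, EuclideanSpace ℝ (Fin m)) ∞ M]
    {E : Type*} [TopologicalSpace E]
    [ChartedSpace (EuclideanSpace ℝ (Fin m) × EuclideanSpace ℝ (Fin n)) E]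
    [IsManifold 𝓘(ℝ, EuclideanSpace ℝ (Fin m) × EuclideanSpace ℝ (Fin n)) ∞ E]
    (π : E → M) [FieldTheory.IsFibered (EuclideanSpace ℝ (Fin m)) (EuclideanSpace ℝ (Fin n)) π]
    (hπ : Function.Surjective π)
    (η : M → EuclideanSpace ℝ (Fin m) [⋀^Fin m]→L[ℝ] ℝ) (hη : FieldTheory.IsVolumeForm η)
    (L : FieldTheory.J1 (EuclideanSpace ℝ (Fin m)) (EuclideanSpace ℝ (Fin n)) π → ℝ)
    (hL : ContMDiff 𝓘(ℝ, EuclideanSpace ℝ (Fin m) × (EuclideanSpace ℝ (Fin n) ×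
      (EuclideanSpace ℝ (Fin m) →L[ℝ] EuclideanSpace ℝ (Fin n)))) 𝓘(ℝ, ℝ) ∞ L) :
    FieldTheory.IsPremultisymplectic
      (FieldTheory.omegaTilde (m := m) (F := EuclideanSpace ℝ (Fin n)) π) ∧
    FieldTheory.IsLagrangianSubmanifold
      (FieldTheory.omegaTilde (m := m) (F := EuclideanSpace ℝ (Fin n)) π) (m + 1)
      (FieldTheory.lagrangianSet (m := m) (F := EuclideanSpace ℝ (Fin n)) π L η) := by
  -- Writing m = k + 1 provides a first base coordinate and makes the contraction of an m-form a
  -- form of degree k.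
  obtain ⟨k, rfl⟩ : ∃ k, m = k + 1 := ⟨m - 1, by omega⟩
  exact ⟨FieldTheory.isPremultisymplectic_omegaTilde,
    FieldTheory.isLagrangianSubmanifold_lagrangianSet hL hη.smooth⟩
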